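/- Let $n\ge 1$ and let $\mathcal S^n=\{X\in\mathbb S^n: X\succeq 0,\ \mathrm{Tr}(X)=1\}$ be the spectrahedron in the space $\mathbb S^n$ of real symmetric $n\times n$ matrices. Write $\|\cdot\|_F$ for the Frobenius norm, $\|\cdot\|$ for the spectral norm of a matrix and the Euclidean norm of a vector, $\lambda_1(A)\ge\dots\ge\lambda_n(A)$ for the eigenvalues of $A\in\mathbb S^n$, $\mathrm{Im}(A)$ for its image and $A^\dagger$ for its Moore–Penrose pseudo-inverse. Let $f$ be a real function on matrices that is convex on $\mathcal S^n$ and has at every $X\in\mathcal S^n$ a gradient $\nabla f(X)\in\mathbb S^n$ (the gradient of $f$ on $\mathbb S^n$ for the inner product $\mathrm{Tr}(A^\top B)$), and let $\beta\ge 0$ be such that $\|\nabla f(X)-\nabla f(Y)\|_F\le\beta\|X-Y\|_F$ for all $X,Y\in\mathcal S^n$. Let $f^*=\min_{\mathcal S^n}f$, let $\mathcal X^*$ be the set of minimizers of $f$ over $\mathcal S^n$, and let $G=\sup_{X\in\mathcal S^n}\|\nabla f(X)\|$. **Algorithm.** $X_1\in\mathcal S^n$ is arbitrary. For $t=1,2,\dots$: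 1. Let $v_{t,-}$ maximize $v^\top\nabla f(X_t)v$ over the unit vectors $v\in\mathrm{Im}(X_t)$, and let $\lambda_t=(v_{t,-}^\top X_t^\dagger v_{t,-})^{-1}$. 2. If $\lambda_t<1$ and $X^{\rm drop}_{t+1}=\frac{1}{1-\lambda_t}(X_t-\lambda_t v_{t,-}v_{t,-}^\top)$ satisfies $f(X^{\rm drop}_{t+1})\le f(X_t)$, set $X_{t+1}=X^{\rm drop}_{t+1}$ (a *drop step*). 3. Otherwise let $v_{t,+}$ be a unit leading eigenvector of $-\nabla f(X_t)$ and compute three points: - $X^{\rm FW}_{t+1}=(1-\eta)X_t+\eta v_{t,+}v_{t,+}^\top$, where $\eta\in[0,1]$ minimizes $f$ of this matrix; - $X^{\rm AFW}_{t+1}=\frac{1}{1-\eta}(X_t-\eta v_{t,-}v_{t,-}^\top)$, where $\eta\in[0,\lambda_t]$, $\eta<1$, minimizes $f$ of this matrix; - $X^{\rm PFW}_{t+1}=X_t+\gamma_t(u_{t,+}u_{t,+}^\top-u_{t,-}u_{t,-}^\top)$, where $u_{t,-}$ is drawn uniformly at random from the unit sphere of $\mathrm{Im}(X_t)$, $\gamma_t=(u_{t,-}^\top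 X_t^\dagger u_{t,-})^{-1}$, and $u_{t,+}$ is a unit leading eigenvector of $\beta\gamma_t u_{t,-}u_{t,-}^\top-\nabla f(X_t)$. Then let $X_{t+1}$ be one of these three points at which $f$ is smallest. Ties are broken arbitrarily. Let $h_t=f(X_t)-f^*$. Then: (i) $h_{t+1}\le h_t$ for all $t\ge 1$, and $$h_t\le\frac{8\beta}{t-\mathrm{rank}(X_1)+4}\qquad\text{for all } t\ge\mathrm{rank}(X_1)+2 .$$ (ii) For every $t\ge 1$, the number of drop steps among the iterations $1,\dots,t-1$ is at most $(t+\mathrm{rank}(X_1)-2)/2$. (iii) Assume in addition that $\beta>0$ and that the following hold. - *Quadratic growth*: $\alpha>0$ and $\min_{Y\in\mathcal X^*}\|X-Y\|_F^2\le\frac2\alpha(f(X)-f^*)$ for all $X\in\mathcal S^n$. - *Strict complementarity*: there is $r^*\in\{1,\dots,n\}$ with $\mathrm{rank}(X^*)=r^*$ for all $X^*\in\mathcal X^*$ and, if $r^*<n$, $\delta:=\min_{X^*\in\mathcal X^*}\big(\lambda_{n-r^*}(\nabla f(X^*))-\lambda_{n-r^*+1}(\nabla f(X^*))\big)>0$.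 Let $\lambda_{r^*}=\min_{X^*\in\mathcal X^*}\lambda_{r^*}(X^*)$. There are universal constants $c,c_1,c_2>0$ (independent of $n$, $f$ and all other data) such that, with $$\mathcal E=c\,\min\Big\{\frac{\alpha\delta^2}{\beta^2},\frac{\delta^2}{\beta},\delta,\alpha\lambda_{r^*}^2,\frac{\delta^3}{\beta^2}\Big\},\qquad \mathcal E_1=c_1\frac{\alpha\delta^2}{\beta^2},\qquad \mathcal E_2=c_2\,\alpha\lambda_{r^*}^2,$$ on each iteration $t$ in which a drop step is not taken: - if $r^*=1$ and $h_t<\mathcal E_1$, then $h_{t+1}\le h_t\big(1-\min\{\frac{\delta}{12\beta},\frac12\}\big)$; - if $r^*=n$ and $h_t<\mathcal E_2$, then $h_{t+1}\le h_t\big(1-\frac{\alpha}{512\beta n}\big)$; - if $2\le r^*<n$ and $h_t<\mathcal E$, then, the expectation being with respect to the random choice of $u_{t,-}$, $$\mathbb E[h_{t+1}\mid X_t]\le h_t\Big(1-\frac1{r^*}\min\Big\{\frac{\delta}{48G}\min\Big\{\frac{\delta}{3\beta},\lambda_{r^*}\Big\},\frac{\alpha}{512\beta}\Big\}\Big).$$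 All claims except the last one hold surely, for every possible outcome of the random choices. In the last one, conditioning on $X_t$ may be replaced by conditioning on any information, available before $u_{t,-}$ is drawn, that contains $X_t$ and the decision whether a drop step is taken. -/

import Mathlib

open MeasureTheory ProbabilityTheory

noncomputable section

namespace SpectraFW

/-! ### Matrices, eigenvalues and the spectrahedron -/

/-- Real `n × n` matrices. -/
abbrev Mat (n : ℕ) : Type := Matrix (Fin n) (Fin n) ℝ

/-- `ℝⁿ` with the Euclidean norm. -/
abbrev Vec (n : ℕ) : Type := EuclideanSpace ℝ (Fin n)

variable {n : ℕ}

/-- The standard matrix inner product `⟨A, B⟩ = Tr(Aᵀ B)`, as a linear functional of `B`. -/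
def frobInner (A : Mat n) : Mat n →ₗ[ℝ] ℝ where
  toFun B := (A.transpose * B).trace
  map_add' B C := by rw [Matrix.mul_add, Matrix.trace_add]
  map_smul' a B := by rw [Matrix.mul_smul, Matrix.trace_smul, RingHom.id_apply]

/-- The Frobenius norm. -/
def frobNorm (A : Mat n) : ℝ := Real.sqrt (frobInner A A)

/-- The spectral norm (largest singular value): the operator norm with respect to the Euclidean
norm on `ℝⁿ`. -/
def specNorm (A : Mat n) : ℝ := ‖Matrix.toEuclideanCLM (𝕜 := ℝ) A‖

/-- The eigenvalues of a symmetric matrix in non-ascending order: `eig A 1 ≥ … ≥ eig A n`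
(indices outside `{1, …, n}` are not used). -/
def eig (A : Mat n) (i : ℕ) : ℝ :=
  open scoped Classical in
  if h : A.IsHermitian ∧ 1 ≤ i ∧ i ≤ n then
    h.1.eigenvalues₀ ⟨i - 1, by rw [Fintype.card_fin]; omega⟩
  else 0

/-- The image of a matrix. -/
def im (A : Mat n) : Submodule ℝ (Vec n) := LinearMap.range (Matrix.toEuclideanLin A)

/-- The quadratic form `vᵀ A v`. -/
def quad (A : Mat n) (v : Vec n) : ℝ := v.ofLp ⬝ᵥ Matrix.mulVec A v.ofLp

/-- The rank-one matrix `v vᵀ`. -/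
def outer (v : Vec n) : Mat n := Matrix.vecMulVec v.ofLp v.ofLp

/-- The four Penrose equations: `B` is the Moore-Penrose pseudo-inverse of `A`. -/
def IsMoorePenrose (A B : Mat n) : Prop :=
  A * B * A = A ∧ B * A * B = B ∧ (A * B).IsSymm ∧ (B * A).IsSymm

/-- The Moore-Penrose pseudo-inverse (it exists and is unique for every real matrix). -/
def pinv (A : Mat n) : Mat n :=
  open scoped Classical in
  if h : ∃ B, IsMoorePenrose A B then h.choose else 0

/-- `v` is a leading eigenvector of the symmetric matrix `A`: a unit eigenvector for the largest
eigenvalue. -/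
def IsLeadingEigenvector (A : Mat n) (v : Vec n) : Prop :=
  ‖v‖ = 1 ∧ Matrix.mulVec A v.ofLp = eig A 1 • v.ofLp

/-- The spectrahedron: positive semidefinite matrices of unit trace. -/
def spectrahedron (n : ℕ) : Set (Mat n) := {X | X.PosSemidef ∧ X.trace = 1}

/-! ### The optimization problem and its assumptions -/

/-- `D` is the gradient of `f` at `X` in the space of real symmetric matrices, with respect to the
standard matrix inner product: `D` is symmetric and `f Y = f X + ⟨D, Y - X⟩ + o(‖Y - X‖)` as
`Y → X` through symmetric matrices. -/
def IsSymGradientAt (f : Mat n → ℝ) (D X : Mat n) : Prop :=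
  D.IsSymm ∧ HasFDerivWithinAt f (LinearMap.toContinuousLinearMap (frobInner D)) {Y | Y.IsSymm} X

/-- `f` is convex and `β`-smooth on the spectrahedron, with gradient map `g`. -/
structure IsSmoothConvex (f : Mat n → ℝ) (g : Mat n → Mat n) (β : ℝ) : Prop where
  convex : ConvexOn ℝ (spectrahedron n) f
  gradient : ∀ X ∈ spectrahedron n, IsSymGradientAt f (g X) X
  nonneg : 0 ≤ β
  smooth : ∀ X ∈ spectrahedron n, ∀ Y ∈ spectrahedron n,
    frobNorm (g X - g Y) ≤ β * frobNorm (X - Y)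

/-- The minimal value `f*` of `f` over the spectrahedron. -/
def optVal (f : Mat n → ℝ) : ℝ := sInf (f '' spectrahedron n)

/-- The set of minimizers of `f` over the spectrahedron. -/
def minimizers (f : Mat n → ℝ) : Set (Mat n) :=
  {X | X ∈ spectrahedron n ∧ ∀ Y ∈ spectrahedron n, f X ≤ f Y}

/-- Quadratic growth with constant `α`. -/
def QuadraticGrowth (f : Mat n → ℝ) (α : ℝ) : Prop :=
  0 < α ∧ ∀ X ∈ spectrahedron n, ∃ Y ∈ minimizers f,
    frobNorm (X - Y) ^ 2 ≤ 2 / α * (f X - optVal f)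

/-- Strict complementarity: all minimizers have rank `r`, and if `r < n`, the minimum over the
minimizers of the gap between the `(n-r)`-th and `(n-r+1)`-th eigenvalues of the gradient is the
positive number `δ` (if `r = n`, nothing is said about `δ`). -/
structure StrictComplementarity (f : Mat n → ℝ) (g : Mat n → Mat n) (r : ℕ) (δ : ℝ) : Prop where
  one_le : 1 ≤ r
  le : r ≤ n
  rank_eq : ∀ X ∈ minimizers f, X.rank = r
  gap : r < n → 0 < δ ∧
    IsLeast ((fun X => eig (g X) (n - r) - eig (g X) (n - r + 1)) '' minimizers f) δ

/-- `G`, the supremum over the spectrahedron of the spectral norm of the gradient. -/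
def gradBound (g : Mat n → Mat n) : ℝ := sSup ((fun X => specNorm (g X)) '' spectrahedron n)

/-! ### The algorithm -/

/-- `v` maximizes `wᵀ D w` over the unit vectors `w` of the image of `X`. -/
def IsAwayVector (D X : Mat n) (v : Vec n) : Prop :=
  v ∈ im X ∧ ‖v‖ = 1 ∧ ∀ w ∈ im X, ‖w‖ = 1 → quad D w ≤ quad D v

/-- The maximal step size `(vᵀ X† v)⁻¹` for removing the direction `v` from `X`. -/
def maxStep (X : Mat n) (v : Vec n) : ℝ := (quad (pinv X) v)⁻¹

/-- `(X - η v vᵀ) / (1 - η)`. -/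
def awayPoint (X : Mat n) (v : Vec n) (η : ℝ) : Mat n := (1 - η)⁻¹ • (X - η • outer v)

/-- `(1 - η) X + η v vᵀ`. -/
def fwPoint (X : Mat n) (v : Vec n) (η : ℝ) : Mat n := (1 - η) • X + η • outer v

/-- The test of the algorithm for taking a drop step from `X` along `v`. -/
def DropTaken (f : Mat n → ℝ) (X : Mat n) (v : Vec n) : Prop :=
  maxStep X v < 1 ∧ f (awayPoint X v (maxStep X v)) ≤ f X

/-- `Z` is the result of a Frank-Wolfe step with line search from `X`; `D` is the gradient. -/
def IsFWStep (f : Mat n → ℝ) (D X Z : Mat n) : Prop :=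
  ∃ (v : Vec n) (η : ℝ), IsLeadingEigenvector (-D) v ∧ η ∈ Set.Icc (0 : ℝ) 1 ∧
    (∀ s ∈ Set.Icc (0 : ℝ) 1, f (fwPoint X v η) ≤ f (fwPoint X v s)) ∧ Z = fwPoint X v η

/-- `Z` is the result of an away step with line search from `X` along `v`. The condition `η < 1`
only matters if the maximal step size is `1`, where the formula for the step has no meaning at
`η = 1`. -/
def IsAwayStep (f : Mat n → ℝ) (X : Mat n) (v : Vec n) (Z : Mat n) : Prop :=
  ∃ η : ℝ, 0 ≤ η ∧ η ≤ maxStep X v ∧ η < 1 ∧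
    (∀ s : ℝ, 0 ≤ s → s ≤ maxStep X v → s < 1 → f (awayPoint X v η) ≤ f (awayPoint X v s)) ∧
    Z = awayPoint X v η

/-- `Z` is the result of a pairwise step from `X` in which the direction `u` is removed; `D` is the
gradient. -/
def IsPairwiseStep (β : ℝ) (D X : Mat n) (u : Vec n) (Z : Mat n) : Prop :=
  ∃ w : Vec n, IsLeadingEigenvector ((β * maxStep X u) • outer u - D) w ∧
    Z = X + maxStep X u • (outer w - outer u)

/-- One iteration of the algorithm: from `X`, with away vector `v` and (if no drop step is taken)
drawn vector `u`, it can produce `X'`. All ties may be broken arbitrarily. -/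
structure IsIteration (f : Mat n → ℝ) (g : Mat n → Mat n) (β : ℝ) (X : Mat n) (v u : Vec n)
    (X' : Mat n) : Prop where
  away : IsAwayVector (g X) X v
  drop : DropTaken f X v → X' = awayPoint X v (maxStep X v)
  no_drop : ¬ DropTaken f X v → u ∈ im X ∧ ‖u‖ = 1 ∧
    ∃ ZF ZA ZP : Mat n, IsFWStep f (g X) X ZF ∧ IsAwayStep f X v ZA ∧
      IsPairwiseStep β (g X) X u ZP ∧
      (X' = ZF ∨ X' = ZA ∨ X' = ZP) ∧ f X' ≤ f ZF ∧ f X' ≤ f ZA ∧ f X' ≤ f ZP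

/-- A possible trajectory of the algorithm: iterates `X t`, away vectors `v t` and drawn vectors
`u t`, for `t = 1, 2, …` (index `0` is not used). -/
def IsTrajectory (f : Mat n → ℝ) (g : Mat n → Mat n) (β : ℝ) (X : ℕ → Mat n) (v u : ℕ → Vec n) :
    Prop :=
  X 1 ∈ spectrahedron n ∧ ∀ t, 1 ≤ t → IsIteration f g β (X t) (v t) (u t) (X (t + 1))

/-- The uniform probability measure on the unit sphere of a subspace `V ≠ 0` of `ℝⁿ`: the
normalized surface measure of the sphere, pushed forward to `ℝⁿ`. -/
def uniformSphere (V : Submodule ℝ (Vec n)) : Measure (Vec n) :=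
  (((volume : Measure V).toSphere Set.univ)⁻¹ • (volume : Measure V).toSphere).map
    (fun x : Metric.sphere (0 : V) 1 => ((x : V) : Vec n))

/-- A random run of the algorithm. The σ-algebra `info t` is the information available at iteration
`t` before the vector `u t` is drawn: it contains `X t` and the decision whether a drop step is
taken, and, if no drop step is taken, then conditionally on it `u t` is uniformly distributed on the
unit sphere of the image of `X t`. For example, `info t` can be generated by the whole history before
the draw, or, if `v t` is a function of `X t`, by `X t` alone. -/
structure IsRandomRun {Ω : Type*} [mΩ : MeasurableSpace Ω] (μ : Measure Ω)
    (f : Mat n → ℝ) (g : Mat n → Mat n) (β : ℝ)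
    (X : ℕ → Ω → Mat n) (v u : ℕ → Ω → Vec n) (info : ℕ → MeasurableSpace Ω) : Prop where
  trajectory : ∀ᵐ ω ∂μ,
    IsTrajectory f g β (fun t => X t ω) (fun t => v t ω) (fun t => u t ω)
  info_le : ∀ t, info t ≤ mΩ
  iterate_measurable : ∀ t, 1 ≤ t → StronglyMeasurable[info t] (X t)
  drop_measurable : ∀ t, 1 ≤ t → MeasurableSet[info t] {ω | DropTaken f (X t ω) (v t ω)}
  draw_measurable : ∀ t, 1 ≤ t → Measurable (u t)
  draw_uniform : ∀ t, 1 ≤ t → ∀ B : Set (Vec n), MeasurableSet B →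
    ∀ᵐ ω ∂μ, ¬ DropTaken f (X t ω) (v t ω) →
      (μ⟦u t ⁻¹' B | info t⟧) ω = (uniformSphere (im (X t ω))).real B

end SpectraFW

end

open SpectraFW

namespace SpectraFW

variable {n : ℕ}

/-! ### The Frobenius inner product and quadratic forms -/

/-! Sublinear rate. A drop step does not increase `f` and lowers the rank of the iterate; every
other iteration raises the rank by at most one. As the rank stays at least one, at most about half
of the iterations are drop steps (`IsTrajectory.rank_add_ncard_le`). Every other iteration does at
least as well as a Frank-Wolfe step with line search, so `h_{t+1} ≤ (1 - η) h_t + β η²` for all `η ∈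
[0, 1]`, and the usual induction, counting only these iterations, gives the rate
(`IsTrajectory.sub_optVal_le`).

Local picture. Let `Y` be a minimizer close to `X`, which quadratic growth provides, and let `D =
∇f(X)`. By optimality `∇f(Y) ≥ ⟨∇f(Y), Y⟩ I`, with equality of the quadratic forms on the image of
`Y`. Weyl's inequality carries this over to `D`: its lowest `r` eigenvalues nearly coincide, and the
others lie above them by nearly `δ`.

For `r = 1` the gap makes the Frank-Wolfe gap at least a multiple of `1 - wᵀXw`, which in turn
bounds `‖X - wwᵀ‖²`. The quadratic error of the step is thus absorbed by its linear gain
(`rate_rank_one`).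

For `r ≥ 2`, convexity gives `h ≤ ⟨D, X - Y⟩`, and `frobInner_sub_le_split` bounds this by a term in
the spread `S` of the lowest `r` eigenvalues of `D`, of size `S √r ‖X - Y‖`, plus the excess `∑ (λ_i
- λ_n) e_iᵀXe_i` over the remaining eigenvectors. If the first term is at least `h/2`, quadratic
growth forces `S²` to be of order `α h / r`. The Frank-Wolfe gap and the away gap add up to at least
`S`, so one of these two steps gains enough (`IsIteration.le_of_le_spread`). The away step has room
for this because otherwise the drop test would have succeeded (`IsIteration.le_of_away_gap`). For `r
= n` there is no second term.

If the second term dominates, the pairwise step is used. Near the minimizers the iterate has rank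
exactly `r`, removable weights are at least about `λ_r*`, and every unit vector of its image lies
almost in the span of the lowest `r` eigenvectors. Comparing the new direction with `u` shrunk on
the upper eigenvectors shows a gain proportional to the excess of `u` (`IsIteration.pairwise_gain`).
For uniform `u` in the image of `X`, `E ⟨a, u⟩² ≥ aᵀXa / rank X`, so the mean excess is at least of
order `h / r` (`le_integral_quad_uniformSphere`). The excess is expressed by the positive part of `D
- (λ_n + δ/10)`, which depends measurably on `X`, so that no measurable choice of eigenvectors is
needed. -/

lemma quad_eq_inner (A : Mat n) (v : Vec n) :
    quad A v = inner ℝ v (Matrix.toEuclideanLin A v) := by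
  simp [quad, Matrix.toLpLin_apply, EuclideanSpace.inner_eq_star_dotProduct, dotProduct_comm]

lemma inner_act_comm {A : Mat n} (hA : A.IsHermitian) (u v : Vec n) :
    inner ℝ (Matrix.toEuclideanLin A u) v = inner ℝ u (Matrix.toEuclideanLin A v) :=
  Matrix.isSymmetric_toEuclideanLin_iff.mpr hA u v

lemma quad_add (A B : Mat n) (v : Vec n) : quad (A + B) v = quad A v + quad B v := by
  simp [quad_eq_inner, inner_add_right]

lemma quad_sub (A B : Mat n) (v : Vec n) : quad (A - B) v = quad A v - quad B v := by
  simp [quad_eq_inner, inner_sub_right]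

lemma quad_neg (A : Mat n) (v : Vec n) : quad (-A) v = - quad A v := by
  simp [quad_eq_inner]

lemma quad_smul (a : ℝ) (A : Mat n) (v : Vec n) : quad (a • A) v = a * quad A v := by
  simp [quad_eq_inner, inner_smul_right]

lemma quad_vec_smul (A : Mat n) (a : ℝ) (v : Vec n) : quad A (a • v) = a ^ 2 * quad A v := by
  simp only [quad_eq_inner, map_smul, inner_smul_right, real_inner_smul_left]
  ring

lemma quad_one (v : Vec n) : quad (1 : Mat n) v = ‖v‖ ^ 2 := by
  simp [quad_eq_inner]

lemma quad_zero_vec (A : Mat n) : quad A 0 = 0 := by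
  simp [quad_eq_inner]

lemma toEuclideanLin_outer (u v : Vec n) :
    Matrix.toEuclideanLin (outer u) v = (inner ℝ u v : ℝ) • u := by
  ext i
  simp [outer, Matrix.toLpLin_apply, Matrix.vecMulVec_mulVec, EuclideanSpace.inner_eq_star_dotProduct,
    dotProduct_comm]

lemma quad_outer (u v : Vec n) : quad (outer u) v = inner ℝ u v ^ 2 := by
  rw [quad_eq_inner, toEuclideanLin_outer, inner_smul_right, real_inner_comm, sq]

lemma outer_isSymm (u : Vec n) : (outer u).IsSymm := by
  ext i j
  simp [outer, Matrix.vecMulVec_apply, mul_comm]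

lemma frobInner_eq_sum (A B : Mat n) : frobInner A B = ∑ j, ∑ i, A i j * B i j := by
  simp [frobInner, Matrix.trace, Matrix.mul_apply]

lemma frobInner_comm (A B : Mat n) : frobInner A B = frobInner B A := by
  simp [frobInner_eq_sum, mul_comm]

lemma frobInner_sub_left (A B C : Mat n) : frobInner (A - B) C = frobInner A C - frobInner B C := by
  rw [frobInner_comm, map_sub, frobInner_comm C, frobInner_comm C]

lemma frobInner_smul_left (a : ℝ) (A C : Mat n) : frobInner (a • A) C = a * frobInner A C := by
  rw [frobInner_comm, map_smul, frobInner_comm C, smul_eq_mul]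

lemma frobInner_one (B : Mat n) : frobInner 1 B = B.trace := by
  simp [frobInner]

lemma frobInner_outer (A : Mat n) (v : Vec n) : frobInner A (outer v) = quad A v := by
  rw [frobInner_eq_sum, Finset.sum_comm]
  simp only [quad, outer, Matrix.vecMulVec_apply, dotProduct, Matrix.mulVec, Finset.mul_sum]
  exact Finset.sum_congr rfl fun i _ => Finset.sum_congr rfl fun j _ => by ring

lemma frobInner_self_nonneg (A : Mat n) : 0 ≤ frobInner A A := by
  rw [frobInner_eq_sum]
  exact Finset.sum_nonneg fun j _ => Finset.sum_nonneg fun i _ => mul_self_nonneg _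

lemma frobNorm_nonneg (A : Mat n) : 0 ≤ frobNorm A := Real.sqrt_nonneg _

lemma frobNorm_sq (A : Mat n) : frobNorm A ^ 2 = frobInner A A :=
  Real.sq_sqrt (frobInner_self_nonneg A)

lemma frobNorm_sub_comm (A B : Mat n) : frobNorm (A - B) = frobNorm (B - A) := by
  rw [frobNorm, frobNorm]
  congr 1
  simp only [frobInner_sub_left, map_sub]
  ring

lemma abs_frobInner_le (A B : Mat n) : |frobInner A B| ≤ frobNorm A * frobNorm B := by
  apply abs_le_of_sq_le_sq _ (mul_nonneg (frobNorm_nonneg A) (frobNorm_nonneg B))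
  rw [mul_pow, frobNorm_sq, frobNorm_sq]
  simp only [frobInner_eq_sum, ← Finset.sum_product', ← sq]
  exact Finset.sum_mul_sq_le_sq_mul_sq _ (fun x : Fin n × Fin n => A x.2 x.1) fun x => B x.2 x.1

lemma frobNorm_outer (v : Vec n) : frobNorm (outer v) = ‖v‖ ^ 2 := by
  rw [frobNorm, frobInner_outer, quad_outer, real_inner_self_eq_norm_sq]
  exact Real.sqrt_sq (sq_nonneg _)

lemma abs_quad_le (A : Mat n) (v : Vec n) : |quad A v| ≤ frobNorm A * ‖v‖ ^ 2 := by
  rw [← frobInner_outer, ← frobNorm_outer]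
  exact abs_frobInner_le _ _

lemma frobNorm_outer_sub_outer_sq (u v : Vec n) (hu : ‖u‖ = 1) (hv : ‖v‖ = 1) :
    frobNorm (outer u - outer v) ^ 2 = 2 * (1 - inner ℝ u v ^ 2) := by
  rw [frobNorm_sq, frobInner_sub_left, map_sub, map_sub]
  simp only [frobInner_outer, quad_outer, real_inner_self_eq_norm_sq, hu, hv,
    real_inner_comm u v]
  ring

/-! ### Eigenvalues and eigenbases -/

/-- `e` is an orthonormal basis of eigenvectors of `A`, in the order of the eigenvalues. -/
def IsEigenbasis (A : Mat n) (e : OrthonormalBasis (Fin n) ℝ (Vec n)) : Prop :=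
  ∀ i : Fin n, Matrix.toEuclideanLin A (e i) = eig A (i + 1) • e i

/-- `eig` counts from `1` and `Fin n` from `0`; this is the source of the shift `i + 1` everywhere
below. -/
lemma eig_eq {A : Mat n} (hA : A.IsHermitian) (i : Fin n) :
    eig A (i + 1) = hA.eigenvalues₀ ⟨i, by simp⟩ := by
  rw [eig, dif_pos ⟨hA, by omega, by omega⟩]
  rfl

lemma exists_eigenbasis {A : Mat n} (hA : A.IsHermitian) : ∃ e, IsEigenbasis A e := by
  let hT := Matrix.isSymmetric_toEuclideanLin_iff.mpr hA
  refine ⟨(hT.eigenvectorBasis finrank_euclideanSpace).reindex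
    (finCongr (Fintype.card_fin n)), fun i => ?_⟩
  rw [OrthonormalBasis.reindex_apply, eig_eq hA i]
  exact hT.apply_eigenvectorBasis finrank_euclideanSpace _

lemma eig_anti {A : Mat n} (hA : A.IsHermitian) {i j : ℕ} (hi : 1 ≤ i) (hij : i ≤ j) (hj : j ≤ n) :
    eig A j ≤ eig A i := by
  obtain ⟨i, rfl⟩ := Nat.exists_eq_add_of_le' hi
  obtain ⟨j, rfl⟩ := Nat.exists_eq_add_of_le' (hi.trans hij)
  rw [eig_eq hA ⟨i, by omega⟩, eig_eq hA ⟨j, by omega⟩]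
  exact hA.eigenvalues₀_antitone (by simp; omega)

variable {A B X : Mat n} {e : OrthonormalBasis (Fin n) ℝ (Vec n)}

lemma IsEigenbasis.quad_basis (he : IsEigenbasis A e) (i : Fin n) :
    quad A (e i) = eig A (i + 1) := by
  rw [quad_eq_inner, he, inner_smul_right, real_inner_self_eq_norm_sq]
  simp

lemma IsEigenbasis.inner_act (hA : A.IsHermitian) (he : IsEigenbasis A e) (i : Fin n) (v : Vec n) :
    inner ℝ (e i) (Matrix.toEuclideanLin A v) = eig A (i + 1) * inner ℝ (e i) v := by
  rw [← inner_act_comm hA, he, real_inner_smul_left]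

lemma IsEigenbasis.quad_eq_sum (hA : A.IsHermitian) (he : IsEigenbasis A e) (v : Vec n) :
    quad A v = ∑ i : Fin n, eig A (i + 1) * inner ℝ (e i) v ^ 2 := by
  rw [quad_eq_inner, ← e.sum_inner_mul_inner]
  refine Finset.sum_congr rfl fun i _ => ?_
  rw [he.inner_act hA, real_inner_comm]
  ring

lemma toEuclideanLin_sum_outer (e : OrthonormalBasis (Fin n) ℝ (Vec n)) (d : Fin n → ℝ) (i : Fin n) :
    Matrix.toEuclideanLin (∑ i, d i • outer (e i)) (e i) = d i • e i := by
  simp only [map_sum, map_smul, LinearMap.sum_apply, LinearMap.smul_apply, toEuclideanLin_outer]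
  rw [Finset.sum_eq_single i]
  · simp
  · intro j _ hj
    rw [e.orthonormal.2 hj]
    simp
  · simp

lemma eq_of_act_basis (e : OrthonormalBasis (Fin n) ℝ (Vec n))
    (h : ∀ i, Matrix.toEuclideanLin A (e i) = Matrix.toEuclideanLin B (e i)) : A = B := by
  apply Matrix.toEuclideanLin.injective
  apply e.toBasis.ext
  simpa using h

lemma IsEigenbasis.eq_sum (he : IsEigenbasis A e) : A = ∑ i : Fin n, eig A (i + 1) • outer (e i) :=
  eq_of_act_basis e fun i => by
    rw [he, toEuclideanLin_sum_outer e fun i : Fin n => eig A (i + 1)]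

lemma one_eq_sum (e : OrthonormalBasis (Fin n) ℝ (Vec n)) : (1 : Mat n) = ∑ i, outer (e i) :=
  eq_of_act_basis e fun i => by
    have := toEuclideanLin_sum_outer e (fun _ => 1) i
    simp only [one_smul] at this
    rw [this]
    simp

lemma frobInner_sum_outer (e : OrthonormalBasis (Fin n) ℝ (Vec n)) (d : Fin n → ℝ) (B : Mat n) :
    frobInner (∑ i, d i • outer (e i)) B = ∑ i, d i * quad B (e i) := by
  rw [frobInner_comm, map_sum]
  simp [frobInner_outer]

lemma quad_sum_outer (e : OrthonormalBasis (Fin n) ℝ (Vec n)) (d : Fin n → ℝ) (v : Vec n) :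
    quad (∑ i, d i • outer (e i)) v = ∑ i, d i * inner ℝ (e i) v ^ 2 := by
  rw [← frobInner_outer, frobInner_sum_outer]
  refine Finset.sum_congr rfl fun i _ => ?_
  rw [quad_outer, real_inner_comm]

lemma IsEigenbasis.frobInner_eq_sum (he : IsEigenbasis A e) (B : Mat n) :
    frobInner A B = ∑ i : Fin n, eig A (i + 1) * quad B (e i) := by
  conv_lhs => rw [he.eq_sum]
  exact frobInner_sum_outer e (fun i : Fin n => eig A (i + 1)) B

lemma trace_eq_sum (e : OrthonormalBasis (Fin n) ℝ (Vec n)) (B : Mat n) :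
    B.trace = ∑ i, quad B (e i) := by
  rw [← frobInner_one, one_eq_sum e, frobInner_comm, map_sum]
  simp [frobInner_outer]

lemma posSemidef_iff_quad : A.PosSemidef ↔ A.IsSymm ∧ ∀ v : Vec n, 0 ≤ quad A v := by
  rw [Matrix.posSemidef_iff_dotProduct_mulVec]
  refine and_congr (by rw [Matrix.isHermitian_iff_isSymm]) ⟨fun h v => ?_, fun h v => ?_⟩
  · simpa [quad] using h v.ofLp
  · simpa [quad] using h (WithLp.toLp 2 v)

lemma frobInner_nonneg_of_posSemidef (hA : A.PosSemidef) (hB : B.PosSemidef) :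
    0 ≤ frobInner A B := by
  obtain ⟨e, he⟩ := exists_eigenbasis hA.1
  rw [he.frobInner_eq_sum]
  refine Finset.sum_nonneg fun i _ => mul_nonneg ?_ ((posSemidef_iff_quad.1 hB).2 _)
  rw [← he.quad_basis]
  exact (posSemidef_iff_quad.1 hA).2 _

lemma outer_posSemidef (v : Vec n) : (outer v).PosSemidef :=
  posSemidef_iff_quad.2 ⟨outer_isSymm v, fun w => by rw [quad_outer]; positivity⟩

lemma trace_outer (v : Vec n) : (outer v).trace = ‖v‖ ^ 2 := by
  rw [← frobInner_one, frobInner_outer, quad_one]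

/-- Cauchy-Schwarz for a positive semidefinite form. -/
lemma inner_act_sq_le (hX : X.PosSemidef) (u v : Vec n) :
    inner ℝ u (Matrix.toEuclideanLin X v) ^ 2 ≤ quad X u * quad X v := by
  have h : ∀ t : ℝ, 0 ≤ quad X v * (t * t) + 2 * inner ℝ u (Matrix.toEuclideanLin X v) * t
      + quad X u := by
    intro t
    have := (posSemidef_iff_quad.1 hX).2 (u + t • v)
    rw [quad_eq_inner] at this ⊢
    rw [quad_eq_inner]
    simp only [map_add, map_smul, inner_add_left, inner_add_right, real_inner_smul_left,
      inner_smul_right] at this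
    have hvu : inner ℝ v (Matrix.toEuclideanLin X u) = inner ℝ u (Matrix.toEuclideanLin X v) := by
      rw [← inner_act_comm hX.1, real_inner_comm]
    rw [hvu] at this
    linarith
  have := discrim_le_zero h
  rw [discrim] at this
  nlinarith

lemma act_eq_zero_of_quad_eq_zero (hX : X.PosSemidef) {v : Vec n} (h : quad X v = 0) :
    Matrix.toEuclideanLin X v = 0 := by
  have := inner_act_sq_le hX (Matrix.toEuclideanLin X v) v
  rw [h, mul_zero] at this
  have h2 := sq_eq_zero_iff.1 (le_antisymm this (sq_nonneg _))
  exact inner_self_eq_zero.1 h2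

/-! ### The min-max principle -/

/-- Dimension count: fewer linear conditions than the dimension of `V` leave a nonzero solution. All
the min-max statements below rest on it. -/
lemma exists_unit_mem_of_finrank {V : Submodule ℝ (Vec n)} (e : OrthonormalBasis (Fin n) ℝ (Vec n))
    (s : Finset (Fin n)) (h : s.card < Module.finrank ℝ V) :
    ∃ v ∈ V, ‖v‖ = 1 ∧ ∀ i ∈ s, inner ℝ (e i) v = 0 := by
  let L : V →ₗ[ℝ] (s → ℝ) := LinearMap.pi fun i => (innerₛₗ ℝ (e i)).comp V.subtype
  have hL : LinearMap.ker L ≠ ⊥ := by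
    apply LinearMap.ker_ne_bot_of_finrank_lt
    simpa using h
  obtain ⟨⟨w, hw⟩, hw0, hne⟩ := Submodule.exists_mem_ne_zero_of_ne_bot hL
  have hne' : w ≠ 0 := fun h => hne (by simpa using h)
  refine ⟨‖w‖⁻¹ • w, V.smul_mem _ hw, ?_, fun i hi => ?_⟩
  · rw [norm_smul, norm_inv, norm_norm, inv_mul_cancel₀ (norm_ne_zero_iff.2 hne')]
  · have := congrFun (LinearMap.mem_ker.1 hw0) ⟨i, hi⟩
    simp only [L, LinearMap.pi_apply, LinearMap.comp_apply, Submodule.subtype_apply,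
      Pi.zero_apply] at this
    rw [inner_smul_right]
    simp only [innerₛₗ_apply_apply] at this
    rw [this, mul_zero]

lemma card_filter_lt (k : ℕ) (hk : k ≤ n) :
    (Finset.univ.filter fun i : Fin n => (i : ℕ) < k).card = k := by
  rw [Fin.card_filter_val_lt]; omega

lemma IsEigenbasis.quad_le_of_inner_eq_zero (hA : A.IsHermitian) (he : IsEigenbasis A e) {k : ℕ}
    (hk : 1 ≤ k) (v : Vec n) (hv : ∀ i : Fin n, (i : ℕ) + 1 < k → inner ℝ (e i) v = 0) :
    quad A v ≤ eig A k * ‖v‖ ^ 2 := by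
  rw [he.quad_eq_sum hA, ← e.sum_sq_inner_right, Finset.mul_sum]
  refine Finset.sum_le_sum fun i _ => ?_
  by_cases hi : (i : ℕ) + 1 < k
  · simp [hv i hi]
  · exact mul_le_mul_of_nonneg_right (eig_anti hA hk (by omega) (by omega)) (sq_nonneg _)

lemma IsEigenbasis.le_quad_of_inner_eq_zero (hA : A.IsHermitian) (he : IsEigenbasis A e) {k : ℕ}
    (hk : k ≤ n) (v : Vec n) (hv : ∀ i : Fin n, k < (i : ℕ) + 1 → inner ℝ (e i) v = 0) :
    eig A k * ‖v‖ ^ 2 ≤ quad A v := by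
  rw [he.quad_eq_sum hA, ← e.sum_sq_inner_right, Finset.mul_sum]
  refine Finset.sum_le_sum fun i _ => ?_
  by_cases hi : k < (i : ℕ) + 1
  · simp [hv i hi]
  · exact mul_le_mul_of_nonneg_right (eig_anti hA (by omega) (by omega) hk) (sq_nonneg _)

lemma exists_unit_quad_le_eig (hA : A.IsHermitian) {V : Submodule ℝ (Vec n)} {k : ℕ} (hk : 1 ≤ k)
    (hV : k ≤ Module.finrank ℝ V) : ∃ v ∈ V, ‖v‖ = 1 ∧ quad A v ≤ eig A k := by
  obtain ⟨e, he⟩ := exists_eigenbasis hA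
  have hVn : Module.finrank ℝ V ≤ n := by simpa using V.finrank_le
  obtain ⟨v, hv, hv1, h⟩ := exists_unit_mem_of_finrank (V := V) e
    (Finset.univ.filter fun i : Fin n => (i : ℕ) < k - 1)
    (by rw [card_filter_lt _ (by omega)]; omega)
  refine ⟨v, hv, hv1, ?_⟩
  have := he.quad_le_of_inner_eq_zero hA hk v fun i hi => h i (by simp; omega)
  simpa [hv1] using this

lemma exists_unit_eig_le_quad (hA : A.IsHermitian) {V : Submodule ℝ (Vec n)} {k : ℕ} (hk : k ≤ n)
    (hV : n < Module.finrank ℝ V + k) : ∃ v ∈ V, ‖v‖ = 1 ∧ eig A k ≤ quad A v := by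
  obtain ⟨e, he⟩ := exists_eigenbasis hA
  obtain ⟨v, hv, hv1, h⟩ := exists_unit_mem_of_finrank (V := V) e
    (Finset.univ.filter fun i : Fin n => (i : ℕ) < k)ᶜ
    (by rw [Finset.card_compl, card_filter_lt _ hk, Fintype.card_fin]; omega)
  refine ⟨v, hv, hv1, ?_⟩
  have := he.le_quad_of_inner_eq_zero hA hk v fun i hi => h i (by simp; omega)
  simpa [hv1] using this

/-- Weyl's inequality. -/
lemma eig_le_eig_add (hA : A.IsHermitian) (hB : B.IsHermitian) {ε : ℝ} {k : ℕ} (hk : 1 ≤ k)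
    (hkn : k ≤ n) (h : ∀ v : Vec n, ‖v‖ = 1 → quad A v ≤ quad B v + ε) :
    eig A k ≤ eig B k + ε := by
  obtain ⟨e, he⟩ := exists_eigenbasis hA
  let s := Finset.univ.filter fun i : Fin n => (i : ℕ) < k
  -- On the span of the top `k` eigenvectors of `A` the form is at least `eig A k`, while some unit
  -- vector there has `quad B` at most `eig B k`.
  let V : Submodule ℝ (Vec n) := Submodule.span ℝ (Set.range fun i : s => e i)
  have hV : Module.finrank ℝ V = k := by
    rw [finrank_span_eq_card (b := fun i : s => e i)
      (e.orthonormal.linearIndependent.comp _ Subtype.val_injective)]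
    rw [Fintype.card_coe, card_filter_lt _ hkn]
  obtain ⟨v, hv, hv1, hle⟩ := exists_unit_quad_le_eig hB hk hV.ge
  have := he.le_quad_of_inner_eq_zero hA hkn v fun i hi => by
    refine Submodule.span_induction (p := fun x _ => inner ℝ (e i) x = 0) ?_ (by simp)
      (fun x y _ _ hx hy => by rw [inner_add_right, hx, hy, add_zero])
      (fun a x _ hx => by rw [inner_smul_right, hx, mul_zero]) hv
    rintro _ ⟨⟨j, hj⟩, rfl⟩
    apply e.orthonormal.2
    rintro rfl
    simp [s] at hj
    omega
  rw [hv1] at this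
  have := h v hv1
  linarith

lemma eig_le_eig_add_frobNorm (hA : A.IsHermitian) (hB : B.IsHermitian) {k : ℕ} (hk : 1 ≤ k)
    (hkn : k ≤ n) : eig A k ≤ eig B k + frobNorm (A - B) :=
  eig_le_eig_add hA hB hk hkn fun v hv => by
    have := abs_quad_le (A - B) v
    rw [quad_sub, hv] at this
    have := (abs_le.1 this).2
    linarith

lemma quad_le_eig_one (hA : A.IsHermitian) (v : Vec n) :
    quad A v ≤ eig A 1 * ‖v‖ ^ 2 := by
  obtain ⟨e, he⟩ := exists_eigenbasis hA
  exact he.quad_le_of_inner_eq_zero hA le_rfl v fun i hi => absurd hi (by omega)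

lemma eig_last_le_quad (hA : A.IsHermitian) (v : Vec n) :
    eig A n * ‖v‖ ^ 2 ≤ quad A v := by
  obtain ⟨e, he⟩ := exists_eigenbasis hA
  exact he.le_quad_of_inner_eq_zero hA le_rfl v fun i hi => absurd hi (by omega)

lemma le_eig_last (hA : A.IsHermitian) (hn : 1 ≤ n) {a : ℝ} (h : ∀ v : Vec n, ‖v‖ = 1 → a ≤ quad A v) :
    a ≤ eig A n := by
  obtain ⟨e, he⟩ := exists_eigenbasis hA
  have := he.quad_basis ⟨n - 1, by omega⟩
  simp only [Nat.sub_add_cancel hn] at this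
  rw [← this]
  exact h _ (e.orthonormal.1 _)

lemma IsLeadingEigenvector.quad_eq {v : Vec n} (h : IsLeadingEigenvector A v) :
    quad A v = eig A 1 := by
  rw [quad, h.2, dotProduct_smul]
  have : v.ofLp ⬝ᵥ v.ofLp = ‖v‖ ^ 2 := by
    rw [← quad_one, quad, Matrix.one_mulVec]
  rw [this, h.1]
  simp

lemma IsLeadingEigenvector.quad_le {v : Vec n} (hA : A.IsHermitian) (h : IsLeadingEigenvector A v)
    (w : Vec n) : quad A w ≤ quad A v * ‖w‖ ^ 2 := by
  rw [h.quad_eq]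
  exact quad_le_eig_one hA w

lemma IsLeadingEigenvector.act_eq {v : Vec n} (h : IsLeadingEigenvector A v) :
    Matrix.toEuclideanLin A v = quad A v • v := by
  rw [h.quad_eq, Matrix.toLpLin_apply, h.2]
  rfl

/-! ### Rank -/

lemma finrank_im (X : Mat n) : Module.finrank ℝ (im X) = X.rank := by
  rw [im, Matrix.rank_eq_finrank_range_toLin X (PiLp.basisFun 2 ℝ (Fin n)) (PiLp.basisFun 2 ℝ (Fin n))]
  rfl

lemma finrank_ker_add_rank (X : Mat n) :
    Module.finrank ℝ (LinearMap.ker (Matrix.toEuclideanLin X)) + X.rank = n := by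
  rw [← finrank_im, im, add_comm]
  simpa using LinearMap.finrank_range_add_finrank_ker (Matrix.toEuclideanLin X)

lemma rank_le_of_ker_le (h : LinearMap.ker (Matrix.toEuclideanLin A) ≤
    LinearMap.ker (Matrix.toEuclideanLin B)) : B.rank ≤ A.rank := by
  have h1 := finrank_ker_add_rank A
  have h2 := finrank_ker_add_rank B
  have := Submodule.finrank_mono h
  omega

lemma rank_lt_of_ker_lt (h : LinearMap.ker (Matrix.toEuclideanLin A) <
    LinearMap.ker (Matrix.toEuclideanLin B)) : B.rank < A.rank := by
  have h1 := finrank_ker_add_rank A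
  have h2 := finrank_ker_add_rank B
  have := Submodule.finrank_lt_finrank_of_lt h
  omega

lemma le_rank_of_eig_pos (hX : X.IsHermitian) {r : ℕ} (hr : r ≤ n) (h : 0 < eig X r) :
    r ≤ X.rank := by
  by_contra! hlt
  have hk : n < Module.finrank ℝ (LinearMap.ker (Matrix.toEuclideanLin X)) + r := by
    have := finrank_ker_add_rank X
    omega
  obtain ⟨v, hv, -, hle⟩ := exists_unit_eig_le_quad hX hr hk
  rw [quad_eq_inner, LinearMap.mem_ker.1 hv, inner_zero_right] at hle
  linarith

lemma eig_pos_of_le_rank (hX : X.PosSemidef) {r : ℕ} (hr : 1 ≤ r) (h : r ≤ X.rank) :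
    0 < eig X r := by
  rw [← finrank_im] at h
  obtain ⟨v, ⟨y, hy⟩, hv1, hle⟩ := exists_unit_quad_le_eig hX.1 hr h
  refine lt_of_lt_of_le (lt_of_le_of_ne ((posSemidef_iff_quad.1 hX).2 v) fun h0 => ?_) hle
  have h1 := act_eq_zero_of_quad_eq_zero hX h0.symm
  have : inner ℝ v v = (0 : ℝ) := by
    nth_rw 1 [← hy]
    rw [inner_act_comm hX.1, h1, inner_zero_right]
  rw [real_inner_self_eq_norm_sq, hv1] at this
  norm_num at this

lemma eig_nonpos_of_rank_lt (hX : X.IsHermitian) {k : ℕ} (hk : k ≤ n) (h : X.rank < k) :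
    eig X k ≤ 0 := by
  by_contra! hpos
  exact absurd (le_rank_of_eig_pos hX hk hpos) (by omega)

lemma eig_nonneg (hX : X.PosSemidef) (i : Fin n) : 0 ≤ eig X (i + 1) := by
  obtain ⟨e, he⟩ := exists_eigenbasis hX.1
  rw [← he.quad_basis]
  exact (posSemidef_iff_quad.1 hX).2 _

end SpectraFW

namespace SpectraFW

variable {n : ℕ} {A B X Y D : Mat n} {f : Mat n → ℝ} {g : Mat n → Mat n} {β : ℝ}

/-! ### The spectrahedron -/

lemma mem_spectrahedron_iff : X ∈ spectrahedron n ↔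
    X.IsSymm ∧ (∀ v : Vec n, 0 ≤ quad X v) ∧ X.trace = 1 := by
  rw [spectrahedron, Set.mem_ofPred_eq, posSemidef_iff_quad, and_assoc]

lemma convex_spectrahedron : Convex ℝ (spectrahedron n) := by
  intro X hX Y hY a b ha hb hab
  rw [mem_spectrahedron_iff] at *
  refine ⟨(hX.1.smul a).add (hY.1.smul b), fun v => ?_, ?_⟩
  · rw [quad_add, quad_smul, quad_smul]
    exact add_nonneg (mul_nonneg ha (hX.2.1 v)) (mul_nonneg hb (hY.2.1 v))
  · rw [Matrix.trace_add, Matrix.trace_smul, Matrix.trace_smul, hX.2.2, hY.2.2]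
    simpa using hab

lemma outer_mem_spectrahedron {v : Vec n} (hv : ‖v‖ = 1) : outer v ∈ spectrahedron n :=
  ⟨outer_posSemidef v, by rw [trace_outer, hv, one_pow]⟩

lemma quad_nonneg (hX : X ∈ spectrahedron n) (v : Vec n) : 0 ≤ quad X v :=
  (posSemidef_iff_quad.1 hX.1).2 v

lemma sum_eig_eq_one (hX : X ∈ spectrahedron n) : ∑ i : Fin n, eig X (i + 1) = 1 := by
  obtain ⟨e, he⟩ := exists_eigenbasis hX.1.1
  rw [← hX.2, trace_eq_sum e]
  exact Finset.sum_congr rfl fun i _ => (he.quad_basis i).symm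

lemma eig_le_one (hX : X ∈ spectrahedron n) (i : Fin n) : eig X (i + 1) ≤ 1 := by
  rw [← sum_eig_eq_one hX]
  exact Finset.single_le_sum (f := fun i : Fin n => eig X (i + 1)) (fun j _ => eig_nonneg hX.1 j)
    (Finset.mem_univ i)

lemma quad_le_one (hX : X ∈ spectrahedron n) {v : Vec n} (hv : ‖v‖ = 1) : quad X v ≤ 1 := by
  obtain ⟨e, he⟩ := exists_eigenbasis hX.1.1
  rw [he.quad_eq_sum hX.1.1]
  calc _ ≤ ∑ i : Fin n, 1 * inner ℝ (e i) v ^ 2 := Finset.sum_le_sum fun i _ =>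
        mul_le_mul_of_nonneg_right (eig_le_one hX i) (sq_nonneg _)
    _ = 1 := by simp [e.sum_sq_inner_right, hv]

lemma frobInner_self_le_one (hX : X ∈ spectrahedron n) : frobInner X X ≤ 1 := by
  obtain ⟨e, he⟩ := exists_eigenbasis hX.1.1
  rw [he.frobInner_eq_sum, ← sum_eig_eq_one hX]
  refine Finset.sum_le_sum fun i _ => ?_
  exact mul_le_of_le_one_right (eig_nonneg hX.1 i) (quad_le_one hX (e.orthonormal.1 i))

lemma frobNorm_le_one (hX : X ∈ spectrahedron n) : frobNorm X ≤ 1 :=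
  Real.sqrt_le_one.2 (frobInner_self_le_one hX)

/-- Expand the square and use `‖X‖_F ≤ 1`. Unlike the crude bound `2`, the right side vanishes as
`vᵀXv → 1`, which is what the rank-one rate exploits. -/
lemma frobNorm_sub_outer_sq_le (hX : X ∈ spectrahedron n) {v : Vec n} (hv : ‖v‖ = 1) :
    frobNorm (X - outer v) ^ 2 ≤ 2 * (1 - quad X v) := by
  rw [frobNorm_sq, frobInner_sub_left, map_sub, map_sub, frobInner_comm (outer v) X,
    frobInner_outer, frobInner_outer, quad_outer, real_inner_self_eq_norm_sq, hv]
  have := frobInner_self_le_one hX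
  linarith

lemma frobNorm_sub_outer_sq_le_two (hX : X ∈ spectrahedron n) {v : Vec n} (hv : ‖v‖ = 1) :
    frobNorm (X - outer v) ^ 2 ≤ 2 := by
  have := frobNorm_sub_outer_sq_le hX hv
  have := quad_nonneg hX v
  linarith

lemma rank_pos (hX : X ∈ spectrahedron n) : 1 ≤ X.rank := by
  by_contra! h
  have h1 : LinearMap.ker (Matrix.toEuclideanLin X) = ⊤ := by
    apply Submodule.eq_top_of_finrank_eq
    have := finrank_ker_add_rank X
    simp only [finrank_euclideanSpace, Fintype.card_fin]
    omega
  have h0 : X = 0 := Matrix.toEuclideanLin.injective (by rw [LinearMap.ker_eq_top.1 h1, map_zero])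
  have := hX.2
  simp [h0] at this

/-! ### Smooth convex functions -/

namespace IsSmoothConvex

/-- The line through `X` and `Y` stays in the symmetric matrices for every real parameter, so the
derivative is two-sided even at the endpoints, where the line may leave the spectrahedron. -/
lemma hasDerivAt_segment (hf : IsSmoothConvex f g β) (hX : X ∈ spectrahedron n)
    (hY : Y ∈ spectrahedron n) {s : ℝ} (hs : s ∈ Set.Icc (0 : ℝ) 1) :
    HasDerivAt (fun s : ℝ => f (X + s • (Y - X))) (frobInner (g (X + s • (Y - X))) (Y - X)) s := by
  let _ : NormedAddCommGroup (Mat n) := Matrix.normedAddCommGroup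
  let _ : NormedSpace ℝ (Mat n) := Matrix.normedSpace
  have hmem := convex_spectrahedron.add_smul_sub_mem hX hY hs
  have h1 := (hf.gradient _ hmem).2
  have h2 : HasDerivWithinAt (fun s : ℝ => X + s • (Y - X)) (Y - X) Set.univ s := by
    have := (((hasDerivAt_id s).smul_const (Y - X)).const_add X).hasDerivWithinAt (s := Set.univ)
    rwa [one_smul] at this
  have h3 := HasFDerivWithinAt.comp_hasDerivWithinAt s h1 h2 (fun r _ => by
    exact (mem_spectrahedron_iff.1 hX).1.add
      (((mem_spectrahedron_iff.1 hY).1.sub (mem_spectrahedron_iff.1 hX).1).smul r))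
  exact hasDerivWithinAt_univ.1 h3

/-- The descent lemma. Along the segment the derivative is at most `a + s b` by Cauchy-Schwarz and
the Lipschitz bound, and this comparison is integrated. -/
lemma le_add (hf : IsSmoothConvex f g β) (hX : X ∈ spectrahedron n) (hY : Y ∈ spectrahedron n) :
    f Y ≤ f X + frobInner (g X) (Y - X) + β / 2 * frobNorm (Y - X) ^ 2 := by
  set a := frobInner (g X) (Y - X)
  set b := β * frobNorm (Y - X) ^ 2 with hb
  have key := image_le_of_deriv_right_le_deriv_boundary (a := (0 : ℝ)) (b := 1)
    (f := fun s : ℝ => f (X + s • (Y - X))) (f' := fun s => frobInner (g (X + s • (Y - X))) (Y - X))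
    (fun s hs => (hf.hasDerivAt_segment hX hY hs).continuousAt.continuousWithinAt)
    (fun s hs => (hf.hasDerivAt_segment hX hY (Set.Ico_subset_Icc_self hs)).hasDerivWithinAt)
    (B := fun s => f X + s * a + s ^ 2 / 2 * b) (B' := fun s => a + s * b)
    (by simp) (by fun_prop)
    (fun s _ => by
      have h1 : HasDerivAt (fun s : ℝ => f X + s * a + s ^ 2 / 2 * b) (a + s * b) s := by
        have h2 := (((hasDerivAt_id s).mul_const a).const_add (f X)).add
          ((((hasDerivAt_id s).pow 2).div_const 2).mul_const b)
        refine h2.congr_deriv ?_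
        simp only [id, Nat.cast_ofNat]
        ring
      exact h1.hasDerivWithinAt)
    (fun s hs => by
      have hmem := convex_spectrahedron.add_smul_sub_mem hX hY (Set.Ico_subset_Icc_self hs)
      have h1 := (le_abs_self _).trans (abs_frobInner_le (g (X + s • (Y - X)) - g X) (Y - X))
      have h2 := hf.smooth _ hmem _ hX
      have h3 : frobNorm (X + s • (Y - X) - X) = s * frobNorm (Y - X) := by
        rw [add_sub_cancel_left, frobNorm, frobInner_smul_left, map_smul, smul_eq_mul, ← mul_assoc,
          Real.sqrt_mul (by nlinarith [hs.1]), Real.sqrt_mul_self hs.1]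
        rfl
      rw [h3] at h2
      rw [frobInner_sub_left] at h1
      have h4 := mul_le_mul_of_nonneg_right h2 (frobNorm_nonneg (Y - X))
      simp only [hb, a]
      nlinarith)
  have := key (Set.right_mem_Icc.2 zero_le_one)
  simp only [one_smul, add_sub_cancel, one_mul, one_pow] at this
  rw [hb] at this
  linarith

lemma add_le (hf : IsSmoothConvex f g β) (hX : X ∈ spectrahedron n) (hY : Y ∈ spectrahedron n) :
    f X + frobInner (g X) (Y - X) ≤ f Y := by
  have h := (hf.hasDerivAt_segment hX hY (Set.left_mem_Icc.2 zero_le_one)).tendsto_slope_zero_right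
  simp only [zero_add, zero_smul, add_zero] at h
  have h2 : frobInner (g X) (Y - X) ≤ f Y - f X := by
    refine le_of_tendsto h ?_
    filter_upwards [Ioo_mem_nhdsGT zero_lt_one] with s hs
    have h3 := hf.convex.2 hX hY (sub_nonneg.2 hs.2.le) hs.1.le (sub_add_cancel 1 s)
    have h4 : X + s • (Y - X) = (1 - s) • X + s • Y := by
      rw [smul_sub, sub_smul, one_smul]; abel
    rw [h4, smul_eq_mul, inv_mul_le_iff₀ hs.1]
    simp only [smul_eq_mul] at h3
    linarith
  linarith

lemma bddBelow (hf : IsSmoothConvex f g β) : BddBelow (f '' spectrahedron n) := by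
  rcases (spectrahedron n).eq_empty_or_nonempty with h | ⟨X, hX⟩
  · simp [h]
  · refine ⟨f X - frobNorm (g X) - frobInner (g X) X, ?_⟩
    rintro _ ⟨Y, hY, rfl⟩
    have h1 := hf.add_le hX hY
    have h2 := (abs_le.1 (abs_frobInner_le (g X) Y)).1
    have h3 := mul_le_mul_of_nonneg_left (frobNorm_le_one hY) (frobNorm_nonneg (g X))
    rw [map_sub] at h1
    linarith

lemma optVal_le (hf : IsSmoothConvex f g β) (hX : X ∈ spectrahedron n) : optVal f ≤ f X :=
  csInf_le hf.bddBelow ⟨X, hX, rfl⟩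

lemma isSymm (hf : IsSmoothConvex f g β) (hX : X ∈ spectrahedron n) : (g X).IsHermitian :=
  Matrix.isHermitian_iff_isSymm.2 (hf.gradient X hX).1

/-- The Frank-Wolfe gap bounds the suboptimality. -/
lemma sub_optVal_le_of_isLeading (hf : IsSmoothConvex f g β) (hX : X ∈ spectrahedron n)
    {v : Vec n} (hv : IsLeadingEigenvector (-g X) v) :
    f X - optVal f ≤ frobInner (g X) X - quad (g X) v := by
  have h : f X - (frobInner (g X) X - quad (g X) v) ≤ optVal f := by
    refine le_csInf ⟨_, X, hX, rfl⟩ ?_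
    rintro _ ⟨Y, hY, rfl⟩
    have h1 := hf.add_le hX hY
    obtain ⟨e, he⟩ := exists_eigenbasis hY.1.1
    have h2 : quad (g X) v ≤ frobInner (g X) Y := by
      rw [frobInner_comm, he.frobInner_eq_sum, ← one_mul (quad (g X) v), ← sum_eig_eq_one hY,
        Finset.sum_mul]
      refine Finset.sum_le_sum fun i _ => mul_le_mul_of_nonneg_left ?_ (eig_nonneg hY.1 i)
      have := hv.quad_le (hf.isSymm hX).neg (e i)
      rw [quad_neg, quad_neg, e.orthonormal.1] at this
      linarith
    rw [map_sub] at h1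
    linarith
  linarith

end IsSmoothConvex

lemma optVal_eq_of_mem_minimizers (hX : X ∈ minimizers f) : optVal f = f X :=
  le_antisymm (csInf_le ⟨f X, by rintro _ ⟨Y, hY, rfl⟩; exact hX.2 Y hY⟩ ⟨X, hX.1, rfl⟩)
    (le_csInf ⟨_, X, hX.1, rfl⟩ (by rintro _ ⟨Y, hY, rfl⟩; exact hX.2 Y hY))

lemma mem_minimizers_of_le (hf : IsSmoothConvex f g β) (hX : X ∈ spectrahedron n)
    (h : f X ≤ optVal f) : X ∈ minimizers f :=
  ⟨hX, fun _ hY => h.trans (hf.optVal_le hY)⟩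

end SpectraFW

namespace SpectraFW

variable {n : ℕ} {A B X Y D X' Z : Mat n} {f : Mat n → ℝ} {g : Mat n → Mat n} {β : ℝ}
  {u v w : Vec n}

/-! ### The pseudo-inverse and maximal step sizes -/

lemma toEuclideanLin_mul_apply (A B : Mat n) (v : Vec n) :
    Matrix.toEuclideanLin (A * B) v = Matrix.toEuclideanLin A (Matrix.toEuclideanLin B v) := by
  simp [Matrix.toLpLin_apply, Matrix.mulVec_mulVec]

lemma isSymm_sum_outer (e : Fin n → Vec n) (d : Fin n → ℝ) :
    (∑ i, d i • outer (e i)).IsSymm := by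
  rw [Matrix.IsSymm, Matrix.transpose_sum]
  exact Finset.sum_congr rfl fun i _ => (outer_isSymm (e i)).smul (d i)

lemma exists_isMoorePenrose (hX : X.IsHermitian) : ∃ B, IsMoorePenrose X B := by
  obtain ⟨e, he⟩ := exists_eigenbasis hX
  let d : Fin n → ℝ := fun i => eig X (i + 1)
  have hB := toEuclideanLin_sum_outer e fun i => (d i)⁻¹
  have hX' : ∀ i, Matrix.toEuclideanLin X (e i) = d i • e i := he
  have h1 : X * ∑ i, (d i)⁻¹ • outer (e i) = ∑ i, (d i * (d i)⁻¹) • outer (e i) :=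
    eq_of_act_basis e fun i => by
      rw [toEuclideanLin_mul_apply, hB, map_smul, hX', toEuclideanLin_sum_outer, smul_smul, mul_comm]
  have h2 : (∑ i, (d i)⁻¹ • outer (e i)) * X = ∑ i, (d i * (d i)⁻¹) • outer (e i) :=
    eq_of_act_basis e fun i => by
      rw [toEuclideanLin_mul_apply, hX', map_smul, hB, toEuclideanLin_sum_outer, smul_smul]
  refine ⟨∑ i, (d i)⁻¹ • outer (e i), ?_, ?_, ?_, ?_⟩
  · refine eq_of_act_basis e fun i => ?_
    rw [h1, toEuclideanLin_mul_apply, hX', map_smul, toEuclideanLin_sum_outer, smul_smul,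
      mul_comm, mul_assoc]
    by_cases h : d i = 0 <;> simp [h]
  · refine eq_of_act_basis e fun i => ?_
    rw [h2, toEuclideanLin_mul_apply, hB, map_smul, toEuclideanLin_sum_outer, smul_smul]
    -- The convention `0⁻¹ = 0` makes the inverse vanish on the kernel.
    by_cases h : d i = 0 <;> simp [h]
  · rw [h1]; exact isSymm_sum_outer e _
  · rw [h2]; exact isSymm_sum_outer e _

lemma mul_pinv_mul (hX : X.IsHermitian) : X * pinv X * X = X := by
  rw [pinv, dif_pos (exists_isMoorePenrose hX)]
  exact (exists_isMoorePenrose hX).choose_spec.1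

lemma quad_pinv_act (hX : X.IsHermitian) (y : Vec n) :
    quad (pinv X) (Matrix.toEuclideanLin X y) = quad X y := by
  rw [quad_eq_inner, inner_act_comm hX, ← toEuclideanLin_mul_apply, ← toEuclideanLin_mul_apply,
    mul_pinv_mul hX, quad_eq_inner]

/-- Writing `u = X y` turns `uᵀX†u` into `yᵀXy`; after this the pseudo-inverse is no longer needed.
-/
lemma exists_maxStep_eq (hX : X.PosSemidef) (hu : u ∈ im X) (hu0 : ‖u‖ = 1) :
    ∃ y, Matrix.toEuclideanLin X y = u ∧ 0 < quad X y ∧ maxStep X u = (quad X y)⁻¹ := by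
  obtain ⟨y, rfl⟩ := hu
  refine ⟨y, rfl, lt_of_le_of_ne ((posSemidef_iff_quad.1 hX).2 y) fun h => ?_, ?_⟩
  · rw [act_eq_zero_of_quad_eq_zero hX h.symm] at hu0
    simp at hu0
  · rw [maxStep, quad_pinv_act hX.1]

lemma maxStep_pos (hX : X.PosSemidef) (hu : u ∈ im X) (hu1 : ‖u‖ = 1) : 0 < maxStep X u := by
  obtain ⟨y, -, hy, h⟩ := exists_maxStep_eq hX hu hu1
  rw [h]
  exact inv_pos.2 hy

/-- With `u = X y`, Cauchy-Schwarz for the form of `X` reads `⟨u, v⟩² ≤ (yᵀXy)(vᵀXv)`, and `yᵀXy` is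
the inverse of the maximal step. -/
lemma sub_smul_outer_posSemidef (hX : X.PosSemidef) (hu : u ∈ im X) (hu1 : ‖u‖ = 1) {η : ℝ}
    (hη : η ≤ maxStep X u) : (X - η • outer u).PosSemidef := by
  obtain ⟨y, hy, hy0, h⟩ := exists_maxStep_eq hX hu hu1
  refine posSemidef_iff_quad.2 ⟨(posSemidef_iff_quad.1 hX).1.sub ((outer_isSymm u).smul η),
    fun v => ?_⟩
  have h1 := inner_act_sq_le hX v y
  rw [hy, real_inner_comm] at h1
  have h2 : η * inner ℝ u v ^ 2 ≤ (quad X y)⁻¹ * inner ℝ u v ^ 2 :=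
    mul_le_mul_of_nonneg_right (hη.trans h.le) (sq_nonneg _)
  have h3 : (quad X y)⁻¹ * inner ℝ u v ^ 2 ≤ quad X v := by
    rw [inv_mul_le_iff₀ hy0]
    linarith
  rw [quad_sub, quad_smul, quad_outer]
  linarith

lemma awayPoint_mem (hX : X ∈ spectrahedron n) (hu : u ∈ im X) (hu1 : ‖u‖ = 1) {η : ℝ}
    (hη : η ≤ maxStep X u) (hη1 : η < 1) : awayPoint X u η ∈ spectrahedron n := by
  have h1 : 0 < 1 - η := sub_pos.2 hη1
  refine ⟨(sub_smul_outer_posSemidef hX.1 hu hu1 hη).smul (inv_nonneg.2 h1.le), ?_⟩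
  rw [awayPoint, Matrix.trace_smul, Matrix.trace_sub, hX.2, Matrix.trace_smul, trace_outer, hu1]
  simp [h1.ne']

/-- The substitution `η = s / (1 + s)` makes the away step affine in `s`, so that the descent lemma
bounds it by a quadratic in `s`. -/
lemma awayPoint_eq (X : Mat n) (v : Vec n) {s : ℝ} (hs : 0 ≤ s) :
    awayPoint X v (s / (1 + s)) = X + s • (X - outer v) := by
  have h1 : 1 + s ≠ 0 := by positivity
  have h2 : (1 - s / (1 + s))⁻¹ = 1 + s := by
    rw [one_sub_div h1]; simp
  rw [awayPoint, h2, smul_sub, smul_smul, mul_div_cancel₀ _ h1, smul_sub, add_smul, one_smul]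
  abel

lemma fwPoint_eq (X : Mat n) (v : Vec n) (η : ℝ) :
    fwPoint X v η = X + η • (outer v - X) := by
  rw [fwPoint, smul_sub, sub_smul, one_smul]
  abel

lemma fwPoint_mem (hX : X ∈ spectrahedron n) (hv : ‖v‖ = 1) {η : ℝ} (hη : η ∈ Set.Icc (0 : ℝ) 1) :
    fwPoint X v η ∈ spectrahedron n :=
  convex_spectrahedron hX (outer_mem_spectrahedron hv) (sub_nonneg.2 hη.2) hη.1 (sub_add_cancel 1 η)

lemma pairwisePoint_mem (hX : X ∈ spectrahedron n) (hu : u ∈ im X) (hu1 : ‖u‖ = 1)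
    (hw : ‖w‖ = 1) : X + maxStep X u • (outer w - outer u) ∈ spectrahedron n := by
  have h : X + maxStep X u • (outer w - outer u)
      = (X - maxStep X u • outer u) + maxStep X u • outer w := by
    rw [smul_sub]; abel
  refine ⟨?_, ?_⟩
  · rw [h]
    exact (sub_smul_outer_posSemidef hX.1 hu hu1 le_rfl).add
      ((outer_posSemidef w).smul (maxStep_pos hX.1 hu hu1).le)
  · rw [Matrix.trace_add, Matrix.trace_smul, Matrix.trace_sub, trace_outer, trace_outer, hu1, hw,
      hX.2]
    simp

/-! ### Rank along the iterations -/

lemma rank_smul_le (a : ℝ) (A : Mat n) : (a • A).rank ≤ A.rank := by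
  refine rank_le_of_ker_le fun v hv => ?_
  rw [LinearMap.mem_ker] at *
  rw [map_smul, LinearMap.smul_apply, hv, smul_zero]

lemma rank_add_le (A B : Mat n) : (A + B).rank ≤ A.rank + B.rank := by
  rw [← finrank_im, ← finrank_im, ← finrank_im]
  refine (Submodule.finrank_mono (t := im A ⊔ im B) ?_).trans
    (Submodule.finrank_add_le_finrank_add_finrank _ _)
  rintro _ ⟨y, rfl⟩
  rw [map_add, LinearMap.add_apply]
  exact Submodule.add_mem_sup ⟨y, rfl⟩ ⟨y, rfl⟩

lemma rank_outer_le (v : Vec n) : (outer v).rank ≤ 1 :=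
  Matrix.rank_vecMulVec_le _ _

lemma ker_le_ker_sub_outer (hX : X.IsHermitian) (hu : u ∈ im X) (η : ℝ) :
    LinearMap.ker (Matrix.toEuclideanLin X) ≤
      LinearMap.ker (Matrix.toEuclideanLin (X - η • outer u)) := by
  obtain ⟨y, rfl⟩ := hu
  intro z hz
  rw [LinearMap.mem_ker] at *
  rw [map_sub, map_smul, LinearMap.sub_apply, LinearMap.smul_apply, toEuclideanLin_outer, hz,
    inner_act_comm hX, hz, inner_zero_right, zero_smul, smul_zero, sub_zero]

lemma rank_sub_outer_le (hX : X.IsHermitian) (hu : u ∈ im X) (η : ℝ) :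
    (X - η • outer u).rank ≤ X.rank :=
  rank_le_of_ker_le (ker_le_ker_sub_outer hX hu η)

/-- The kernel of `X` survives because it is orthogonal to `u`, and the vector `y` with `X y = u` is
a new element of the kernel. -/
lemma rank_sub_maxStep_outer_lt (hX : X.PosSemidef) (hu : u ∈ im X) (hu1 : ‖u‖ = 1) :
    (X - maxStep X u • outer u).rank < X.rank := by
  obtain ⟨y, hy, hy0, h⟩ := exists_maxStep_eq hX hu hu1
  refine rank_lt_of_ker_lt (lt_of_le_of_ne (ker_le_ker_sub_outer hX.1 hu _) fun heq => ?_)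
  have hmem : y ∈ LinearMap.ker (Matrix.toEuclideanLin (X - maxStep X u • outer u)) := by
    have h1 : inner ℝ u y = quad X y := by
      rw [← hy, inner_act_comm hX.1, quad_eq_inner]
    rw [LinearMap.mem_ker, map_sub, map_smul, LinearMap.sub_apply, LinearMap.smul_apply,
      toEuclideanLin_outer, hy, h1, smul_smul, h, inv_mul_cancel₀ hy0.ne', one_smul, sub_self]
  rw [← heq, LinearMap.mem_ker, hy] at hmem
  rw [hmem, norm_zero] at hu1
  exact zero_ne_one hu1

/-! ### One iteration -/

namespace IsIteration

lemma mem_of_drop (h : IsIteration f g β X v u X') (hX : X ∈ spectrahedron n)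
    (hd : DropTaken f X v) : X' ∈ spectrahedron n := by
  rw [h.drop hd]
  exact awayPoint_mem hX h.away.1 h.away.2.1 le_rfl hd.1

lemma rank_lt_of_drop (h : IsIteration f g β X v u X') (hX : X ∈ spectrahedron n)
    (hd : DropTaken f X v) : X'.rank < X.rank := by
  rw [h.drop hd]
  exact (rank_smul_le _ _).trans_lt (rank_sub_maxStep_outer_lt hX.1 h.away.1 h.away.2.1)

lemma mem (h : IsIteration f g β X v u X') (hX : X ∈ spectrahedron n) : X' ∈ spectrahedron n := by
  by_cases hd : DropTaken f X v
  · exact h.mem_of_drop hX hd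
  obtain ⟨hu, hu1, ZF, ZA, ZP, ⟨wF, η, hwF, hη, -, rfl⟩, ⟨η', -, hη', hη1, -, rfl⟩, ⟨w, hw, rfl⟩,
    rfl | rfl | rfl, -⟩ := h.no_drop hd
  · exact fwPoint_mem hX hwF.1 hη
  · exact awayPoint_mem hX h.away.1 h.away.2.1 hη' hη1
  · exact pairwisePoint_mem hX hu hu1 hw.1

lemma rank_le_of_not_drop (h : IsIteration f g β X v u X') (hX : X ∈ spectrahedron n)
    (hd : ¬ DropTaken f X v) : X'.rank ≤ X.rank + 1 := by
  obtain ⟨hu, hu1, ZF, ZA, ZP, ⟨wF, η, hwF, hη, -, rfl⟩, ⟨η', -, hη', hη1, -, rfl⟩, ⟨w, hw, rfl⟩,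
    rfl | rfl | rfl, -⟩ := h.no_drop hd
  · refine (rank_add_le _ _).trans (add_le_add (rank_smul_le _ _) ?_)
    exact (rank_smul_le _ _).trans (rank_outer_le _)
  · refine (rank_smul_le _ _).trans ((rank_sub_outer_le hX.1.1 h.away.1 _).trans (by omega))
  · have : X + maxStep X u • (outer w - outer u)
        = (X - maxStep X u • outer u) + maxStep X u • outer w := by
      rw [smul_sub]; abel
    rw [this]
    refine (rank_add_le _ _).trans (add_le_add (rank_sub_outer_le hX.1.1 hu _) ?_)
    exact (rank_smul_le _ _).trans (rank_outer_le _)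

/-- The decrease of a Frank-Wolfe step. -/
lemma exists_fw_le (hf : IsSmoothConvex f g β) (h : IsIteration f g β X v u X')
    (hX : X ∈ spectrahedron n) (hd : ¬ DropTaken f X v) :
    ∃ w, IsLeadingEigenvector (-g X) w ∧ ∀ η ∈ Set.Icc (0 : ℝ) 1,
      f X' ≤ f X - η * (frobInner (g X) X - quad (g X) w)
        + β / 2 * (η ^ 2 * frobNorm (X - outer w) ^ 2) := by
  obtain ⟨-, -, ZF, ZA, ZP, ⟨w, η₀, hw, -, hmin, rfl⟩, -, -, -, hle, -⟩ := h.no_drop hd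
  refine ⟨w, hw, fun η hη => ?_⟩
  have h1 := hf.le_add hX (fwPoint_mem hX hw.1 hη)
  have h2 : fwPoint X w η - X = η • (outer w - X) := by rw [fwPoint_eq]; abel
  rw [h2, frobNorm_sq, frobInner_smul_left, map_smul, map_smul, map_sub, frobInner_outer,
    ← frobNorm_sq, frobNorm_sub_comm] at h1
  have := hle.trans (hmin η hη)
  rw [smul_eq_mul, smul_eq_mul] at h1
  linarith

lemma le_self (hf : IsSmoothConvex f g β) (h : IsIteration f g β X v u X')
    (hX : X ∈ spectrahedron n) : f X' ≤ f X := by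
  by_cases hd : DropTaken f X v
  · rw [h.drop hd]
    exact hd.2
  · obtain ⟨w, -, hle⟩ := h.exists_fw_le hf hX hd
    simpa using hle 0 (by simp)

/-- If no drop step is taken, a Frank-Wolfe step with a large gap makes progress. -/
lemma le_of_fw_gap (hf : IsSmoothConvex f g β) (h : IsIteration f g β X v u X')
    (hX : X ∈ spectrahedron n) (hd : ¬ DropTaken f X v) (hβ : 0 < β) {q : ℝ} (hq : 0 ≤ q)
    (hqβ : q ≤ 2 * β)
    (hgap : ∀ w, IsLeadingEigenvector (-g X) w → q ≤ frobInner (g X) X - quad (g X) w) :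
    f X' ≤ f X - q ^ 2 / (4 * β) := by
  obtain ⟨w, hw, hle⟩ := h.exists_fw_le hf hX hd
  have h1 := hle (q / (2 * β)) ⟨by positivity, by rw [div_le_one (by positivity)]; exact hqβ⟩
  have h2 := mul_le_mul_of_nonneg_left (hgap w hw) (show 0 ≤ q / (2 * β) by positivity)
  have h3 := mul_le_mul_of_nonneg_left (frobNorm_sub_outer_sq_le_two hX hw.1)
    (show 0 ≤ β / 2 * (q / (2 * β)) ^ 2 by positivity)
  have h4 : q / (2 * β) * q - β / 2 * (q / (2 * β)) ^ 2 * 2 = q ^ 2 / (4 * β) := by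
    field_simp; ring
  linarith

/-- If no drop step is taken, an away step with a large gap makes progress. -/
lemma le_of_away_gap (hf : IsSmoothConvex f g β) (h : IsIteration f g β X v u X')
    (hX : X ∈ spectrahedron n) (hd : ¬ DropTaken f X v) (hβ : 0 < β) {q : ℝ} (hq : 0 ≤ q)
    (hgap : q ≤ quad (g X) v - frobInner (g X) X) :
    f X' ≤ f X - q ^ 2 / (4 * β) := by
  obtain ⟨-, -, ZF, ZA, ZP, -, ⟨η₀, -, -, -, hmin, rfl⟩, -, -, -, hle, -⟩ := h.no_drop hd
  obtain ⟨hv, hv1, -⟩ := h.away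
  have hstep : ∀ s : ℝ, 0 ≤ s → s / (1 + s) ≤ maxStep X v →
      f (awayPoint X v (s / (1 + s))) ≤ f X - s * q + β * s ^ 2 := by
    intro s hs hsle
    have hs1 : s / (1 + s) < 1 := by rw [div_lt_one (by positivity)]; linarith
    have h1 := hf.le_add hX (awayPoint_mem hX hv hv1 hsle hs1)
    have h2 : awayPoint X v (s / (1 + s)) - X = s • (X - outer v) := by
      rw [awayPoint_eq X v hs]; abel
    rw [h2, frobNorm_sq, frobInner_smul_left, map_smul, map_smul, ← frobNorm_sq, map_sub,
      frobInner_outer, smul_eq_mul, smul_eq_mul] at h1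
    have h3 := mul_le_mul_of_nonneg_left (frobNorm_sub_outer_sq_le_two hX hv1)
      (show 0 ≤ β / 2 * s ^ 2 by positivity)
    have h4 := mul_le_mul_of_nonneg_left hgap hs
    rw [frobNorm_sq] at h3 h1
    linarith
  have hs0 : 0 ≤ q / (2 * β) := by positivity
  -- If the step `s = q / (2β)` were too long, the maximal step would correspond to some smaller
  -- positive `s`, for which `-s q + β s² ≤ 0`. The drop test would then have succeeded.
  have hfeas : q / (2 * β) / (1 + q / (2 * β)) ≤ maxStep X v := by
    by_contra! hlt
    have hlt1 : maxStep X v < 1 :=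
      hlt.trans (by rw [div_lt_one (by positivity)]; linarith)
    have hpos := maxStep_pos hX.1 hv hv1
    set l := maxStep X v with hl
    have h1l : 0 < 1 - l := sub_pos.2 hlt1
    have hs : 0 < l / (1 - l) := div_pos hpos h1l
    have heq : l / (1 - l) / (1 + l / (1 - l)) = l := by
      field_simp; ring
    have h1 := hstep (l / (1 - l)) hs.le heq.le
    rw [heq] at h1
    have h2 : l / (1 - l) < q / (2 * β) := by
      rw [lt_div_iff₀ (by positivity)] at hlt
      rw [div_lt_iff₀ h1l]
      linarith
    rw [lt_div_iff₀ (by positivity)] at h2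
    exact hd ⟨hlt1, h1.trans (by nlinarith)⟩
  have hs1 : q / (2 * β) / (1 + q / (2 * β)) < 1 := by
    rw [div_lt_one (by positivity)]; linarith
  have h1 := hstep _ hs0 hfeas
  have h2 := hle.trans (hmin _ (by positivity) hfeas hs1)
  have h4 : q / (2 * β) * q - β * (q / (2 * β)) ^ 2 = q ^ 2 / (4 * β) := by
    field_simp; ring
  linarith

end IsIteration

/-! ### Trajectories: drop steps and the sublinear rate -/

namespace IsTrajectory

variable {X : ℕ → Mat n} {v u : ℕ → Vec n}

lemma mem (h : IsTrajectory f g β X v u) {t : ℕ} (ht : 1 ≤ t) : X t ∈ spectrahedron n := by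
  induction t, ht using Nat.le_induction with
  | base => exact h.1
  | succ t ht ih => exact (h.2 t ht).mem ih

/-- The iterations before `t` in which a drop step is taken. -/
def dropSet (f : Mat n → ℝ) (X : ℕ → Mat n) (v : ℕ → Vec n) (t : ℕ) : Set ℕ :=
  {s : ℕ | 1 ≤ s ∧ s < t ∧ DropTaken f (X s) (v s)}

lemma dropSet_finite (t : ℕ) : (dropSet f X v t).Finite :=
  (Set.finite_lt_nat t).subset fun _ hs => hs.2.1

lemma ncard_dropSet_succ_of_drop {t : ℕ} (ht : 1 ≤ t) (hd : DropTaken f (X t) (v t)) :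
    (dropSet f X v (t + 1)).ncard = (dropSet f X v t).ncard + 1 := by
  have : dropSet f X v (t + 1) = insert t (dropSet f X v t) := by
    ext s
    simp only [dropSet, Set.mem_ofPred_eq, Set.mem_insert_iff]
    constructor
    · rintro ⟨h1, h2, h3⟩
      rcases Nat.lt_succ_iff_lt_or_eq.1 h2 with h | h
      · exact Or.inr ⟨h1, h, h3⟩
      · exact Or.inl h
    · rintro (rfl | ⟨h1, h2, h3⟩)
      · exact ⟨ht, by omega, hd⟩
      · exact ⟨h1, by omega, h3⟩
  rw [this, Set.ncard_insert_of_notMem (fun h => lt_irrefl t h.2.1) (dropSet_finite t)]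

lemma dropSet_succ_of_not_drop {t : ℕ} (hd : ¬ DropTaken f (X t) (v t)) :
    dropSet f X v (t + 1) = dropSet f X v t := by
  ext s
  simp only [dropSet, Set.mem_ofPred_eq]
  constructor
  · rintro ⟨h1, h2, h3⟩
    refine ⟨h1, lt_of_le_of_ne (Nat.lt_succ_iff.1 h2) ?_, h3⟩
    rintro rfl
    exact hd h3
  · rintro ⟨h1, h2, h3⟩
    exact ⟨h1, by omega, h3⟩

lemma dropSet_one : dropSet f X v 1 = ∅ := by
  ext s
  simp only [dropSet, Set.mem_ofPred_eq, Set.mem_empty_iff_false, iff_false]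
  omega

/-- The potential `rank (X t) + 2 · (number of drops) - t` does not increase: a drop changes the
rank by at most `-1`, another iteration by at most `+1`. -/
lemma rank_add_ncard_le (h : IsTrajectory f g β X v u) {t : ℕ} (ht : 1 ≤ t) :
    (X t).rank + 2 * (dropSet f X v t).ncard + 1 ≤ (X 1).rank + t := by
  induction t, ht using Nat.le_induction with
  | base => simp [dropSet_one]
  | succ t ht ih =>
    by_cases hd : DropTaken f (X t) (v t)
    · have := (h.2 t ht).rank_lt_of_drop (h.mem ht) hd
      rw [ncard_dropSet_succ_of_drop ht hd]
      omega
    · have := (h.2 t ht).rank_le_of_not_drop (h.mem ht) hd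
      rw [dropSet_succ_of_not_drop hd]
      omega

lemma two_mul_ncard_le (h : IsTrajectory f g β X v u) {t : ℕ} (ht : 1 ≤ t) :
    2 * (dropSet f X v t).ncard + 2 ≤ (X 1).rank + t := by
  have := h.rank_add_ncard_le ht
  have := rank_pos (h.mem ht)
  omega

lemma ncard_dropSet_lt {t : ℕ} (ht : 1 ≤ t) : (dropSet f X v t).ncard + 1 ≤ t := by
  induction t, ht using Nat.le_induction with
  | base => simp [dropSet_one]
  | succ t ht ih =>
    by_cases hd : DropTaken f (X t) (v t)
    · rw [ncard_dropSet_succ_of_drop ht hd]; omega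
    · rw [dropSet_succ_of_not_drop hd]; omega

/-- One Frank-Wolfe step with line search. -/
lemma sub_optVal_succ_le (hf : IsSmoothConvex f g β) (h : IsTrajectory f g β X v u) {t : ℕ}
    (ht : 1 ≤ t) (hd : ¬ DropTaken f (X t) (v t)) {η : ℝ} (hη : η ∈ Set.Icc (0 : ℝ) 1) :
    f (X (t + 1)) - optVal f ≤ (1 - η) * (f (X t) - optVal f) + β * η ^ 2 := by
  obtain ⟨w, hw, hle⟩ := (h.2 t ht).exists_fw_le hf (h.mem ht) hd
  have h1 := hle η hη
  have h2 := mul_le_mul_of_nonneg_left (hf.sub_optVal_le_of_isLeading (h.mem ht) hw) hη.1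
  have h3 := mul_le_mul_of_nonneg_left (frobNorm_sub_outer_sq_le_two (h.mem ht) hw.1)
    (show 0 ≤ β / 2 * η ^ 2 from mul_nonneg (by have := hf.nonneg; positivity) (sq_nonneg _))
  linarith

/-- The sublinear rate in terms of the number of iterations without drop steps. -/
lemma sub_optVal_le (hf : IsSmoothConvex f g β) (h : IsTrajectory f g β X v u) {t : ℕ}
    (ht : 1 ≤ t) (hN : (dropSet f X v t).ncard + 2 ≤ t) :
    f (X t) - optVal f ≤ 4 * β / ((t : ℝ) - (dropSet f X v t).ncard + 1) := by
  have hβ := hf.nonneg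
  induction t, ht using Nat.le_induction with
  | base => omega
  | succ t ht ih =>
    by_cases hd : DropTaken f (X t) (v t)
    · rw [ncard_dropSet_succ_of_drop ht hd] at hN ⊢
      have h1 := ih (by omega)
      have h2 := (h.2 t ht).le_self hf (h.mem ht)
      push_cast
      have h3 : ((t : ℝ) + 1 - ((dropSet f X v t).ncard + 1) + 1)
        = (t : ℝ) - (dropSet f X v t).ncard + 1 := by ring
      rw [h3]
      linarith
    · rw [dropSet_succ_of_not_drop hd] at hN ⊢
      -- `N` counts the iterations before `t` without a drop step.
      obtain ⟨N, hN'⟩ := Nat.exists_eq_add_of_le (ncard_dropSet_lt (f := f) (X := X) (v := v) ht)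
      have hN'' : (t : ℝ) - (dropSet f X v t).ncard = N + 1 := by
        have : (t : ℝ) = (dropSet f X v t).ncard + 1 + N := by exact_mod_cast hN'
        rw [this]; ring
      have h3 : ((t + 1 : ℕ) : ℝ) - (dropSet f X v t).ncard + 1 = N + 3 := by
        push_cast
        linarith
      rw [h3]
      -- At the first iteration without a drop nothing is known about `h_t`, and `η = 1` removes it;
      -- afterwards `η = 2 / (N + 2)` closes the induction.
      rcases Nat.eq_zero_or_pos N with h0 | hpos
      · have h1 := h.sub_optVal_succ_le hf ht hd (η := 1) (by simp)
        have h4 : β ≤ 4 * β / ((N : ℝ) + 3) := by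
          rw [h0, le_div_iff₀ (by norm_num)]
          push_cast
          linarith
        linarith
      · have h1 := ih (by omega)
        have h2 := h.sub_optVal_succ_le hf ht hd (η := 2 / ((N : ℝ) + 2))
          ⟨by positivity, by rw [div_le_one (by positivity)]; linarith [(Nat.cast_nonneg N : (0 : ℝ) ≤ N)]⟩
        rw [hN''] at h1
        have h4 : 0 ≤ 1 - 2 / ((N : ℝ) + 2) := by
          rw [sub_nonneg, div_le_one (by positivity)]
          linarith [(Nat.cast_nonneg N : (0 : ℝ) ≤ N)]
        have h5 := mul_le_mul_of_nonneg_left h1 h4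
        have h6 : (1 - 2 / ((N : ℝ) + 2)) * (4 * β / ((N : ℝ) + 1 + 1)) + β * (2 / ((N : ℝ) + 2)) ^ 2
            ≤ 4 * β / ((N : ℝ) + 3) := by
          have : (1 - 2 / ((N : ℝ) + 2)) * (4 * β / ((N : ℝ) + 1 + 1)) + β * (2 / ((N : ℝ) + 2)) ^ 2
              = 4 * β * ((N : ℝ) + 1) / ((N : ℝ) + 2) ^ 2 := by
            rw [show (N : ℝ) + 1 + 1 = N + 2 by ring]
            field_simp
            ring
          rw [this, div_le_div_iff₀ (by positivity) (by positivity)]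
          nlinarith
        linarith

/-- The drop count turns `t - drops + 1` into at least `(t - rank (X 1) + 4) / 2`. -/
lemma sub_optVal_le_div (hf : IsSmoothConvex f g β) (h : IsTrajectory f g β X v u) {t : ℕ}
    (ht : (X 1).rank + 2 ≤ t) :
    f (X t) - optVal f ≤ 8 * β / ((t : ℝ) - (X 1).rank + 4) := by
  have hβ := hf.nonneg
  have h1 : 1 ≤ t := by omega
  have h2 := h.two_mul_ncard_le h1
  refine (h.sub_optVal_le hf h1 (by omega)).trans ?_
  have h3 : 2 * ((dropSet f X v t).ncard : ℝ) + 2 ≤ (X 1).rank + t := by exact_mod_cast h2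
  have h4 : ((X 1).rank : ℝ) + 2 ≤ t := by exact_mod_cast ht
  rw [div_le_div_iff₀ (by linarith) (by linarith)]
  nlinarith

end IsTrajectory

end SpectraFW

namespace SpectraFW

variable {n r : ℕ} {A B X Y D X' Z : Mat n} {f : Mat n → ℝ} {g : Mat n → Mat n} {α β δ lam : ℝ}
  {u v w : Vec n} {e : OrthonormalBasis (Fin n) ℝ (Vec n)}

/-! ### The gradient at a minimizer -/

lemma frobInner_grad_le (hf : IsSmoothConvex f g β) (hY : Y ∈ minimizers f)
    (hZ : Z ∈ spectrahedron n) : frobInner (g Y) Y ≤ frobInner (g Y) Z := by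
  have h := (hf.hasDerivAt_segment hY.1 hZ (Set.left_mem_Icc.2 zero_le_one)).tendsto_slope_zero_right
  simp only [zero_add, zero_smul, add_zero] at h
  have h2 : 0 ≤ frobInner (g Y) (Z - Y) := by
    refine ge_of_tendsto h ?_
    filter_upwards [Ioo_mem_nhdsGT zero_lt_one] with s hs
    have h3 := hY.2 _ (convex_spectrahedron.add_smul_sub_mem hY.1 hZ ⟨hs.1.le, hs.2.le⟩)
    exact mul_nonneg (inv_nonneg.2 hs.1.le) (sub_nonneg.2 h3)
  rw [map_sub] at h2
  linarith

/-- First-order optimality tested against the rank-one points `vvᵀ` with `‖v‖ = 1`. -/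
lemma grad_sub_posSemidef (hf : IsSmoothConvex f g β) (hY : Y ∈ minimizers f) :
    (g Y - frobInner (g Y) Y • (1 : Mat n)).PosSemidef := by
  refine posSemidef_iff_quad.2 ⟨(hf.gradient Y hY.1).1.sub (Matrix.isSymm_one.smul _), fun v => ?_⟩
  rw [quad_sub, quad_smul, quad_one]
  by_cases hv : v = 0
  · simp [hv, quad_zero_vec]
  have hv' : 0 < ‖v‖ := norm_pos_iff.2 hv
  have h1 : ‖‖v‖⁻¹ • v‖ = 1 := by
    rw [norm_smul, norm_inv, norm_norm, inv_mul_cancel₀ hv'.ne']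
  have h2 := frobInner_grad_le hf hY (outer_mem_spectrahedron h1)
  rw [frobInner_outer, quad_vec_smul, inv_pow, inv_mul_eq_div, le_div_iff₀ (by positivity)] at h2
  linarith

lemma grad_quad_ge (hf : IsSmoothConvex f g β) (hY : Y ∈ minimizers f) (hv : ‖v‖ = 1) :
    frobInner (g Y) Y ≤ quad (g Y) v := by
  have := (posSemidef_iff_quad.1 (grad_sub_posSemidef hf hY)).2 v
  rw [quad_sub, quad_smul, quad_one, hv] at this
  linarith

/-- A point on which the gradient at a minimizer is minimal has its image in the lowest eigenspace. -/
lemma grad_quad_eq_of_mem_im (hf : IsSmoothConvex f g β) (hY : Y ∈ minimizers f)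
    (hZ : Z ∈ spectrahedron n) (hle : frobInner (g Y) Z ≤ frobInner (g Y) Y) (hu : u ∈ im Z)
    (hu1 : ‖u‖ = 1) : quad (g Y) u = frobInner (g Y) Y := by
  set M := g Y - frobInner (g Y) Y • (1 : Mat n) with hM
  have hpsd : M.PosSemidef := grad_sub_posSemidef hf hY
  obtain ⟨e, he⟩ := exists_eigenbasis hZ.1.1
  have h0 : frobInner Z M ≤ 0 := by
    rw [frobInner_comm, hM, frobInner_sub_left, frobInner_smul_left, frobInner_one, hZ.2]
    linarith
  rw [he.frobInner_eq_sum] at h0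
  have hnn : ∀ i ∈ Finset.univ, 0 ≤ eig Z ((i : Fin n) + 1) * quad M (e i) := fun i _ =>
    mul_nonneg (eig_nonneg hZ.1 i) ((posSemidef_iff_quad.1 hpsd).2 _)
  have hz := (Finset.sum_eq_zero_iff_of_nonneg hnn).1 (le_antisymm h0 (Finset.sum_nonneg hnn))
  -- Complementary slackness: two positive semidefinite matrices with inner product zero annihilate
  -- each other.
  have hMZ : M * Z = 0 := eq_of_act_basis e fun i => by
    rw [toEuclideanLin_mul_apply, he, map_smul, map_zero, LinearMap.zero_apply]
    rcases mul_eq_zero.1 (hz i (Finset.mem_univ i)) with h | h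
    · rw [h, zero_smul]
    · rw [act_eq_zero_of_quad_eq_zero hpsd h, smul_zero]
  obtain ⟨y, rfl⟩ := hu
  have h1 : quad M (Matrix.toEuclideanLin Z y) = 0 := by
    rw [quad_eq_inner, ← toEuclideanLin_mul_apply, hMZ, map_zero, LinearMap.zero_apply,
      inner_zero_right]
  rw [hM, quad_sub, quad_smul, quad_one, hu1] at h1
  linarith

lemma frobInner_grad_sub_le (hf : IsSmoothConvex f g β) (hY : Y ∈ minimizers f)
    (hX : X ∈ spectrahedron n) :
    frobInner (g Y) X ≤ frobInner (g Y) Y + (f X - optVal f) := by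
  have := hf.add_le hY.1 hX
  rw [map_sub] at this
  rw [optVal_eq_of_mem_minimizers hY]
  linarith

lemma sub_optVal_le_frobInner (hf : IsSmoothConvex f g β) (hY : Y ∈ minimizers f)
    (hX : X ∈ spectrahedron n) : f X - optVal f ≤ frobInner (g X) (X - Y) := by
  have := hf.add_le hX hY.1
  rw [map_sub] at *
  rw [optVal_eq_of_mem_minimizers hY]
  linarith

/-- The gradient form is constant on the unit sphere of the image of `Y`, which has dimension `r`;
the min-max principle converts this into an eigenvalue bound. -/
lemma eig_grad_upper (hf : IsSmoothConvex f g β) (hY : Y ∈ minimizers f) (hr : 1 ≤ r) (hrn : r ≤ n)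
    (hrank : Y.rank = r) : eig (g Y) (n - r + 1) ≤ frobInner (g Y) Y := by
  obtain ⟨w, hw, hw1, hle⟩ := exists_unit_eig_le_quad (hf.isSymm hY.1) (V := im Y)
    (k := n - r + 1) (by omega) (by rw [finrank_im]; omega)
  rwa [grad_quad_eq_of_mem_im hf hY hY.1 le_rfl hw hw1] at hle

lemma eig_near_upper (hf : IsSmoothConvex f g β) (hY : Y ∈ minimizers f) (hX : X ∈ spectrahedron n)
    (hr : 1 ≤ r) (hrn : r ≤ n) (hrank : Y.rank = r) :
    eig (g X) (n - r + 1) ≤ frobInner (g Y) Y + frobNorm (g X - g Y) :=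
  (eig_le_eig_add_frobNorm (hf.isSymm hX) (hf.isSymm hY.1) (by omega) (by omega)).trans
    (add_le_add_left (eig_grad_upper hf hY hr hrn hrank) _)

lemma eig_near_lower (hf : IsSmoothConvex f g β) (hY : Y ∈ minimizers f) (hX : X ∈ spectrahedron n)
    (hn : 1 ≤ n) : frobInner (g Y) Y - frobNorm (g X - g Y) ≤ eig (g X) n := by
  have h1 := eig_le_eig_add_frobNorm (hf.isSymm hY.1) (hf.isSymm hX) hn le_rfl
  have h2 := le_eig_last (hf.isSymm hY.1) hn fun v hv => grad_quad_ge hf hY hv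
  rw [frobNorm_sub_comm]
  linarith

lemma eig_near_gap (hf : IsSmoothConvex f g β) (hs : StrictComplementarity f g r δ)
    (hY : Y ∈ minimizers f) (hX : X ∈ spectrahedron n) (hrn : r < n) :
    frobInner (g Y) Y + δ - frobNorm (g X - g Y) ≤ eig (g X) (n - r) := by
  have hr := hs.one_le
  have h1 := eig_le_eig_add_frobNorm (k := n - r) (hf.isSymm hY.1) (hf.isSymm hX) (by omega)
    (by omega)
  have h2 := le_eig_last (hf.isSymm hY.1) (by omega) fun v hv => grad_quad_ge hf hY hv
  have h3 := (hs.gap hrn).2.2 ⟨Y, hY, rfl⟩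
  have h4 := eig_anti (i := n - r + 1) (j := n) (hf.isSymm hY.1) (by omega) (by omega) le_rfl
  rw [frobNorm_sub_comm]
  simp only at h3
  linarith

/-- The constant is chosen so that `2 / 20000 = (1/100)²`. It is used with `a = δ / β`, to control
the gradient, and with `a` the lower bound on the `r`-th eigenvalue. -/
lemma QuadraticGrowth.frobNorm_le (hq : QuadraticGrowth f α) {a : ℝ}
    (ha : 0 ≤ a) (h : f X - optVal f ≤ 1 / 20000 * (α * a ^ 2)) {Y : Mat n}
    (hY : frobNorm (X - Y) ^ 2 ≤ 2 / α * (f X - optVal f)) : frobNorm (X - Y) ≤ a / 100 := by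
  have hα := hq.1
  refine abs_le_of_sq_le_sq' ?_ (by positivity) |>.2
  refine hY.trans ((mul_le_mul_of_nonneg_left h (by positivity)).trans (le_of_eq ?_))
  field_simp
  ring

lemma exists_unit_mem_im (hX : X ∈ spectrahedron n) : ∃ u ∈ im X, ‖u‖ = 1 := by
  obtain ⟨e, -⟩ := exists_eigenbasis hX.1.1
  obtain ⟨u, hu, hu1, -⟩ := exists_unit_mem_of_finrank (V := im X) e ∅
    (by rw [finrank_im]; exact rank_pos hX)
  exact ⟨u, hu, hu1⟩

/-- Take a unit `u` in the image of a minimizer. As `r ≥ 2`, the rank-one matrix `uuᵀ` is not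
optimal, but the gradient at the minimizer `Y'` supplied by quadratic growth is orthogonal to `uuᵀ -
Y'`. Smoothness and growth thus bound the same positive gap from above and below by `‖uuᵀ - Y'‖²`.
-/
lemma growth_le_smoothness (hf : IsSmoothConvex f g β) (hq : QuadraticGrowth f α)
    (hs : StrictComplementarity f g r δ) (hr : 2 ≤ r) (hY : Y ∈ minimizers f) : α ≤ β := by
  have hα := hq.1
  obtain ⟨u, hu, hu1⟩ := exists_unit_mem_im hY.1
  have hZ := outer_mem_spectrahedron hu1
  have hpos : 0 < f (outer u) - optVal f := by
    by_contra! hle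
    have h1 := hs.rank_eq _ (mem_minimizers_of_le hf hZ (by linarith))
    have h2 := rank_outer_le u
    omega
  obtain ⟨Y', hY', hdist⟩ := hq.2 _ hZ
  have h1 := hf.le_add hY'.1 hZ
  have h2 : frobInner (g Y') (outer u - Y') = 0 := by
    have h3 := frobInner_grad_sub_le hf hY' hY.1
    rw [optVal_eq_of_mem_minimizers hY] at h3
    rw [map_sub, frobInner_outer, grad_quad_eq_of_mem_im hf hY' hY.1 (by linarith) hu hu1, sub_self]
  rw [h2, ← optVal_eq_of_mem_minimizers hY'] at h1
  have h3 := mul_le_mul_of_nonneg_left hdist (show 0 ≤ β / 2 by linarith [hf.nonneg])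
  have h4 : β / 2 * (2 / α * (f (outer u) - optVal f)) = β / α * (f (outer u) - optVal f) := by
    field_simp
  have h5 : 1 ≤ β / α := by
    by_contra! hlt
    have := mul_lt_mul_of_pos_right hlt hpos
    linarith
  rwa [one_le_div hα] at h5

/-! ### Rank-one minimizers -/

lemma IsLeadingEigenvector.quad_eq_eig_last (hD : D.IsHermitian) (hn : 1 ≤ n)
    (hw : IsLeadingEigenvector (-D) w) : quad D w = eig D n := by
  refine le_antisymm (le_eig_last hD hn fun v hv => ?_) ?_
  · have := hw.quad_le hD.neg v
    rw [quad_neg, quad_neg, hv] at this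
    linarith
  · have := eig_last_le_quad hD w
    rwa [hw.1, one_pow, mul_one] at this

lemma eq_of_dim_one (hn : n = 1) (hX : X ∈ spectrahedron n) (hY : Y ∈ spectrahedron n) : X = Y := by
  subst hn
  have h1 := hX.2
  have h2 := hY.2
  simp only [Matrix.trace, Matrix.diag_apply, Finset.univ_unique, Finset.sum_singleton] at h1 h2
  ext i j
  rw [Subsingleton.elim i default, Subsingleton.elim j default, h1, h2]

/-- A spectral gap above the smallest eigenvalue bounds the Frank-Wolfe gap from below. -/
lemma gap_mul_le_frobInner (hD : D.IsHermitian) (hn : 2 ≤ n)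
    (hgap : eig D n < eig D (n - 1)) (hw : IsLeadingEigenvector (-D) w) (hX : X ∈ spectrahedron n) :
    (eig D (n - 1) - eig D n) * (1 - quad X w) ≤ frobInner D X - quad D w := by
  obtain ⟨e, he⟩ := exists_eigenbasis hD
  let l : Fin n := ⟨n - 1, by omega⟩
  have hl : eig D ((l : ℕ) + 1) = eig D n := by simp [l, Nat.sub_add_cancel (show 1 ≤ n by omega)]
  have hDw : Matrix.toEuclideanLin D w = eig D n • w := by
    have := hw.act_eq
    rw [quad_neg, hw.quad_eq_eig_last hD (by omega), map_neg, LinearMap.neg_apply, neg_smul,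
      neg_inj] at this
    exact this
  -- The smallest eigenvalue is simple, so `w` is `e l` up to sign.
  have hperp : ∀ i, i ≠ l → inner ℝ (e i) w = 0 := by
    intro i hi
    have h1 := he.inner_act hD i w
    rw [hDw, inner_smul_right] at h1
    have hi' : (i : ℕ) + 1 ≤ n - 1 := by
      have : (i : ℕ) ≠ n - 1 := fun h => hi (Fin.ext h)
      omega
    have h2 := eig_anti hD (i := i + 1) (j := n - 1) (by omega) hi' (by omega)
    have h3 : (eig D n - eig D (i + 1)) * inner ℝ (e i) w = 0 := by linarith
    rcases mul_eq_zero.1 h3 with h | h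
    · linarith
    · exact h
  have hwl : w = inner ℝ (e l) w • e l := by
    conv_lhs => rw [← e.sum_repr' w]
    exact Finset.sum_eq_single l (fun i _ hi => by rw [hperp i hi, zero_smul]) (by simp)
  have hsq : inner ℝ (e l) w ^ 2 = 1 := by
    have := e.sum_sq_inner_right w
    rw [Finset.sum_eq_single l (fun i _ hi => by rw [hperp i hi]; simp) (by simp), hw.1] at this
    simpa using this
  have hquad : quad X w = quad X (e l) := by
    rw [hwl, quad_vec_smul, hsq, one_mul]
  have htr := trace_eq_sum e X
  rw [hX.2, ← Finset.add_sum_erase _ _ (Finset.mem_univ l)] at htr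
  rw [he.frobInner_eq_sum, hw.quad_eq_eig_last hD (by omega), hquad,
    ← Finset.add_sum_erase _ _ (Finset.mem_univ l), hl]
  have h1 : eig D (n - 1) * ∑ i ∈ Finset.univ.erase l, quad X (e i)
      ≤ ∑ i ∈ Finset.univ.erase l, eig D ((i : ℕ) + 1) * quad X (e i) := by
    rw [Finset.mul_sum]
    refine Finset.sum_le_sum fun i hi => mul_le_mul_of_nonneg_right ?_ (quad_nonneg hX _)
    have : (i : ℕ) ≠ n - 1 := fun h => (Finset.ne_of_mem_erase hi) (Fin.ext h)
    exact eig_anti hD (by omega) (by omega) (by omega)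
  have h2 : ∑ i ∈ Finset.univ.erase l, quad X (e i) = 1 - quad X (e l) := by linarith
  rw [h2] at h1
  linarith

lemma rate_rank_one (hf : IsSmoothConvex f g β) (hβ : 0 < β) (hq : QuadraticGrowth f α)
    (hs : StrictComplementarity f g 1 δ) (hX : X ∈ spectrahedron n)
    (hit : IsIteration f g β X v u X') (hd : ¬ DropTaken f X v)
    (hsmall : f X - optVal f < 1 / 20000 * (α * δ ^ 2 / β ^ 2)) :
    f X' - optVal f ≤ (f X - optVal f) * (1 - min (δ / (12 * β)) (1 / 2)) := by
  obtain ⟨Y, hY, hdist⟩ := hq.2 X hX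
  -- For `n = 1` the spectrahedron is a single point, and nothing is known about `δ`.
  rcases hs.le.eq_or_lt with hn | hn
  · rw [eq_of_dim_one hn.symm (hit.mem hX) hY.1, eq_of_dim_one hn.symm hX hY.1,
      optVal_eq_of_mem_minimizers hY]
    simp
  have hδ := (hs.gap hn).1
  have hF : frobNorm (X - Y) ≤ δ / β / 100 :=
    hq.frobNorm_le (by positivity) (by rw [div_pow, ← mul_div_assoc]; exact hsmall.le) hdist
  have hε : frobNorm (g X - g Y) ≤ δ / 100 := by
    refine (hf.smooth X hX Y hY.1).trans ((mul_le_mul_of_nonneg_left hF hβ.le).trans (le_of_eq ?_))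
    field_simp
  have h1 := eig_near_upper hf hY hX le_rfl hs.le (hs.rank_eq Y hY)
  have h2 := eig_near_gap hf hs hY hX hn
  rw [Nat.sub_add_cancel hs.le] at h1
  set D := g X with hDdef
  have hgap : δ / 3 ≤ eig D (n - 1) - eig D n := by linarith
  obtain ⟨w, hw, hle⟩ := hit.exists_fw_le hf hX hd
  have h3 := gap_mul_le_frobInner (hf.isSymm hX) hn (by linarith) hw hX
  have h4 := frobNorm_sub_outer_sq_le hX hw.1
  have h5 := hf.sub_optVal_le_of_isLeading hX hw
  have h6 := hf.optVal_le hX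
  set q := frobInner D X - quad D w
  set k := 1 - quad X w
  have hk : 0 ≤ k := sub_nonneg.2 (quad_le_one hX hw.1)
  -- With this step size the quadratic term is at most half of the linear gain, because `δ/3 · k ≤
  -- q` and the squared distance is at most `2k`.
  set η := min 1 (δ / (6 * β)) with hη
  have hη0 : 0 ≤ η := le_min zero_le_one (by positivity)
  have hηβ : η * β ≤ δ / 6 := by
    have := mul_le_mul_of_nonneg_right (min_le_right 1 (δ / (6 * β))) hβ.le
    refine this.trans (le_of_eq ?_)
    field_simp
  have h7 := hle η ⟨hη0, min_le_left _ _⟩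
  have h8 : β / 2 * (η ^ 2 * frobNorm (X - outer w) ^ 2) ≤ η / 2 * q := by
    have e1 : δ / 3 * k ≤ q := (mul_le_mul_of_nonneg_right hgap hk).trans h3
    have e2 : (η * β) * k ≤ δ / 6 * k := mul_le_mul_of_nonneg_right hηβ hk
    calc β / 2 * (η ^ 2 * frobNorm (X - outer w) ^ 2) ≤ β / 2 * (η ^ 2 * (2 * k)) := by gcongr
      _ = η * ((η * β) * k) := by ring
      _ ≤ η * (q / 2) := mul_le_mul_of_nonneg_left (by linarith) hη0
      _ = _ := by ring
  have h9 : min (δ / (12 * β)) (1 / 2) = η / 2 := by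
    rw [hη, ← min_div_div_right (by norm_num : (0 : ℝ) ≤ 2), min_comm, div_div]
    congr 2
    ring
  have h10 := mul_le_mul_of_nonneg_left h5 (show 0 ≤ η / 2 by positivity)
  rw [h9]
  linarith

/-! ### Steps driven by the spread of the lowest eigenvalues -/

/-- The image of `X` has dimension at least `r`, so the away vector has form value at least the
`(n-r+1)`-th eigenvalue. The away gap and the Frank-Wolfe gap therefore add up to at least the
spread, and one of them is at least `q`. -/
lemma IsIteration.le_of_spread (hf : IsSmoothConvex f g β) (hit : IsIteration f g β X v u X')
    (hX : X ∈ spectrahedron n) (hd : ¬ DropTaken f X v) (hβ : 0 < β) (hr : 1 ≤ r) (hrn : r ≤ n)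
    (hrank : r ≤ X.rank) {q : ℝ} (hq : 0 ≤ q) (hqβ : q ≤ 2 * β)
    (hspread : 2 * q ≤ eig (g X) (n - r + 1) - eig (g X) n) :
    f X' ≤ f X - q ^ 2 / (4 * β) := by
  obtain ⟨w, hw, hw1, hle⟩ := exists_unit_eig_le_quad (hf.isSymm hX) (V := im X)
    (k := n - r + 1) (by omega) (by rw [finrank_im]; omega)
  have h1 := hit.away.2.2 w hw hw1
  by_cases h : q ≤ quad (g X) v - frobInner (g X) X
  · exact hit.le_of_away_gap hf hX hd hβ hq h
  · refine hit.le_of_fw_gap hf hX hd hβ hq hqβ fun z hz => ?_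
    rw [hz.quad_eq_eig_last (hf.isSymm hX) (by omega)]
    linarith

lemma le_sq_spread {h F S : ℝ} (hα : 0 < α) (hr : 1 ≤ r) (hh : 0 < h) (hF : F ^ 2 ≤ 2 / α * h)
    (hS : h / 2 ≤ S / 2 * √r * F) : α * h / (8 * r) ≤ (S / 2) ^ 2 := by
  have hr' : (0 : ℝ) < r := by exact_mod_cast hr
  have h1 : (h / 2) ^ 2 ≤ (S / 2) ^ 2 * r * (2 / α * h) := by
    calc (h / 2) ^ 2 ≤ (S / 2 * √r * F) ^ 2 := pow_le_pow_left₀ (by positivity) hS 2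
      _ = (S / 2) ^ 2 * r * F ^ 2 := by rw [mul_pow, mul_pow, Real.sq_sqrt hr'.le]
      _ ≤ _ := mul_le_mul_of_nonneg_left hF (by positivity)
  rw [div_le_iff₀ (by positivity)]
  have h2 : (S / 2) ^ 2 * r * (2 / α * h) = ((S / 2) ^ 2 * (8 * r)) * (h / (4 * α)) := by
    field_simp; ring
  have h3 : (h / 2) ^ 2 = (α * h) * (h / (4 * α)) := by field_simp; ring
  rw [h2, h3] at h1
  exact le_of_mul_le_mul_right h1 (by positivity)

/-- The progress made if the lowest `r` eigenvalues of the gradient are spread out. -/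
lemma IsIteration.le_of_le_spread (hf : IsSmoothConvex f g β) (hit : IsIteration f g β X v u X')
    (hX : X ∈ spectrahedron n) (hd : ¬ DropTaken f X v) (hβ : 0 < β) (hα : 0 < α) (hαβ : α ≤ β)
    (hr : 1 ≤ r) (hrn : r ≤ n) (hrank : r ≤ X.rank) (hpos : 0 < f X - optVal f)
    (hle : f X - optVal f ≤ α) {F : ℝ} (hF : F ^ 2 ≤ 2 / α * (f X - optVal f))
    (hS : (f X - optVal f) / 2 ≤ (eig (g X) (n - r + 1) - eig (g X) n) / 2 * √r * F) :
    f X' ≤ f X - α * (f X - optVal f) / (32 * β * r) := by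
  have hr' : (1 : ℝ) ≤ r := by exact_mod_cast hr
  have hS0 : eig (g X) n ≤ eig (g X) (n - r + 1) :=
    eig_anti (hf.isSymm hX) (by omega) (by omega) le_rfl
  have h1 := le_sq_spread hα hr hpos hF hS
  set h := f X - optVal f
  have h2 : √(α * h / (8 * r)) ≤ (eig (g X) (n - r + 1) - eig (g X) n) / 2 :=
    Real.sqrt_le_iff.2 ⟨by linarith, h1⟩
  have h3 : √(α * h / (8 * r)) ≤ 2 * β := by
    -- The bound `2β` keeps the Frank-Wolfe step size in `[0, 1]`; this is where `h ≤ α ≤ β` enters.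
    refine Real.sqrt_le_iff.2 ⟨by positivity, ?_⟩
    rw [div_le_iff₀ (by positivity)]
    calc α * h ≤ β * β := mul_le_mul hαβ (hle.trans hαβ) hpos.le hβ.le
      _ ≤ (2 * β) ^ 2 * (8 * 1) := by nlinarith
      _ ≤ (2 * β) ^ 2 * (8 * r) := by gcongr
  have h4 := hit.le_of_spread hf hX hd hβ hr hrn hrank (Real.sqrt_nonneg _) h3 (by linarith)
  rw [Real.sq_sqrt (by positivity)] at h4
  refine h4.trans (le_of_eq ?_)
  congr 1
  field_simp
  norm_num

/-- The linearized gap splits into a part along the lowest `r` eigenvectors and the rest. -/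
lemma frobInner_sub_le_split (hD : D.IsHermitian) (he : IsEigenbasis D e) (hr : 1 ≤ r) (hrn : r ≤ n)
    (hX : X ∈ spectrahedron n) (hY : Y ∈ spectrahedron n) :
    frobInner D (X - Y) ≤ (eig D (n - r + 1) - eig D n) / 2 * √r * frobNorm (X - Y)
      + ∑ i : Fin n, if (i : ℕ) < n - r then (eig D (i + 1) - eig D n) * quad X (e i) else 0 := by
  set S := eig D (n - r + 1) - eig D n with hS
  -- Shifting `D` by a multiple of the identity is free because `X - Y` has trace zero. The midpoint
  -- leaves deviations of at most `S / 2` on the lowest `r` eigenvectors, hence a Frobenius norm of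
  -- at most `S / 2 · √r`.
  set m := (eig D (n - r + 1) + eig D n) / 2 with hm
  have hS0 : 0 ≤ S := sub_nonneg.2 (eig_anti hD (by omega) (by omega) le_rfl)
  let c : Fin n → ℝ := fun i => if (i : ℕ) < n - r then 0 else eig D (i + 1) - m
  set M := ∑ i, c i • outer (e i) with hM
  have hc : ∀ i, c i ^ 2 ≤ if (i : ℕ) < n - r then 0 else (S / 2) ^ 2 := by
    intro i
    simp only [c]
    split_ifs with hi
    · simp
    · have h1 := eig_anti hD (i := n - r + 1) (j := i + 1) (by omega) (by omega) (by omega)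
      have h2 := eig_anti hD (i := i + 1) (j := n) (by omega) (by omega) le_rfl
      apply sq_le_sq'
      · rw [hS, hm]; linarith
      · rw [hS, hm]; linarith
  have hMM : frobNorm M ≤ S / 2 * √r := by
    refine abs_le_of_sq_le_sq' ?_ (by positivity) |>.2
    rw [frobNorm_sq]
    conv_lhs => rw [hM]
    rw [frobInner_sum_outer]
    have hq : ∀ i, c i * quad M (e i) = c i ^ 2 := by
      intro i
      rw [hM, quad_eq_inner, toEuclideanLin_sum_outer, inner_smul_right,
        real_inner_self_eq_norm_sq, e.orthonormal.1]
      ring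
    rw [Finset.sum_congr rfl fun i _ => hq i]
    refine (Finset.sum_le_sum fun i _ => hc i).trans ?_
    rw [Finset.sum_ite, Finset.sum_const_zero, zero_add, Finset.sum_const, nsmul_eq_mul,
      Finset.filter_not, Finset.card_sdiff_of_subset (Finset.filter_subset _ _),
      card_filter_lt _ (by omega), Finset.card_univ, Fintype.card_fin, mul_pow,
      Real.sq_sqrt (Nat.cast_nonneg r)]
    rw [show n - (n - r) = r by omega, mul_comm]
  have h1 : frobInner M (X - Y) ≤ S / 2 * √r * frobNorm (X - Y) :=
    ((le_abs_self _).trans (abs_frobInner_le _ _)).trans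
      (mul_le_mul_of_nonneg_right hMM (frobNorm_nonneg _))
  have htr : ∑ i, (quad X (e i) - quad Y (e i)) = 0 := by
    rw [Finset.sum_sub_distrib, ← trace_eq_sum, ← trace_eq_sum, hX.2, hY.2, sub_self]
  have h2 : frobInner D (X - Y) = ∑ i : Fin n, (eig D (i + 1) - m) * (quad X (e i) - quad Y (e i)) := by
    simp only [sub_mul _ m, Finset.sum_sub_distrib]
    rw [← Finset.mul_sum, htr, mul_zero, sub_zero, he.frobInner_eq_sum]
    simp only [quad_sub]
  rw [h2]
  refine le_trans ?_ (add_le_add_left h1 _)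
  rw [hM, frobInner_sum_outer, ← Finset.sum_add_distrib]
  refine Finset.sum_le_sum fun i _ => ?_
  simp only [c, quad_sub]
  split_ifs with hi
  -- On an upper eigenvector `λ_n ≤ m ≤ λ_i`, so the contribution of `Y` can be dropped and `m`
  -- lowered to `λ_n`.
  · have h3 := eig_anti hD (i := i + 1) (j := n - r + 1) (by omega) (by omega) (by omega)
    have h4 := quad_nonneg hX (e i)
    have h5 := quad_nonneg hY (e i)
    have h6 : eig D n ≤ m := by rw [hm]; linarith
    have h7 : m ≤ eig D (i + 1) := by rw [hm]; linarith
    nlinarith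
  · simp

lemma rate_full_rank (hf : IsSmoothConvex f g β) (hβ : 0 < β) (hq : QuadraticGrowth f α)
    (hs : StrictComplementarity f g n δ)
    (hlam : IsLeast ((fun Y => eig Y n) '' minimizers f) lam) (hX : X ∈ spectrahedron n)
    (hit : IsIteration f g β X v u X') (hd : ¬ DropTaken f X v)
    (hsmall : f X - optVal f < 1 / 20000 * (α * lam ^ 2)) :
    f X' - optVal f ≤ (f X - optVal f) * (1 - α / (512 * β * n)) := by
  have hα := hq.1
  have hn := hs.one_le
  obtain ⟨Y, hY, hdist⟩ := hq.2 X hX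
  -- The comparison `α ≤ β` needs rank at least two; for `n = 1` there is only one point.
  rcases hn.eq_or_lt with hn1 | hn2
  · rw [eq_of_dim_one hn1.symm (hit.mem hX) hY.1, eq_of_dim_one hn1.symm hX hY.1,
      optVal_eq_of_mem_minimizers hY]
    simp
  have hlam0 : 0 < lam := by
    obtain ⟨Y₀, hY₀, rfl⟩ := hlam.1
    exact eig_pos_of_le_rank hY₀.1.1 hn (hs.rank_eq Y₀ hY₀).ge
  have hlamY : lam ≤ eig Y n := hlam.2 ⟨Y, hY, rfl⟩
  have hlam1 : lam ≤ 1 := by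
    refine hlamY.trans ?_
    have := eig_le_one hY.1 ⟨n - 1, by omega⟩
    simpa [Nat.sub_add_cancel hn] using this
  have hF := hq.frobNorm_le hlam0.le hsmall.le hdist
  have hXn : 0 < eig X n := by
    have := eig_le_eig_add_frobNorm hY.1.1.1 hX.1.1 hn le_rfl
    rw [frobNorm_sub_comm] at this
    linarith
  have hrank := le_rank_of_eig_pos hX.1.1 le_rfl hXn
  have h0 := hf.optVal_le hX
  rcases (sub_nonneg.2 h0).eq_or_lt with h | hpos
  · have := hit.le_self hf hX
    rw [← h]
    linarith
  obtain ⟨e, he⟩ := exists_eigenbasis (hf.isSymm hX)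
  have h1 := (sub_optVal_le_frobInner hf hY hX).trans
    (frobInner_sub_le_split (hf.isSymm hX) he hn le_rfl hX hY.1)
  simp only [Nat.sub_self, Nat.not_lt_zero, if_false, Finset.sum_const_zero, add_zero] at h1
  have h2 := hit.le_of_le_spread (r := n) hf hX hd hβ hα (growth_le_smoothness hf hq hs hn2 hY) hn
    le_rfl hrank hpos (by nlinarith [mul_pos hα hlam0]) hdist
    (by rw [Nat.sub_self]; exact (half_le_self hpos.le).trans h1)
  have h3 : (f X - optVal f) * (1 - α / (512 * β * n))
      = f X - optVal f - α * (f X - optVal f) / (512 * β * n) := by ring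
  have hn' : (0 : ℝ) < n := by exact_mod_cast hn
  have h4 : α * (f X - optVal f) / (512 * β * n) ≤ α * (f X - optVal f) / (32 * β * n) := by
    gcongr
    norm_num
  rw [h3]
  linarith

end SpectraFW

namespace SpectraFW

variable {n r : ℕ} {A B X Y D X' Z : Mat n} {f : Mat n → ℝ} {g : Mat n → Mat n} {α β δ lam : ℝ}
  {u v w : Vec n} {e : OrthonormalBasis (Fin n) ℝ (Vec n)}

/-! ### Pairwise steps -/

/-- The vector `w` minimizes the descent-lemma bound over unit vectors, so any competitor `y` bounds
the gain from below. Since `w` is no worse than `u`, the gain factor is nonnegative and may be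
multiplied by `‖y‖² ≤ 1`, so `y` need not be normalized. -/
lemma IsIteration.pairwise_le (hf : IsSmoothConvex f g β) (hit : IsIteration f g β X v u X')
    (hX : X ∈ spectrahedron n) (hd : ¬ DropTaken f X v) {y : Vec n} (hy : ‖y‖ ^ 2 ≤ 1) :
    f X' ≤ f X - maxStep X u * (β * maxStep X u * inner ℝ u y ^ 2 - quad (g X) y
      + ‖y‖ ^ 2 * (quad (g X) u - β * maxStep X u)) := by
  obtain ⟨hu, hu1, ZF, ZA, ZP, -, -, ⟨w, hw, rfl⟩, -, -, -, hle⟩ := hit.no_drop hd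
  set γ := maxStep X u with hγ
  have hγ0 : 0 < γ := maxStep_pos hX.1 hu hu1
  set D := g X with hD
  set M := (β * γ) • outer u - D with hM
  have hMh : M.IsHermitian := by
    rw [Matrix.isHermitian_iff_isSymm]
    exact ((outer_isSymm u).smul _).sub (hf.gradient X hX).1
  have hMq : ∀ z, quad M z = β * γ * inner ℝ u z ^ 2 - quad D z := fun z => by
    rw [hM, quad_sub, quad_smul, quad_outer]
  have h1 := hf.le_add hX (pairwisePoint_mem hX hu hu1 hw.1)
  rw [add_sub_cancel_left, frobNorm_sq, frobInner_smul_left, map_smul, map_smul, ← frobNorm_sq,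
    frobNorm_outer_sub_outer_sq w u hw.1 hu1, map_sub, frobInner_outer, frobInner_outer, smul_eq_mul,
    smul_eq_mul, real_inner_comm] at h1
  have h2 : f X' ≤ f X - γ * (quad M w + quad D u - β * γ) := by
    rw [hMq]
    refine (hle.trans h1).trans (le_of_eq ?_)
    ring
  have h3 := hw.quad_le hMh u
  rw [hu1, one_pow, mul_one, hMq u, real_inner_self_eq_norm_sq, hu1] at h3
  have h4 := hw.quad_le hMh y
  have h5 : ‖y‖ ^ 2 * (quad M w + quad D u - β * γ) ≤ quad M w + quad D u - β * γ :=
    mul_le_of_le_one_left (by linarith) hy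
  rw [← hMq]
  refine h2.trans (sub_le_sub_left (mul_le_mul_of_nonneg_left ?_ hγ0.le) _)
  linarith

/-- Here `p` is the weight of `u` on the upper eigenvectors, and `T` and `L` are its excesses over
the smallest eigenvalue on the upper and lower ones. As `S ≤ gap / 2`, the loss `p L` takes at most
half of `T (1 - p)`; the curvature term takes at most half of what remains. -/
lemma pairwise_scalar_le {p κ S gap L T b : ℝ} (hp0 : 0 ≤ p) (hp1 : p ≤ 1) (hκ0 : 0 ≤ κ)
    (hκ1 : κ ≤ 1) (hS : 0 ≤ S) (hgS : 2 * S ≤ gap) (hL : L ≤ S * (1 - p)) (hT : gap * p ≤ T)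
    (hb : b * κ ≤ gap / 4) :
    (1 - p) * (κ * T / 4) ≤ (2 * κ - κ ^ 2) * (T * (1 - p) - p * L) - b * κ ^ 2 * p * (1 - p) := by
  have h1 : p * L ≤ p * (S * (1 - p)) := mul_le_mul_of_nonneg_left hL hp0
  have h2 : p * S ≤ T / 2 := by nlinarith
  have hT0 : 0 ≤ T := by nlinarith
  have hq : 0 ≤ 1 - p := sub_nonneg.2 hp1
  have h3 : κ ≤ 2 * κ - κ ^ 2 := by nlinarith
  have h4 : (1 - p) * (T / 2) ≤ T * (1 - p) - p * L := by nlinarith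
  have h5 : κ * ((1 - p) * (T / 2)) ≤ (2 * κ - κ ^ 2) * (T * (1 - p) - p * L) :=
    mul_le_mul h3 h4 (by positivity) (by linarith)
  have h6 : b * κ * (κ * p) ≤ gap / 4 * (κ * p) := mul_le_mul_of_nonneg_right hb (by positivity)
  have h7 : κ * (gap * p) ≤ κ * T := mul_le_mul_of_nonneg_left hT hκ0
  have h8 : b * κ ^ 2 * p * (1 - p) ≤ κ * T / 4 * (1 - p) := by
    apply mul_le_mul_of_nonneg_right _ hq
    nlinarith
  nlinarith

/-- The decrease of a pairwise step in terms of the weight of `u` outside the lowest `r`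
eigenvectors. -/
lemma IsIteration.pairwise_gain (hf : IsSmoothConvex f g β) (hβ : 0 < β)
    (hit : IsIteration f g β X v u X')
    (hX : X ∈ spectrahedron n) (hd : ¬ DropTaken f X v) (he : IsEigenbasis (g X) e) (hr : 1 ≤ r)
    (hrn : r < n) {gap : ℝ} (hgap0 : 0 < gap) (hgap : gap ≤ eig (g X) (n - r) - eig (g X) n)
    (hS : 2 * (eig (g X) (n - r + 1) - eig (g X) n) ≤ gap) :
    f X' ≤ f X - min (maxStep X u) (gap / (4 * β)) *
      ((1 - ∑ i : Fin n, if (i : ℕ) < n - r then inner ℝ (e i) u ^ 2 else 0) *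
      ((∑ i : Fin n, if (i : ℕ) < n - r then
        (eig (g X) (i + 1) - eig (g X) n) * inner ℝ (e i) u ^ 2 else 0) / 4)) := by
  obtain ⟨hu, hu1, -⟩ := hit.no_drop hd
  have hγ0 : 0 < maxStep X u := maxStep_pos hX.1 hu hu1
  have hDh := hf.isSymm hX
  set γ := maxStep X u with hγ
  set D := g X with hD
  set l := eig D n with hl
  set c : Fin n → ℝ := fun i => inner ℝ (e i) u with hc
  set p := ∑ i : Fin n, if (i : ℕ) < n - r then inner ℝ (e i) u ^ 2 else 0 with hp
  set T := ∑ i : Fin n, if (i : ℕ) < n - r then (eig D (i + 1) - l) * inner ℝ (e i) u ^ 2 else 0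
    with hT
  set L := ∑ i : Fin n, if (i : ℕ) < n - r then 0 else (eig D (i + 1) - l) * inner ℝ (e i) u ^ 2
    with hLdef
  -- The fraction by which the upper part of `u` is shrunk. The full projection `κ = 1` is too
  -- ambitious when the curvature `β γ` is large compared with the gap.
  set κ := min 1 (gap / (4 * β * γ)) with hκ
  have hκ0 : 0 ≤ κ := le_min zero_le_one (by positivity)
  have hκ1 : κ ≤ 1 := min_le_left _ _
  have hbκ : β * γ * κ ≤ gap / 4 := by
    have := mul_le_mul_of_nonneg_left (min_le_right 1 (gap / (4 * β * γ)))
      (show 0 ≤ β * γ by positivity)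
    refine this.trans (le_of_eq ?_)
    field_simp
  have hγκ : γ * κ = min γ (gap / (4 * β)) := by
    rw [hκ, mul_min_of_nonneg _ _ hγ0.le, mul_one]
    congr 1
    field_simp
  have hu2 : ∑ i, inner ℝ (e i) u ^ 2 = 1 := by rw [e.sum_sq_inner_right, hu1, one_pow]
  have hbot : ∑ i : Fin n, (if (i : ℕ) < n - r then 0 else inner ℝ (e i) u ^ 2) = 1 - p := by
    rw [← hu2, hp, ← Finset.sum_sub_distrib]
    exact Finset.sum_congr rfl fun i _ => by split_ifs <;> simp
  have hp0 : 0 ≤ p := Finset.sum_nonneg fun i _ => by split_ifs <;> positivity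
  have hp1 : p ≤ 1 := by
    have : 0 ≤ 1 - p := by
      rw [← hbot]
      exact Finset.sum_nonneg fun i _ => by split_ifs <;> positivity
    linarith
  have hL : L ≤ (eig D (n - r + 1) - l) * (1 - p) := by
    rw [← hbot, Finset.mul_sum]
    refine Finset.sum_le_sum fun i _ => ?_
    split_ifs with hi
    · simp
    · refine mul_le_mul_of_nonneg_right ?_ (sq_nonneg _)
      exact sub_le_sub_right (eig_anti hDh (by omega) (by omega) (by omega)) _
  have hTp : gap * p ≤ T := by
    rw [hp, Finset.mul_sum]
    refine Finset.sum_le_sum fun i _ => ?_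
    split_ifs with hi
    · refine mul_le_mul_of_nonneg_right (hgap.trans ?_) (sq_nonneg _)
      exact sub_le_sub_right (eig_anti hDh (by omega) (by omega) (by omega)) _
    · simp
  have hquad : quad D u = T + L + l := by
    have hl1 : T + L + l = T + L + ∑ i, l * inner ℝ (e i) u ^ 2 := by
      rw [← Finset.mul_sum, hu2, mul_one]
    rw [hl1, he.quad_eq_sum hDh, hT, hLdef, ← Finset.sum_add_distrib, ← Finset.sum_add_distrib]
    exact Finset.sum_congr rfl fun i _ => by split_ifs <;> ring
  let y : Vec n := ∑ i : Fin n, (if (i : ℕ) < n - r then (1 - κ) * c i else c i) • e i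
  have hey : ∀ i, inner ℝ (e i) y = if (i : ℕ) < n - r then (1 - κ) * c i else c i := fun i =>
    e.orthonormal.inner_right_fintype _ i
  have hy1 : ‖y‖ ^ 2 = 1 - (2 * κ - κ ^ 2) * p := by
    rw [← e.sum_sq_inner_right, ← hu2, hp, Finset.mul_sum, ← Finset.sum_sub_distrib]
    refine Finset.sum_congr rfl fun i _ => ?_
    rw [hey]
    split_ifs <;> simp only [hc] <;> ring
  have hy2 : inner ℝ u y = 1 - κ * p := by
    rw [← e.sum_inner_mul_inner, ← hu2, hp, Finset.mul_sum, ← Finset.sum_sub_distrib]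
    refine Finset.sum_congr rfl fun i _ => ?_
    rw [hey, real_inner_comm]
    split_ifs <;> simp only [hc] <;> ring
  have hy3 : quad D y = (1 - κ) ^ 2 * T + L + l * ‖y‖ ^ 2 := by
    rw [he.quad_eq_sum hDh, ← e.sum_sq_inner_right, hT, hLdef, Finset.mul_sum, Finset.mul_sum,
      ← Finset.sum_add_distrib, ← Finset.sum_add_distrib]
    refine Finset.sum_congr rfl fun i _ => ?_
    rw [hey]
    split_ifs <;> simp only [hc] <;> ring
  have h1 := hit.pairwise_le hf hX hd (y := y) (by
    rw [hy1]
    have : 0 ≤ (2 * κ - κ ^ 2) * p := mul_nonneg (by nlinarith) hp0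
    linarith)
  have h2 := pairwise_scalar_le hp0 hp1 hκ0 hκ1
    (sub_nonneg.2 (eig_anti hDh (by omega) (by omega) le_rfl)) hS hL hTp hbκ
  refine h1.trans (sub_le_sub_left ?_ _)
  rw [← hγκ]
  calc γ * κ * ((1 - p) * (T / 4)) = γ * ((1 - p) * (κ * T / 4)) := by ring
    _ ≤ γ * _ := mul_le_mul_of_nonneg_left h2 hγ0.le
    _ = _ := by
      rw [hy3, hy2, hquad, hy1]
      ring

/-! ### The local analysis near the minimizers -/

/-- With `u = X y`, the claim is `a · yᵀXy ≤ ‖X y‖²`, which holds eigenvalue by eigenvalue: each one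
is zero or at least `a`. -/
lemma le_maxStep (hX : X.PosSemidef) (hrank : X.rank ≤ r) {a : ℝ} (ha : a ≤ eig X r)
    (hrn : r ≤ n) (hu : u ∈ im X) (hu1 : ‖u‖ = 1) : a ≤ maxStep X u := by
  obtain ⟨y, hy, hy0, h⟩ := exists_maxStep_eq hX hu hu1
  obtain ⟨e, he⟩ := exists_eigenbasis hX.1
  rw [h, ← one_div, le_div_iff₀ hy0, he.quad_eq_sum hX.1, Finset.mul_sum]
  have h1 : (1 : ℝ) = ∑ i : Fin n, (eig X (i + 1) * inner ℝ (e i) y) ^ 2 := by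
    rw [← one_pow 2, ← hu1, ← e.sum_sq_inner_right, ← hy]
    exact Finset.sum_congr rfl fun i _ => by rw [he.inner_act hX.1]
  rw [h1]
  refine Finset.sum_le_sum fun i _ => ?_
  rw [mul_pow, ← mul_assoc]
  refine mul_le_mul_of_nonneg_right ?_ (sq_nonneg _)
  have h0 := eig_nonneg hX i
  by_cases hi : (i : ℕ) + 1 ≤ r
  · have := ha.trans (eig_anti hX.1 (by omega) hi hrn)
    nlinarith
  · have := eig_nonpos_of_rank_lt hX.1 (k := i + 1) (by omega) (by omega)
    rw [le_antisymm this h0]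
    simp

/-- The positive part of `D - t`. -/
noncomputable def posExcess (D : Mat n) (t : ℝ) : Mat n :=
  open scoped Classical in
  if h : D.IsHermitian then
    ∑ i : Fin n, max (eig D (i + 1) - t) 0 • outer ((exists_eigenbasis h).choose i)
  else 0

lemma exists_posExcess_eq (hD : D.IsHermitian) : ∃ e, IsEigenbasis D e ∧ ∀ t,
    posExcess D t = ∑ i : Fin n, max (eig D (i + 1) - t) 0 • outer (e i) :=
  ⟨_, (exists_eigenbasis hD).choose_spec, fun t => by rw [posExcess, dif_pos hD]⟩

lemma posExcess_quad_nonneg (D : Mat n) (t : ℝ) (v : Vec n) : 0 ≤ quad (posExcess D t) v := by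
  by_cases hD : D.IsHermitian
  · obtain ⟨e, -, hB⟩ := exists_posExcess_eq hD
    rw [hB, quad_sum_outer]
    exact Finset.sum_nonneg fun i _ => mul_nonneg (le_max_right _ _) (sq_nonneg _)
  · rw [posExcess, dif_neg hD]
    simp [quad]

/-- The quantity in the local rates is small. -/
structure IsSmallGap (α β δ lam h : ℝ) : Prop where
  le_one : h < 1 / 20000 * (α * δ ^ 2 / β ^ 2)
  le_two : h < 1 / 20000 * (δ ^ 2 / β)
  le_three : h < 1 / 20000 * δ
  le_four : h < 1 / 20000 * (α * lam ^ 2)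

lemma isSmallGap_of_lt {h : ℝ} (hh : h < 1 / 20000 * min (α * δ ^ 2 / β ^ 2) (min (δ ^ 2 / β)
    (min δ (min (α * lam ^ 2) (δ ^ 3 / β ^ 2))))) : IsSmallGap α β δ lam h := by
  set m := min (α * δ ^ 2 / β ^ 2) (min (δ ^ 2 / β) (min δ (min (α * lam ^ 2) (δ ^ 3 / β ^ 2))))
    with hm
  have h1 : m ≤ α * δ ^ 2 / β ^ 2 := min_le_left _ _
  have h2 : m ≤ δ ^ 2 / β := (min_le_right _ _).trans (min_le_left _ _)
  have h3 : m ≤ δ := (min_le_right _ _).trans ((min_le_right _ _).trans (min_le_left _ _))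
  have h4 : m ≤ α * lam ^ 2 := (min_le_right _ _).trans ((min_le_right _ _).trans
    ((min_le_right _ _).trans (min_le_left _ _)))
  constructor <;> linarith

/-- The deterministic core for `2 ≤ r < n`. The two alternatives depend only on `X`, so they can be
separated before `u` is drawn. The threshold `λ_n + δ/10` lies above the lowest `r` eigenvalues and
low enough that at least `88/100` of each upper excess survives; `44/100` is half of that. -/
lemma local_step (hf : IsSmoothConvex f g β) (hβ : 0 < β) (hq : QuadraticGrowth f α)
    (hs : StrictComplementarity f g r δ)
    (hlam : IsLeast ((fun Y => eig Y r) '' minimizers f) lam) (hr : 2 ≤ r) (hrn : r < n)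
    (hX : X ∈ spectrahedron n) (hit : IsIteration f g β X v u X') (hd : ¬ DropTaken f X v)
    (hsmall : IsSmallGap α β δ lam (f X - optVal f)) :
    X.rank ≤ r ∧ (44 / 100 * (f X - optVal f) ≤ frobInner (posExcess (g X) (eig (g X) n + δ / 10)) X →
      f X' ≤ f X - 1 / 8 * min (δ / (3 * β)) lam
        * quad (posExcess (g X) (eig (g X) n + δ / 10)) u) ∧
    (frobInner (posExcess (g X) (eig (g X) n + δ / 10)) X < 44 / 100 * (f X - optVal f) →
      f X' ≤ f X - α * (f X - optVal f) / (32 * β * r)) := by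
  have hα := hq.1
  have hδ := (hs.gap hrn).1
  obtain ⟨hu, hu1, -⟩ := hit.no_drop hd
  obtain ⟨Y, hY, hdist⟩ := hq.2 X hX
  have hαβ := growth_le_smoothness hf hq hs hr hY
  have hlam0 : 0 < lam := by
    obtain ⟨Y₀, hY₀, rfl⟩ := hlam.1
    exact eig_pos_of_le_rank hY₀.1.1 hs.one_le (hs.rank_eq Y₀ hY₀).ge
  have hlamY : lam ≤ eig Y r := hlam.2 ⟨Y, hY, rfl⟩
  have hlam1 : lam ≤ 1 := by
    refine hlamY.trans ?_
    have := eig_le_one hY.1 ⟨r - 1, by omega⟩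
    simpa [Nat.sub_add_cancel hs.one_le] using this
  obtain ⟨hs1, hs2, hs3, hs4⟩ := hsmall
  have hF1 : frobNorm (X - Y) ≤ δ / β / 100 :=
    hq.frobNorm_le (by positivity) (by rw [div_pow, ← mul_div_assoc]; exact hs1.le) hdist
  have hF2 := hq.frobNorm_le hlam0.le hs4.le hdist
  have hε : frobNorm (g X - g Y) ≤ δ / 100 := by
    refine (hf.smooth X hX Y hY.1).trans ((mul_le_mul_of_nonneg_left hF1 hβ.le).trans (le_of_eq ?_))
    field_simp
  have h0 := sub_nonneg.2 (hf.optVal_le hX)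
  have hup := eig_near_upper hf hY hX hs.one_le hs.le (hs.rank_eq Y hY)
  have hlo := eig_near_lower hf hY hX (by omega)
  have hga := eig_near_gap hf hs hY hX hrn
  have hDYX := frobInner_grad_sub_le hf hY hX
  have hDh := hf.isSymm hX
  obtain ⟨e, he, hB⟩ := exists_posExcess_eq hDh
  set μ := frobInner (g Y) Y
  set h := f X - optVal f with hh
  set ε := frobNorm (g X - g Y) with hεdef
  set D := g X with hDdef
  have hln : eig D n ≤ eig D (n - r + 1) := eig_anti hDh (by omega) (by omega) le_rfl
  have hεX : frobInner D X ≤ frobInner (g Y) X + ε := by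
    have h1 := (le_abs_self _).trans (abs_frobInner_le (D - g Y) X)
    have h2 := mul_le_mul_of_nonneg_left (frobNorm_le_one hX) (frobNorm_nonneg (D - g Y))
    rw [frobInner_sub_left] at h1
    linarith
  have hXr : 99 / 100 * lam ≤ eig X r := by
    have := eig_le_eig_add_frobNorm hY.1.1.1 hX.1.1 hs.one_le hs.le
    rw [frobNorm_sub_comm] at this
    linarith
  have hrank1 : r ≤ X.rank := le_rank_of_eig_pos hX.1.1 hs.le (by linarith)
  -- An image of dimension above `r` contains a direction with form value near or above `μ + δ`. The
  -- resulting away step would decrease `f` by at least `δ² / (16β)`, below the optimal value.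
  have hrank2 : X.rank ≤ r := by
    by_contra! hlt
    obtain ⟨w, hw, hw1, hle⟩ := exists_unit_eig_le_quad hDh (V := im X) (k := n - r) (by omega)
      (by rw [finrank_im]; omega)
    have h1 := hit.away.2.2 w hw hw1
    have h2 := hit.le_of_away_gap hf hX hd hβ (q := δ / 2) (by positivity) (by linarith)
    have h3 := hf.optVal_le (hit.mem hX)
    have h4 : (δ / 2) ^ 2 / (4 * β) = 1 / 16 * (δ ^ 2 / β) := by field_simp; norm_num
    have h5 : 0 < δ ^ 2 / β := by positivity
    linarith
  have hγ : 99 / 100 * lam ≤ maxStep X u :=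
    le_maxStep hX.1 hrank2 hXr hs.le hu hu1
  have hγ0 : 0 < maxStep X u := maxStep_pos hX.1 hu hu1
  -- The geometric mean of the first and the fourth smallness bounds, with `α ≤ β`.
  have hhδ : h ≤ 1 / 20000 * (δ * lam) := by
    refine abs_le_of_sq_le_sq' ?_ (by positivity) |>.2
    calc h ^ 2 = h * h := sq h
      _ ≤ 1 / 20000 * (α * δ ^ 2 / β ^ 2) * (1 / 20000 * (α * lam ^ 2)) :=
        mul_le_mul hs1.le hs4.le h0 (by positivity)
      _ = (1 / 20000 * (δ * lam)) ^ 2 * (α / β) ^ 2 := by field_simp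
      _ ≤ (1 / 20000 * (δ * lam)) ^ 2 * 1 := by
        refine mul_le_mul_of_nonneg_left (pow_le_one₀ (by positivity) ?_) (by positivity)
        rwa [div_le_one hβ]
      _ = _ := mul_one _
  -- Pair the positive semidefinite matrices `∇f(Y) - μ I` and `X - γ uuᵀ`: the excess of `u`, times
  -- its removable weight `γ`, is at most `h`.
  have hDYu : quad (g Y) u ≤ μ + δ / 100 := by
    have h1 := frobInner_nonneg_of_posSemidef (grad_sub_posSemidef hf hY)
      (sub_smul_outer_posSemidef hX.1 hu hu1 le_rfl)
    rw [map_sub, map_smul, frobInner_outer, frobInner_sub_left, frobInner_smul_left, frobInner_one,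
      hX.2, quad_sub, quad_smul, quad_one, hu1, smul_eq_mul] at h1
    by_contra! hlt
    have h2 : lam * 99 / 100 * (δ / 100) ≤ maxStep X u * (quad (g Y) u - μ) :=
      mul_le_mul (by linarith) (by linarith) (by positivity) hγ0.le
    have h3 : 0 < δ * lam := mul_pos hδ hlam0
    linarith
  have hDu : quad D u ≤ μ + δ / 50 := by
    have := (abs_le.1 (abs_quad_le (D - g Y) u)).2
    rw [quad_sub, hu1] at this
    linarith
  have hgap : 98 / 100 * δ ≤ eig D (n - r) - eig D n := by linarith
  have hS : 2 * (eig D (n - r + 1) - eig D n) ≤ 98 / 100 * δ := by linarith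
  have htop : ∀ i : Fin n, (i : ℕ) < n - r → eig D (n - r) ≤ eig D (i + 1) := fun i hi =>
    eig_anti hDh (by omega) (by omega) (by omega)
  have hbot : ∀ i : Fin n, ¬ (i : ℕ) < n - r → eig D (i + 1) ≤ eig D (n - r + 1) := fun i hi =>
    eig_anti hDh (by omega) (by omega) (by omega)
  refine ⟨hrank2, fun _ => ?_, fun hlt => ?_⟩
  · have hgain := hit.pairwise_gain hf hβ hX hd he hs.one_le hrn (gap := 98 / 100 * δ)
      (by positivity) hgap hS
    set p := ∑ i : Fin n, if (i : ℕ) < n - r then inner ℝ (e i) u ^ 2 else 0 with hp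
    set T := ∑ i : Fin n, if (i : ℕ) < n - r then
        (eig D (i + 1) - eig D n) * inner ℝ (e i) u ^ 2 else 0 with hT
    have hp' : p ≤ 1 / 20 := by
      have h1 : 98 / 100 * δ * p + eig D n ≤ quad D u := by
        rw [he.quad_eq_sum hDh, ← mul_one (eig D n), ← one_pow 2, ← hu1, ← e.sum_sq_inner_right,
          hp, Finset.mul_sum, Finset.mul_sum, ← Finset.sum_add_distrib]
        refine Finset.sum_le_sum fun i _ => ?_
        split_ifs with hi
        · rw [← add_mul]
          exact mul_le_mul_of_nonneg_right (by linarith [htop i hi]) (sq_nonneg _)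
        · rw [mul_zero, zero_add]
          exact mul_le_mul_of_nonneg_right (eig_anti hDh (by omega) (by omega) le_rfl) (sq_nonneg _)
      by_contra! hlt
      have := mul_lt_mul_of_pos_left hlt hδ
      linarith
    have hTB : quad (posExcess D (eig D n + δ / 10)) u ≤ T := by
      rw [hB, quad_sum_outer]
      refine Finset.sum_le_sum fun i _ => ?_
      split_ifs with hi
      · refine mul_le_mul_of_nonneg_right (max_le (by linarith) ?_) (sq_nonneg _)
        linarith [htop i hi]
      · rw [max_eq_right (by linarith [hbot i hi]), zero_mul]
    have hB0 := posExcess_quad_nonneg D (eig D n + δ / 10) u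
    refine hgain.trans (sub_le_sub_left ?_ _)
    have hm : 7 / 10 * min (δ / (3 * β)) lam ≤ min (maxStep X u) (98 / 100 * δ / (4 * β)) := by
      have hm1 := min_le_left (δ / (3 * β)) lam
      have hm2 := min_le_right (δ / (3 * β)) lam
      refine le_min (by linarith) ?_
      have : 98 / 100 * δ / (4 * β) = 735 / 1000 * (δ / (3 * β)) := by field_simp; norm_num
      have hpos : 0 < δ / (3 * β) := by positivity
      rw [this]
      linarith
    have hm0 : 0 ≤ min (δ / (3 * β)) lam := le_min (by positivity) hlam0.le
    set m := min (δ / (3 * β)) lam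
    set Q := quad (posExcess D (eig D n + δ / 10)) u
    calc 1 / 8 * m * Q ≤ 7 / 10 * m * ((1 - 1 / 20) * (Q / 4)) := by
          have := mul_nonneg hm0 hB0
          linarith
      _ ≤ _ := mul_le_mul hm (mul_le_mul (by linarith) (by linarith) (by positivity) (by linarith))
          (by positivity) (by positivity)
  · have hsplit := (sub_optVal_le_frobInner hf hY hX).trans
      (frobInner_sub_le_split hDh he hs.one_le hs.le hX hY.1)
    have h1 : 88 / 100 * (∑ i : Fin n, if (i : ℕ) < n - r then
        (eig D (i + 1) - eig D n) * quad X (e i) else 0)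
        ≤ frobInner (posExcess D (eig D n + δ / 10)) X := by
      rw [hB, frobInner_sum_outer, Finset.mul_sum]
      refine Finset.sum_le_sum fun i _ => ?_
      have hx := quad_nonneg hX (e i)
      split_ifs with hi
      · rw [← mul_assoc]
        exact mul_le_mul_of_nonneg_right (le_max_of_le_left (by linarith [htop i hi])) hx
      · rw [mul_zero]
        exact mul_nonneg (le_max_right _ _) hx
    have hB0 : 0 ≤ frobInner (posExcess D (eig D n + δ / 10)) X := by
      rw [hB, frobInner_sum_outer]
      exact Finset.sum_nonneg fun i _ => mul_nonneg (le_max_right _ _) (quad_nonneg hX _)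
    refine hit.le_of_le_spread hf hX hd hβ hα hαβ hs.one_le hs.le hrank1 (by linarith) ?_ hdist ?_
    -- This gives `h ≤ α`. In the next goal the upper excess is less than `h / 2`, because `88/100`
    -- of it is below `44/100 · h`, so the spread term must be at least `h / 2`.
    · have : α * lam ^ 2 ≤ α * 1 :=
        mul_le_mul_of_nonneg_left (pow_le_one₀ hlam0.le hlam1) hα.le
      linarith
    · linarith

end SpectraFW

namespace SpectraFW

/-! ### The second moment of the uniform distribution on a sphere -/

section Sphere

variable {E : Type*} [NormedAddCommGroup E] [InnerProductSpace ℝ E]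

/-- The action of a linear isometry on the unit sphere. -/
def sphereMap (φ : E ≃ₗᵢ[ℝ] E) (x : Metric.sphere (0 : E) 1) : Metric.sphere (0 : E) 1 :=
  ⟨φ x, by simp⟩

lemma continuous_sphereMap (φ : E ≃ₗᵢ[ℝ] E) : Continuous (sphereMap φ) :=
  Continuous.subtype_mk (φ.continuous.comp continuous_subtype_val) _

variable [FiniteDimensional ℝ E] [MeasurableSpace E] [BorelSpace E]

/-- The surface measure of a set is a multiple of the volume of the cone over it, and an isometry
maps cones to cones and preserves volume. -/
lemma map_sphereMap_toSphere (φ : E ≃ₗᵢ[ℝ] E) :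
    (volume : Measure E).toSphere.map (sphereMap φ) = (volume : Measure E).toSphere := by
  ext s hs
  have hm := (continuous_sphereMap φ).measurable
  have hpre : ∀ T : Set E, volume (φ ⁻¹' T) = volume T :=
    MeasurePreserving.measure_preimage_equiv (f := φ.toHomeomorph.toMeasurableEquiv)
      φ.measurePreserving
  rw [Measure.map_apply hm hs, Measure.toSphere_apply' _ (hm hs), Measure.toSphere_apply' _ hs]
  conv_rhs => rw [← hpre]
  congr 2
  ext x
  simp only [Set.mem_smul, Set.mem_image, Set.mem_preimage]
  constructor
  · rintro ⟨c, hc, _, ⟨y, hy, rfl⟩, rfl⟩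
    exact ⟨c, hc, _, ⟨sphereMap φ y, hy, rfl⟩, (map_smul φ c (y : E)).symm⟩
  · rintro ⟨c, hc, _, ⟨y, hy, rfl⟩, hx⟩
    refine ⟨c, hc, _, ⟨sphereMap φ.symm y, ?_, rfl⟩, ?_⟩
    · have : sphereMap φ (sphereMap φ.symm y) = y := Subtype.ext (φ.apply_symm_apply y)
      rwa [this]
    · apply φ.injective
      rw [map_smul]
      exact (congrArg _ (φ.apply_symm_apply (y : E))).trans hx

lemma integrable_inner_sq_toSphere (a : E) :
    Integrable (fun x : Metric.sphere (0 : E) 1 => inner ℝ (x : E) a ^ 2)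
      (volume : Measure E).toSphere := by
  apply Continuous.integrable_of_hasCompactSupport
  · fun_prop
  · exact HasCompactSupport.of_compactSpace _

lemma integral_inner_sq_eq {a b : E} (h : ‖a‖ = ‖b‖) :
    ∫ x : Metric.sphere (0 : E) 1, inner ℝ (x : E) a ^ 2 ∂(volume : Measure E).toSphere
      = ∫ x : Metric.sphere (0 : E) 1, inner ℝ (x : E) b ^ 2 ∂(volume : Measure E).toSphere := by
  -- The reflection that exchanges two vectors of equal length.
  let φ : E ≃ₗᵢ[ℝ] E := (ℝ ∙ (a - b))ᗮ.reflection
  have hφ : φ a = b := Submodule.reflection_sub h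
  conv_rhs => rw [← map_sphereMap_toSphere φ]
  rw [integral_map (continuous_sphereMap φ).aemeasurable]
  · refine integral_congr_ae (Filter.Eventually.of_forall fun x => ?_)
    simp only [sphereMap, ← hφ, LinearIsometryEquiv.inner_map_map]
  · exact (by fun_prop : Continuous fun x : Metric.sphere (0 : E) 1 =>
      inner ℝ (x : E) b ^ 2).aestronglyMeasurable

/-- By symmetry all basis directions have the same second moment, and on the sphere these moments
sum to the total mass. -/
lemma integral_inner_sq_toSphere (a : E) :
    (Module.finrank ℝ E : ℝ) * ∫ x : Metric.sphere (0 : E) 1, inner ℝ (x : E) a ^ 2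
      ∂(volume : Measure E).toSphere = ‖a‖ ^ 2 * (volume : Measure E).toSphere.real Set.univ := by
  let b := stdOrthonormalBasis ℝ E
  have h1 : ∀ i, ∫ x : Metric.sphere (0 : E) 1, inner ℝ (x : E) a ^ 2 ∂(volume : Measure E).toSphere
      = ‖a‖ ^ 2 * ∫ x : Metric.sphere (0 : E) 1, inner ℝ (x : E) (b i) ^ 2
        ∂(volume : Measure E).toSphere := by
    intro i
    rw [integral_inner_sq_eq (b := ‖a‖ • b i) (by simp [norm_smul]), ← integral_const_mul]
    simp only [inner_smul_right, mul_pow]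
  have h2 : ∑ i, ∫ x : Metric.sphere (0 : E) 1, inner ℝ (x : E) (b i) ^ 2
      ∂(volume : Measure E).toSphere = (volume : Measure E).toSphere.real Set.univ := by
    rw [← integral_finsetSum _ fun i _ => integrable_inner_sq_toSphere (b i)]
    have : ∀ x : Metric.sphere (0 : E) 1, ∑ i, inner ℝ (x : E) (b i) ^ 2 = 1 := by
      intro x
      rw [b.sum_sq_inner_left]
      simp
    simp [this]
  rw [← h2, Finset.mul_sum, ← Finset.sum_congr rfl fun i _ => h1 i]
  simp

end Sphere

variable {n : ℕ} {X : Mat n}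

lemma isProbabilityMeasure_uniformSphere {V : Submodule ℝ (Vec n)} (hV : 1 ≤ Module.finrank ℝ V) :
    IsProbabilityMeasure (uniformSphere V) := by
  have : Nontrivial V := Module.nontrivial_of_finrank_pos (R := ℝ) hV
  have h0 : (volume : Measure V).toSphere Set.univ ≠ 0 :=
    Measure.measure_univ_ne_zero.2 (Measure.toSphere_ne_zero _)
  refine ⟨?_⟩
  rw [uniformSphere, Measure.map_apply (by fun_prop) .univ, Set.preimage_univ, Measure.smul_apply,
    smul_eq_mul, ENNReal.inv_mul_cancel h0 (measure_ne_top _ _)]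

lemma measurable_coe_sphere (V : Submodule ℝ (Vec n)) :
    Measurable fun x : Metric.sphere (0 : V) 1 => ((x : V) : Vec n) := by fun_prop

lemma integral_inner_sq_uniformSphere {V : Submodule ℝ (Vec n)} (hV : 1 ≤ Module.finrank ℝ V)
    (a : V) : ∫ y, inner ℝ y (a : Vec n) ^ 2 ∂(uniformSphere V) = ‖a‖ ^ 2 / Module.finrank ℝ V := by
  have : Nontrivial V := Module.nontrivial_of_finrank_pos (R := ℝ) hV
  have h0 : (volume : Measure V).toSphere Set.univ ≠ 0 :=
    Measure.measure_univ_ne_zero.2 (Measure.toSphere_ne_zero _)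
  have hd : (0 : ℝ) < Module.finrank ℝ V := by exact_mod_cast hV
  have hr : (volume : Measure V).toSphere.real Set.univ ≠ 0 :=
    ENNReal.toReal_ne_zero.2 ⟨h0, measure_ne_top _ _⟩
  rw [uniformSphere, integral_map (measurable_coe_sphere V).aemeasurable
    (by fun_prop : Continuous fun y : Vec n => inner ℝ y (a : Vec n) ^ 2).aestronglyMeasurable,
    integral_smul_measure]
  have h1 := integral_inner_sq_toSphere a
  simp only [← Submodule.coe_inner]
  rw [eq_div_iff hd.ne', smul_eq_mul, mul_assoc, mul_comm _ (Module.finrank ℝ V : ℝ), h1,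
    ENNReal.toReal_inv, ← measureReal_def, mul_comm, mul_assoc, mul_inv_cancel₀ hr, mul_one]

lemma ae_norm_uniformSphere (V : Submodule ℝ (Vec n)) : ∀ᵐ y ∂(uniformSphere V), ‖y‖ = 1 ∧ y ∈ V := by
  rw [uniformSphere, ae_map_iff (measurable_coe_sphere V).aemeasurable]
  · exact Filter.Eventually.of_forall fun x => ⟨norm_eq_of_mem_sphere x, (x : V).2⟩
  · exact (measurableSet_eq_fun (by fun_prop) (by fun_prop)).inter
      V.closed_of_finiteDimensional.measurableSet

/-- The mean is `‖b‖² / rank X`, where `b` is the projection of `a` onto the image of `X`. Since `X`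
does not see the rest of `a` and `X ≤ I`, `aᵀXa = bᵀXb ≤ ‖b‖²`. -/
lemma le_integral_inner_sq_uniformSphere (hX : X ∈ spectrahedron n) (a : Vec n) :
    quad X a / X.rank ≤ ∫ y, inner ℝ a y ^ 2 ∂(uniformSphere (im X)) := by
  have hV : 1 ≤ Module.finrank ℝ (im X) := by rw [finrank_im]; exact rank_pos hX
  set b := (im X).orthogonalProjectionOnto a with hb
  have h1 : ∫ y, inner ℝ a y ^ 2 ∂(uniformSphere (im X))
      = ∫ y, inner ℝ y (b : Vec n) ^ 2 ∂(uniformSphere (im X)) := by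
    refine integral_congr_ae ?_
    filter_upwards [ae_norm_uniformSphere (im X)] with y hy
    have := Submodule.inner_orthogonalProjectionOnto_eq_of_mem_left (K := im X) ⟨y, hy.2⟩ a
    rw [real_inner_comm]
    congr 1
    exact this.symm
  have h2 : quad X a ≤ ‖b‖ ^ 2 := by
    have h3 : Matrix.toEuclideanLin X (a - b) = 0 := by
      rw [← inner_self_eq_zero (𝕜 := ℝ), inner_act_comm hX.1.1]
      have := Submodule.sub_starProjection_mem_orthogonal (K := im X) a
      exact (Submodule.mem_orthogonal' _ _).1 this _ ⟨_, rfl⟩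
    rw [map_sub, sub_eq_zero] at h3
    have h4 : quad X a = quad X b := by
      rw [quad_eq_inner, h3, ← inner_act_comm hX.1.1, h3, inner_act_comm hX.1.1, ← quad_eq_inner]
    have hn : 1 ≤ n := (rank_pos hX).trans (X.rank_le_width)
    have h5 := eig_le_one hX ⟨0, hn⟩
    rw [h4]
    refine (quad_le_eig_one hX.1.1 _).trans ?_
    exact mul_le_of_le_one_left (sq_nonneg _) (by simpa using h5)
  rw [h1, integral_inner_sq_uniformSphere hV, finrank_im]
  gcongr

/-- The mean of a positive quadratic form over the unit sphere of the image of `X`. -/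
lemma le_integral_quad_uniformSphere (hX : X ∈ spectrahedron n)
    (e : OrthonormalBasis (Fin n) ℝ (Vec n)) {d : Fin n → ℝ} (hd : ∀ i, 0 ≤ d i) :
    frobInner (∑ i, d i • outer (e i)) X / X.rank
      ≤ ∫ y, quad (∑ i, d i • outer (e i)) y ∂(uniformSphere (im X)) := by
  have hV : 1 ≤ Module.finrank ℝ (im X) := by rw [finrank_im]; exact rank_pos hX
  have := isProbabilityMeasure_uniformSphere hV
  simp only [quad_sum_outer]
  rw [integral_finsetSum]
  · rw [frobInner_sum_outer, Finset.sum_div]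
    refine Finset.sum_le_sum fun i _ => ?_
    rw [integral_const_mul, mul_div_assoc]
    exact mul_le_mul_of_nonneg_left (le_integral_inner_sq_uniformSphere hX _) (hd i)
  · intro i _
    refine Integrable.const_mul (Integrable.of_bound (C := 1) ?_ ?_) _
    · exact (by fun_prop : Continuous fun y : Vec n => inner ℝ (e i) y ^ 2).aestronglyMeasurable
    · filter_upwards [ae_norm_uniformSphere (im X)] with y hy
      have := abs_real_inner_le_norm (e i) y
      rw [hy.1, e.orthonormal.1, mul_one] at this
      rw [Real.norm_eq_abs, abs_pow]
      exact pow_le_one₀ (abs_nonneg _) this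

/-! ### Conditional expectations given the information before the draw -/

lemma exists_countable_piSystem (α : Type*) [hα : MeasurableSpace α]
    [MeasurableSpace.CountablyGenerated α] :
    ∃ C : Set (Set α), C.Countable ∧ IsPiSystem C ∧ hα = MeasurableSpace.generateFrom C := by
  let S := MeasurableSpace.countableGeneratingSet α
  have hS : MeasurableSpace.generateFrom S = hα := MeasurableSpace.generateFrom_countableGeneratingSet
  refine ⟨Set.sInter '' {F | F.Finite ∧ F ⊆ S}, ?_, ?_, ?_⟩
  · exact (Set.countable_ofPred_finite_subset
      MeasurableSpace.countable_countableGeneratingSet).image _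
  · rintro _ ⟨F, hF, rfl⟩ _ ⟨F', hF', rfl⟩ -
    exact ⟨F ∪ F', ⟨hF.1.union hF'.1, Set.union_subset hF.2 hF'.2⟩, Set.sInter_union F F'⟩
  · apply le_antisymm
    · rw [← hS]
      refine MeasurableSpace.generateFrom_mono fun s hs => ⟨{s}, ⟨Set.finite_singleton s, ?_⟩, ?_⟩
      · simpa using hs
      · simp
    · refine MeasurableSpace.generateFrom_le ?_
      rintro _ ⟨F, hF, rfl⟩
      refine MeasurableSet.sInter hF.1.countable fun s hs => ?_
      rw [← hS]
      exact MeasurableSpace.measurableSet_generateFrom (hF.2 hs)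

/-- If the conditional law of `Y` given `m` is known on `N`, it computes conditional expectations
there. -/
lemma condExp_eq_integral_of_condProb {Ω : Type*} {m mΩ : MeasurableSpace Ω} {μ : Measure Ω}
    [IsProbabilityMeasure μ] (hm : m ≤ mΩ) {Y : Ω → Vec n} (hY : Measurable Y)
    {σ : Ω → Measure (Vec n)} {N : Set Ω} (hσ : ∀ᵐ ω ∂μ, ω ∈ N → IsProbabilityMeasure (σ ω))
    (hlaw : ∀ B : Set (Vec n), MeasurableSet B →
      ∀ᵐ ω ∂μ, ω ∈ N → (μ⟦Y ⁻¹' B | m⟧) ω = (σ ω).real B)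
    {φ : Ω × Vec n → ℝ} (hφ : StronglyMeasurable[m.prod inferInstance] φ)
    (hint : Integrable (fun ω => φ (ω, Y ω)) μ) :
    ∀ᵐ ω ∂μ, ω ∈ N → (μ[fun ω => φ (ω, Y ω) | m]) ω = ∫ y, φ (ω, y) ∂(σ ω) := by
  have hid : @Measurable Ω Ω mΩ m id := measurable_id'' hm
  let κ : @Kernel Ω (Vec n) m _ := @condDistrib Ω Ω (Vec n) _ _ _ mΩ m Y id μ _
  have hκ : ∀ ω, IsProbabilityMeasure (κ ω) := fun ω => by
    have : @IsMarkovKernel Ω (Vec n) m _ κ := by infer_instance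
    exact this.isProbabilityMeasure ω
  have h1 : μ[fun ω => φ (ω, Y ω) | m] =ᵐ[μ] fun ω => ∫ y, φ (ω, y) ∂(κ ω) := by
    have := @condExp_prod_ae_eq_integral_condDistrib Ω Ω (Vec n) ℝ _ _ _ _ mΩ μ _ id Y m φ _ _
      hid hY.aemeasurable hφ hint
    rwa [MeasurableSpace.comap_id] at this
  -- The law is known only up to a null set depending on `B`. A countable generating π-system gives
  -- one null set outside which `κ ω` and `σ ω` agree as measures; no measurability of `σ` in `ω` is
  -- required.
  obtain ⟨C, hC, hpi, hgen⟩ := exists_countable_piSystem (Vec n)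
  have h2 : ∀ B ∈ C, ∀ᵐ ω ∂μ, ω ∈ N → (κ ω).real B = (σ ω).real B := by
    intro B hB
    have hBm : MeasurableSet B := by
      rw [hgen]
      exact MeasurableSpace.measurableSet_generateFrom hB
    have h3 := @condDistrib_ae_eq_condExp Ω Ω (Vec n) _ _ _ mΩ μ _ id Y m B hid hY hBm
    rw [MeasurableSpace.comap_id] at h3
    filter_upwards [h3, hlaw B hBm] with ω hω1 hω2 hN
    exact hω1.trans (hω2 hN)
  rw [← ae_ball_iff hC] at h2
  filter_upwards [h1, h2, hσ] with ω hω1 hω2 hω3 hN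
  have := hω3 hN
  have := hκ ω
  have heq : κ ω = σ ω := by
    refine ext_of_generate_finite C hgen hpi (fun B hB => ?_) (by simp)
    have := hω2 B hB hN
    rwa [measureReal_eq_measureReal_iff] at this
  rw [hω1, heq]

/-- The indicator of an `m`-measurable event can be taken out of the conditional expectation. -/
lemma condExp_le_of_le_on {Ω : Type*} {m mΩ : MeasurableSpace Ω} {μ : Measure Ω}
    {A : Set Ω} (hA : MeasurableSet[m] A) {k l : Ω → ℝ}
    (hk : Integrable k μ) (hl : Integrable l μ) (hm : m ≤ mΩ) (h : ∀ᵐ ω ∂μ, ω ∈ A → k ω ≤ l ω) :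
    ∀ᵐ ω ∂μ, ω ∈ A → (μ[k | m]) ω ≤ (μ[l | m]) ω := by
  have h1 := condExp_mono (m := m) (hk.indicator (hm _ hA)) (hl.indicator (hm _ hA)) (by
    filter_upwards [h] with ω hω
    by_cases hωA : ω ∈ A
    · simpa [hωA] using hω hωA
    · simp [hωA])
  filter_upwards [h1, condExp_indicator hk hA, condExp_indicator hl hA] with ω h1 h2 h3 hωA
  rw [h2, h3, Set.indicator_of_mem hωA, Set.indicator_of_mem hωA] at h1
  exact h1

end SpectraFW

namespace SpectraFW

variable {n r : ℕ} {A B X Y D : Mat n} {f : Mat n → ℝ} {g : Mat n → Mat n} {α β δ lam : ℝ}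

/-! ### Continuity and compactness -/

instance : NormalSpace (Mat n) := inferInstanceAs (NormalSpace (Fin n → Fin n → ℝ))

instance : TietzeExtension.{0, 0} (Mat n) :=
  inferInstanceAs (TietzeExtension.{0, 0} (Fin n → Fin n → ℝ))

lemma continuous_quad (v : Vec n) : Continuous fun A : Mat n => quad A v := by
  unfold quad
  fun_prop

lemma continuous_frobInner : Continuous fun p : Mat n × Mat n => frobInner p.1 p.2 := by
  simp only [frobInner_eq_sum]
  fun_prop

lemma continuous_frobNorm : Continuous fun A : Mat n => frobNorm A :=
  Real.continuous_sqrt.comp (continuous_frobInner.comp (continuous_id.prodMk continuous_id))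

lemma abs_apply_le_frobNorm (A : Mat n) (i j : Fin n) : |A i j| ≤ frobNorm A := by
  refine Real.abs_le_sqrt ?_
  rw [frobInner_eq_sum, sq]
  exact (Finset.single_le_sum (f := fun i => A i j * A i j) (fun k _ => mul_self_nonneg (A k j))
    (Finset.mem_univ i)).trans (Finset.single_le_sum (f := fun j => ∑ i, A i j * A i j)
      (fun k _ => Finset.sum_nonneg fun l _ => mul_self_nonneg (A l k)) (Finset.mem_univ j))

lemma isClosed_spectrahedron : IsClosed (spectrahedron n) := by
  have : spectrahedron n = {X | X.transpose = X} ∩ (⋂ v : Vec n, {X | 0 ≤ quad X v})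
      ∩ {X | X.trace = 1} := by
    ext X
    rw [mem_spectrahedron_iff]
    simp only [Set.mem_inter_iff, Set.mem_ofPred_eq, Set.mem_iInter, Matrix.IsSymm, and_assoc]
  rw [this]
  refine IsClosed.inter (IsClosed.inter (isClosed_eq (by fun_prop) continuous_id) ?_)
    (isClosed_eq (by fun_prop) continuous_const)
  exact isClosed_iInter fun v => isClosed_le continuous_const (continuous_quad v)

lemma isCompact_spectrahedron : IsCompact (spectrahedron n) := by
  have hK : IsCompact (Set.univ.pi fun _ : Fin n => Set.univ.pi fun _ : Fin n =>
      Set.Icc (-1 : ℝ) 1) :=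
    isCompact_univ_pi fun _ => isCompact_univ_pi fun _ => isCompact_Icc
  refine IsCompact.of_isClosed_subset hK isClosed_spectrahedron fun X hX i _ j _ => ?_
  exact abs_le.1 ((abs_apply_le_frobNorm X i j).trans (frobNorm_le_one hX))

lemma continuousWithinAt_of_frobNorm_le {s : Set (Mat n)} {K : ℝ} {k : Mat n → ℝ}
    (h : ∀ Y ∈ s, |k Y - k X| ≤ K * frobNorm (Y - X)) : ContinuousWithinAt k s X := by
  rw [ContinuousWithinAt, tendsto_iff_dist_tendsto_zero]
  have h0 : Filter.Tendsto (fun Y : Mat n => K * frobNorm (Y - X)) (nhdsWithin X s) (nhds 0) := by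
    have : Continuous fun Y : Mat n => K * frobNorm (Y - X) :=
      continuous_const.mul (continuous_frobNorm.comp (continuous_id.sub continuous_const))
    have h1 := (this.tendsto X).mono_left (nhdsWithin_le_nhds (s := s))
    simpa [frobNorm] using h1
  refine squeeze_zero' (Filter.Eventually.of_forall fun _ => dist_nonneg) ?_ h0
  filter_upwards [self_mem_nhdsWithin] with Y hY using h Y hY

lemma IsSmoothConvex.continuousOn_grad (hf : IsSmoothConvex f g β) :
    ContinuousOn g (spectrahedron n) := by
  intro X hX
  refine tendsto_pi_nhds.2 fun i => tendsto_pi_nhds.2 fun j => ?_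
  exact continuousWithinAt_of_frobNorm_le (k := fun Y => g Y i j) fun Y hY =>
    (abs_apply_le_frobNorm (g Y - g X) i j).trans (hf.smooth Y hY X hX)

lemma IsSmoothConvex.continuousOn (hf : IsSmoothConvex f g β) :
    ContinuousOn f (spectrahedron n) := by
  let _ : NormedAddCommGroup (Mat n) := Matrix.normedAddCommGroup
  let _ : NormedSpace ℝ (Mat n) := Matrix.normedSpace
  intro X hX
  have h := (hf.gradient X hX).2
  exact (HasFDerivWithinAt.continuousWithinAt h).mono fun Y hY => (mem_spectrahedron_iff.1 hY).1

/-- Tietze extension. Nothing is known about `f` and its gradient map outside the spectrahedron,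
which the iterates may leave on a null set; the continuous extensions make the derived random
variables genuinely measurable. -/
lemma exists_continuous_eqOn {W : Type*} [TopologicalSpace W] [TietzeExtension.{0} W]
    {k : Mat n → W} (hk : ContinuousOn k (spectrahedron n)) :
    ∃ K : Mat n → W, Continuous K ∧ Set.EqOn K k (spectrahedron n) := by
  obtain ⟨K, hK⟩ := ContinuousMap.exists_restrict_eq isClosed_spectrahedron
    ⟨(spectrahedron n).domRestrict k, continuousOn_iff_continuous_domRestrict.1 hk⟩
  exact ⟨K, K.continuous, fun X hX => DFunLike.congr_fun hK ⟨X, hX⟩⟩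

/-! ### The gradient bound -/

lemma abs_quad_le_specNorm (A : Mat n) (v : Vec n) : |quad A v| ≤ specNorm A * ‖v‖ ^ 2 := by
  have h1 : quad A v = inner ℝ v (Matrix.toEuclideanCLM (𝕜 := ℝ) A v) := quad_eq_inner A v
  rw [h1]
  refine (abs_real_inner_le_norm _ _).trans ?_
  have h2 := (Matrix.toEuclideanCLM (𝕜 := ℝ) A).le_opNorm v
  calc _ ≤ ‖v‖ * (specNorm A * ‖v‖) := mul_le_mul_of_nonneg_left h2 (norm_nonneg v)
    _ = _ := by ring

lemma continuous_specNorm : Continuous fun A : Mat n => specNorm A := by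
  let T : Mat n →ₗ[ℝ] (Vec n →L[ℝ] Vec n) :=
    (Matrix.toEuclideanCLM (𝕜 := ℝ) (n := Fin n)).toAlgEquiv.toLinearMap
  exact (LinearMap.continuous_of_finiteDimensional T).norm

lemma IsSmoothConvex.specNorm_le_gradBound (hf : IsSmoothConvex f g β) (hX : X ∈ spectrahedron n) :
    specNorm (g X) ≤ gradBound g :=
  le_csSup (isCompact_spectrahedron.bddAbove_image
    (continuous_specNorm.comp_continuousOn hf.continuousOn_grad)) ⟨X, hX, rfl⟩

/-- The gap is attained as a difference of two eigenvalues of a gradient, each of absolute value at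
most the spectral norm. -/
lemma gap_le_gradBound (hf : IsSmoothConvex f g β) (hs : StrictComplementarity f g r δ)
    (hrn : r < n) : δ ≤ 2 * gradBound g := by
  have hr := hs.one_le
  obtain ⟨Y, hY, hδ⟩ := (hs.gap hrn).2.1
  have hDh := hf.isSymm hY.1
  obtain ⟨e, he⟩ := exists_eigenbasis hDh
  have h1 := hf.specNorm_le_gradBound hY.1
  have h2 : ∀ i, |quad (g Y) (e i)| ≤ gradBound g := fun i => by
    have := abs_quad_le_specNorm (g Y) (e i)
    rw [e.orthonormal.1, one_pow, mul_one] at this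
    exact this.trans h1
  have h3 := (abs_le.1 (h2 ⟨n - r - 1, by omega⟩)).2
  have h4 := (abs_le.1 (h2 ⟨n - r, by omega⟩)).1
  rw [he.quad_basis] at h3 h4
  simp only [Nat.sub_add_cancel (show 1 ≤ n - r by omega)] at h3 h4
  simp only at hδ
  linarith

/-! ### Measurability of spectral quantities -/

/-- The symmetric part of a matrix. -/
noncomputable def symPart (A : Mat n) : Mat n := (1 / 2 : ℝ) • (A + A.transpose)

lemma symPart_isHermitian (A : Mat n) : (symPart A).IsHermitian := by
  rw [Matrix.isHermitian_iff_isSymm, Matrix.IsSymm, symPart, Matrix.transpose_smul,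
    Matrix.transpose_add, Matrix.transpose_transpose, add_comm]

lemma symPart_eq (hA : A.IsHermitian) : symPart A = A := by
  rw [Matrix.isHermitian_iff_isSymm, Matrix.IsSymm] at hA
  rw [symPart, hA, ← two_smul ℝ, smul_smul]
  norm_num

lemma continuous_symPart : Continuous (symPart : Mat n → Mat n) := by
  unfold symPart
  fun_prop

/-- Weyl's inequality gives a Lipschitz bound. Symmetrizing first avoids the default value `0` of
`eig` at matrices that are not symmetric. -/
lemma continuous_eig_symPart {k : ℕ} (hk : 1 ≤ k) (hkn : k ≤ n) :
    Continuous fun A : Mat n => eig (symPart A) k := by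
  rw [continuous_iff_continuousAt]
  intro A
  rw [ContinuousAt, tendsto_iff_dist_tendsto_zero]
  have h0 : Filter.Tendsto (fun B : Mat n => frobNorm (symPart B - symPart A)) (nhds A)
      (nhds 0) := by
    have : Continuous fun B : Mat n => frobNorm (symPart B - symPart A) :=
      continuous_frobNorm.comp (continuous_symPart.sub continuous_const)
    simpa [frobNorm] using this.tendsto A
  refine squeeze_zero (fun _ => dist_nonneg) (fun B => ?_) h0
  have h1 := eig_le_eig_add_frobNorm (symPart_isHermitian A) (symPart_isHermitian B) hk hkn
  have h2 := eig_le_eig_add_frobNorm (symPart_isHermitian B) (symPart_isHermitian A) hk hkn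
  rw [frobNorm_sub_comm] at h1
  rw [Real.dist_eq, abs_le]
  constructor <;> linarith

lemma toEuclideanLin_aeval {v : Vec n} {a : ℝ} (h : Matrix.toEuclideanLin A v = a • v)
    (p : Polynomial ℝ) :
    Matrix.toEuclideanLin (Polynomial.aeval A p) v = p.eval a • v := by
  induction p using Polynomial.induction_on' with
  | add p q hp hq => rw [map_add, map_add, LinearMap.add_apply, hp, hq, Polynomial.eval_add, add_smul]
  | monomial k c =>
    rw [Polynomial.aeval_monomial, Polynomial.eval_monomial, Algebra.algebraMap_eq_smul_one,
      smul_mul_assoc, one_mul, map_smul, LinearMap.smul_apply, mul_smul]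
    congr 1
    induction k with
    | zero => simp
    | succ k ih => rw [pow_succ, toEuclideanLin_mul_apply, h, map_smul, ih, smul_smul, pow_succ,
        mul_comm]

lemma IsEigenbasis.aeval_sub_eq {e : OrthonormalBasis (Fin n) ℝ (Vec n)} (he : IsEigenbasis D e)
    (t : ℝ) (p : Polynomial ℝ) :
    Polynomial.aeval (D - t • (1 : Mat n)) p
      = ∑ i : Fin n, p.eval (eig D (i + 1) - t) • outer (e i) :=
  eq_of_act_basis e fun i => by
    rw [toEuclideanLin_sum_outer e fun i : Fin n => p.eval (eig D (i + 1) - t)]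
    apply toEuclideanLin_aeval
    rw [map_sub, map_smul, LinearMap.sub_apply, LinearMap.smul_apply, he, sub_smul]
    congr 2
    simp

/-- Polynomials converging pointwise to the positive part. -/
lemma exists_polynomial_tendsto_posPart : ∃ p : ℕ → Polynomial ℝ, ∀ x : ℝ,
    Filter.Tendsto (fun k => (p k).eval x) Filter.atTop (nhds (max x 0)) := by
  have h : ∀ k : ℕ, ∃ p : Polynomial ℝ, ∀ x ∈ Set.Icc (-(k : ℝ)) k,
      |p.eval x - max x 0| < 1 / ((k : ℝ) + 1) := fun k =>
    exists_polynomial_near_of_continuousOn _ _ (fun x => max x 0) (by fun_prop) _ (by positivity)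
  choose p hp using h
  refine ⟨p, fun x => ?_⟩
  rw [tendsto_iff_dist_tendsto_zero]
  refine squeeze_zero' (Filter.Eventually.of_forall fun _ => dist_nonneg) ?_
    tendsto_one_div_add_atTop_nhds_zero_nat
  obtain ⟨K, hK⟩ := exists_nat_ge |x|
  filter_upwards [Filter.eventually_ge_atTop K] with k hk
  have hk' : |x| ≤ k := hK.trans (by exact_mod_cast hk)
  exact (hp k x (abs_le.1 hk')).le

/-- The positive part is a pointwise limit of polynomials in `D - t`, which are continuous in `(D,
t)`; the eigenbasis chosen in `posExcess` plays no role. -/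
lemma stronglyMeasurable_posExcess {Ω : Type*} {m : MeasurableSpace Ω} {D : Ω → Mat n} {t : Ω → ℝ}
    (hD : StronglyMeasurable D) (hDh : ∀ ω, (D ω).IsHermitian) (ht : StronglyMeasurable t)
    (i j : Fin n) : StronglyMeasurable fun ω => posExcess (D ω) (t ω) i j := by
  obtain ⟨p, hp⟩ := exists_polynomial_tendsto_posPart
  refine stronglyMeasurable_of_tendsto (f := fun k ω =>
    (Polynomial.aeval (D ω - t ω • (1 : Mat n)) (p k)) i j) Filter.atTop (fun k => ?_) ?_
  · have hc : Continuous fun q : Mat n × ℝ =>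
        (Polynomial.aeval (q.1 - q.2 • (1 : Mat n)) (p k)) i j := by
      have h1 : Continuous fun M : Mat n => (Polynomial.aeval M (p k)) :=
        (p k).continuous_aeval
      exact ((h1.comp (by fun_prop : Continuous fun q : Mat n × ℝ =>
        q.1 - q.2 • (1 : Mat n))).matrix_elem i j)
    exact hc.comp_stronglyMeasurable (hD.prodMk ht)
  · rw [tendsto_pi_nhds]
    intro ω
    obtain ⟨e, he, hB⟩ := exists_posExcess_eq (hDh ω)
    simp only [hB, he.aeval_sub_eq, Matrix.sum_apply, Matrix.smul_apply, smul_eq_mul]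
    exact tendsto_finsetSum _ fun k _ => (hp _).mul_const _

lemma quad_eq_double_sum (A : Mat n) (v : Vec n) : quad A v = ∑ i, ∑ j, A i j * (v i * v j) := by
  simp only [quad, dotProduct, Matrix.mulVec, Finset.mul_sum]
  exact Finset.sum_congr rfl fun i _ => Finset.sum_congr rfl fun j _ => by ring

end SpectraFW

namespace SpectraFW

variable {n r : ℕ} {f : Mat n → ℝ} {g : Mat n → Mat n} {α β δ lam : ℝ}

/-! ### The expected rate -/

lemma stronglyMeasurable_indicator_quad {Ω : Type*} {m : MeasurableSpace Ω} {B : Ω → Mat n}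
    (hB : ∀ i j, StronglyMeasurable fun ω => B ω i j) {A : Set Ω} (hA : MeasurableSet A) :
    StronglyMeasurable fun p : Ω × Vec n => A.indicator (fun ω => quad (B ω) p.2) p.1 := by
  have h : (fun p : Ω × Vec n => A.indicator (fun ω => quad (B ω) p.2) p.1)
      = fun p => ∑ i, ∑ j, A.indicator (fun ω => B ω i j) p.1 * (p.2 i * p.2 j) := by
    ext p
    by_cases hp : p.1 ∈ A
    · simp [hp, quad_eq_double_sum]
    · simp [hp]
  rw [h]
  refine Finset.stronglyMeasurable_fun_sum _ fun i _ => Finset.stronglyMeasurable_fun_sum _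
    fun j _ => ?_
  refine (((hB i j).indicator hA).comp_measurable measurable_fst).mul ?_
  exact (by fun_prop : Continuous fun y : Vec n => y i * y j).stronglyMeasurable.comp_measurable
    measurable_snd

lemma IsSmoothConvex.exists_abs_sub_optVal_le (hf : IsSmoothConvex f g β) :
    ∃ K : ℝ, ∀ X ∈ spectrahedron n, |f X - optVal f| ≤ K := by
  obtain ⟨K, hK⟩ := isCompact_spectrahedron.exists_bound_of_continuousOn
    (hf.continuousOn.sub (continuousOn_const (c := optVal f)))
  exact ⟨K, fun X hX => hK X hX⟩

namespace IsRandomRun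

variable {Ω : Type*} [mΩ : MeasurableSpace Ω] {μ : Measure Ω} [IsProbabilityMeasure μ]
  {X : ℕ → Ω → Mat n} {v u : ℕ → Ω → Vec n} {info : ℕ → MeasurableSpace Ω}

lemma integrable_comp (hf : IsSmoothConvex f g β) (hrun : IsRandomRun μ f g β X v u info)
    {F : Mat n → ℝ} (hF : Continuous F) (hFf : Set.EqOn F f (spectrahedron n)) {t : ℕ}
    (ht : 1 ≤ t) : Integrable (fun ω => F (X t ω) - optVal f) μ := by
  obtain ⟨K, hK⟩ := hf.exists_abs_sub_optVal_le
  have hm : StronglyMeasurable (fun ω => F (X t ω) - optVal f) :=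
    ((hF.sub continuous_const).comp_stronglyMeasurable (hrun.iterate_measurable t ht)).mono
      (hrun.info_le t)
  refine Integrable.of_bound (C := K) hm.aestronglyMeasurable ?_
  filter_upwards [hrun.trajectory] with ω hω
  rw [hFf (hω.mem ht)]
  exact hK _ (hω.mem ht)

lemma integrable (hf : IsSmoothConvex f g β) (hrun : IsRandomRun μ f g β X v u info) {t : ℕ}
    (ht : 1 ≤ t) : Integrable (fun ω => f (X t ω) - optVal f) μ := by
  obtain ⟨F, hF, hFf⟩ := exists_continuous_eqOn hf.continuousOn
  refine (hrun.integrable_comp hf hF hFf ht).congr ?_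
  filter_upwards [hrun.trajectory] with ω hω
  rw [hFf (hω.mem ht)]

/-- If the iterate satisfies a deterministic bound in terms of a quadratic form of the drawn
vector, the conditional expectation satisfies the corresponding bound in terms of its mean. -/
lemma condExp_le_sub_integral (hf : IsSmoothConvex f g β) (hrun : IsRandomRun μ f g β X v u info)
    {t : ℕ} (ht : 1 ≤ t) {H : Ω → ℝ} (hH : StronglyMeasurable[info t] H) (hHint : Integrable H μ)
    (hHf : ∀ᵐ ω ∂μ, H ω = f (X t ω) - optVal f)
    {B : Ω → Mat n} (hB : ∀ i j, StronglyMeasurable[info t] fun ω => B ω i j)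
    (hB0 : ∀ ω y, 0 ≤ quad (B ω) y) {A : Set Ω}
    (hA : MeasurableSet[info t] A) (hAd : ∀ ω ∈ A, ¬ DropTaken f (X t ω) (v t ω)) {C : ℝ}
    (hC : 0 < C)
    (hle : ∀ᵐ ω ∂μ, ω ∈ A →
      f (X (t + 1) ω) - optVal f ≤ H ω - C * quad (B ω) (u t ω)) :
    ∀ᵐ ω ∂μ, ω ∈ A → (μ[fun ω' => f (X (t + 1) ω') - optVal f | info t]) ω
      ≤ H ω - C * ∫ y, quad (B ω) y ∂(uniformSphere (im (X t ω))) := by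
  have hm := hrun.info_le t
  have hmem : ∀ᵐ ω ∂μ, ∀ s, 1 ≤ s → X s ω ∈ spectrahedron n := by
    filter_upwards [hrun.trajectory] with ω hω s hs using hω.mem hs
  let φ : Ω × Vec n → ℝ := fun p => A.indicator (fun ω => quad (B ω) p.2) p.1
  have hφ : StronglyMeasurable[(info t).prod inferInstance] φ :=
    @stronglyMeasurable_indicator_quad n Ω (info t) B hB A hA
  -- The assumed decrease bounds the quadratic form: `C` times it is at most `H`, because the next
  -- value is not below the optimum.
  have hφint : Integrable (fun ω => φ (ω, u t ω)) μ := by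
    obtain ⟨K, hK⟩ := hf.exists_abs_sub_optVal_le
    have hmeas : Measurable[mΩ, (info t).prod inferInstance] fun ω => (ω, u t ω) :=
      (measurable_id'' hm).prodMk (hrun.draw_measurable t ht)
    refine Integrable.of_bound (C := K / C) (hφ.comp_measurable hmeas).aestronglyMeasurable ?_
    filter_upwards [hle, hmem, hHf] with ω h1 h2 h3
    have hK0 : 0 ≤ K := (abs_nonneg _).trans (hK _ (h2 t ht))
    by_cases hω : ω ∈ A
    · have h4 := h1 hω
      have h5 := (le_abs_self _).trans (hK _ (h2 t ht))
      have h6 := hf.optVal_le (h2 (t + 1) (by omega))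
      simp only [φ, Set.indicator_of_mem hω]
      rw [Real.norm_eq_abs, abs_of_nonneg (hB0 _ _), le_div_iff₀ hC]
      linarith
    · simp only [φ, Set.indicator_of_notMem hω, norm_zero]
      positivity
  have h1 := condExp_le_of_le_on hA (hrun.integrable hf (t := t + 1) (by omega))
    (hHint.sub (hφint.const_mul C)) hm (by
      filter_upwards [hle] with ω hω hωA
      simpa [φ, hωA] using hω hωA)
  have h2 : μ[H - (fun ω => C * φ (ω, u t ω)) | info t]
      =ᵐ[μ] H - C • μ[fun ω => φ (ω, u t ω) | info t] := by
    refine (condExp_sub hHint (hφint.const_mul C) _).trans ?_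
    rw [condExp_of_stronglyMeasurable hm hH hHint]
    exact (Filter.EventuallyEq.refl _ H).sub (condExp_smul C (fun ω => φ (ω, u t ω)) (info t))
  have h3 := condExp_eq_integral_of_condProb (μ := μ) (m := info t) hm (hrun.draw_measurable t ht)
    (σ := fun ω => uniformSphere (im (X t ω)))
    (N := {ω | ¬ DropTaken f (X t ω) (v t ω)})
    (by
      filter_upwards [hmem] with ω hω _
      exact isProbabilityMeasure_uniformSphere (by rw [finrank_im]; exact rank_pos (hω t ht)))
    (fun B hB => hrun.draw_uniform t ht B hB) hφ hφint
  filter_upwards [h1, h2, h3] with ω hω1 hω2 hω3 hωA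
  have h4 := hω1 hωA
  have h5 := hω3 (hAd ω hωA)
  simp only [φ, Set.indicator_of_mem hωA] at h5
  refine h4.trans (le_of_eq ?_)
  refine Eq.trans hω2 ?_
  simp only [Pi.sub_apply, Pi.smul_apply, smul_eq_mul]
  rw [← h5]

theorem expected_rate (hf : IsSmoothConvex f g β) (hβ : 0 < β) (hq : QuadraticGrowth f α)
    (hs : StrictComplementarity f g r δ)
    (hlam : IsLeast ((fun Y => eig Y r) '' minimizers f) lam) (hr : 2 ≤ r) (hrn : r < n)
    (hrun : IsRandomRun μ f g β X v u info) {t : ℕ} (ht : 1 ≤ t) :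
    ∀ᵐ ω ∂μ, ¬ DropTaken f (X t ω) (v t ω) →
      f (X t ω) - optVal f < 1 / 20000 * min (α * δ ^ 2 / β ^ 2) (min (δ ^ 2 / β) (min δ
        (min (α * lam ^ 2) (δ ^ 3 / β ^ 2)))) →
      (μ[fun ω' => f (X (t + 1) ω') - optVal f | info t]) ω
        ≤ (f (X t ω) - optVal f) *
          (1 - 1 / (r : ℝ) * min (δ / (48 * gradBound g) * min (δ / (3 * β)) lam)
            (α / (512 * β))) := by
  have hα := hq.1
  have hδ := (hs.gap hrn).1
  have hr0 : (0 : ℝ) < r := by exact_mod_cast hs.one_le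
  have hlam0 : 0 < lam := by
    obtain ⟨Y₀, hY₀, rfl⟩ := hlam.1
    exact eig_pos_of_le_rank hY₀.1.1 hs.one_le (hs.rank_eq Y₀ hY₀).ge
  have hδG := gap_le_gradBound hf hs hrn
  have hG : 0 < gradBound g := by linarith
  obtain ⟨F, hF, hFf⟩ := exists_continuous_eqOn hf.continuousOn
  obtain ⟨G, hGc, hGg⟩ := exists_continuous_eqOn hf.continuousOn_grad
  have hXm := hrun.iterate_measurable t ht
  have hm := hrun.info_le t
  set M := min (δ / (3 * β)) lam with hM
  have hM0 : 0 < M := lt_min (by positivity) hlam0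
  set E := 1 / 20000 * min (α * δ ^ 2 / β ^ 2) (min (δ ^ 2 / β) (min δ
        (min (α * lam ^ 2) (δ ^ 3 / β ^ 2)))) with hE
  let H : Ω → ℝ := fun ω => F (X t ω) - optVal f
  let D : Ω → Mat n := fun ω => symPart (G (X t ω))
  let τ : Ω → ℝ := fun ω => eig (D ω) n + δ / 10
  let B : Ω → Mat n := fun ω => posExcess (D ω) (τ ω)
  have hH : StronglyMeasurable[info t] H := (hF.sub continuous_const).comp_stronglyMeasurable hXm
  have hHint : Integrable H μ := hrun.integrable_comp hf hF hFf ht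
  have hHf : ∀ᵐ ω ∂μ, H ω = f (X t ω) - optVal f := by
    filter_upwards [hrun.trajectory] with ω hω
    simp only [H, hFf (hω.mem ht)]
  have hDm : StronglyMeasurable[info t] D :=
    (continuous_symPart.comp hGc).comp_stronglyMeasurable hXm
  have hτ : StronglyMeasurable[info t] τ :=
    ((continuous_eig_symPart (k := n) (by omega) le_rfl).comp hGc |>.add
      continuous_const).comp_stronglyMeasurable hXm
  have hB : ∀ i j, StronglyMeasurable[info t] fun ω => B ω i j :=
    @stronglyMeasurable_posExcess n Ω (info t) D τ hDm (fun ω => symPart_isHermitian _) hτ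
  have hXij : ∀ i j, StronglyMeasurable[info t] fun ω => X t ω i j := fun i j =>
    (by fun_prop : Continuous fun A : Mat n => A i j).comp_stronglyMeasurable hXm
  have hb : StronglyMeasurable[info t] fun ω => frobInner (B ω) (X t ω) := by
    simp only [frobInner_eq_sum]
    exact Finset.stronglyMeasurable_fun_sum _ fun j _ => Finset.stronglyMeasurable_fun_sum _
      fun i _ => (hB i j).mul (hXij i j)
  have hBeq : ∀ᵐ ω ∂μ, B ω = posExcess (g (X t ω)) (eig (g (X t ω)) n + δ / 10) := by
    filter_upwards [hrun.trajectory] with ω hω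
    have : D ω = g (X t ω) := by
      simp only [D]
      rw [hGg (hω.mem ht), symPart_eq (hf.isSymm (hω.mem ht))]
    simp only [B, τ, this]
  have hN : MeasurableSet[info t] {ω | ¬ DropTaken f (X t ω) (v t ω)} :=
    (hrun.drop_measurable t ht).compl
  have hHE : MeasurableSet[info t] {ω | H ω < E} :=
    hH.measurableSet_lt stronglyMeasurable_const
  -- The case distinction is decided by the information before the draw, so each case can be treated
  -- on its own event.
  have hcmp : MeasurableSet[info t] {ω | 44 / 100 * H ω ≤ frobInner (B ω) (X t ω)} :=
    (hH.const_mul (44 / 100)).measurableSet_le hb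
  have hA1 := (hN.inter hHE).inter hcmp
  have hA2 := (hN.inter hHE).inter hcmp.compl
  have hstep : ∀ᵐ ω ∂μ, ω ∈ {ω | ¬ DropTaken f (X t ω) (v t ω)} ∩ {ω | H ω < E} →
      (X t ω).rank ≤ r ∧ (44 / 100 * H ω ≤ frobInner (B ω) (X t ω) →
        f (X (t + 1) ω) - optVal f ≤ H ω - 1 / 8 * M * quad (B ω) (u t ω)) ∧
      (frobInner (B ω) (X t ω) < 44 / 100 * H ω →
        f (X (t + 1) ω) - optVal f ≤ (1 - α / (32 * β * r)) * H ω) := by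
    filter_upwards [hrun.trajectory, hHf, hBeq] with ω hω h1 h2 h3
    have h4 : f (X t ω) - optVal f < E := by rw [← h1]; exact h3.2
    obtain ⟨h5, h6, h7⟩ := local_step hf hβ hq hs hlam hr hrn (hω.mem ht) (hω.2 t ht) h3.1
      (isSmallGap_of_lt h4)
    rw [← h2, ← h1] at h6 h7
    refine ⟨h5, fun h => ?_, fun h => ?_⟩
    · have := h6 h
      rw [h1]
      linarith
    · have := h7 h
      have h8 : (1 - α / (32 * β * r)) * H ω = H ω - α * H ω / (32 * β * r) := by ring
      rw [h8]
      linarith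
  have hc1 := hrun.condExp_le_sub_integral hf ht hH hHint hHf hB
    (fun ω y => posExcess_quad_nonneg _ _ y) hA1 (fun ω hω => hω.1.1) (C := 1 / 8 * M)
    (by positivity) (by
      filter_upwards [hstep] with ω hω hωA using (hω hωA.1).2.1 hωA.2)
  have hc2 := condExp_le_of_le_on hA2 (hrun.integrable hf (t := t + 1) (by omega))
    (hHint.const_mul (1 - α / (32 * β * r))) hm (by
      filter_upwards [hstep] with ω hω hωA using (hω hωA.1).2.2 (not_le.1 hωA.2))
  have hc3 : μ[fun ω => (1 - α / (32 * β * r)) * H ω | info t]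
      = fun ω => (1 - α / (32 * β * r)) * H ω :=
    condExp_of_stronglyMeasurable hm (hH.const_mul _) (hHint.const_mul _)
  rw [hc3] at hc2
  filter_upwards [hc1, hc2, hstep, hHf, hrun.trajectory] with ω h1 h2 h3 h4 hω hd hlt
  have hX := hω.mem ht
  have hH0 : 0 ≤ H ω := by rw [h4]; exact sub_nonneg.2 (hf.optVal_le hX)
  rw [← h4] at hlt ⊢
  obtain ⟨hrk, -⟩ := h3 ⟨hd, hlt⟩
  set R := min (δ / (48 * gradBound g) * M) (α / (512 * β)) with hR
  -- From `δ ≤ 2G`. It suffices since the pairwise gain has the factor `1/8 · 44/100 > 1/24`.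
  have hR1 : R ≤ 1 / 24 * M := by
    refine (min_le_left _ _).trans (mul_le_mul_of_nonneg_right ?_ hM0.le)
    rw [div_le_iff₀ (by positivity)]
    linarith
  have hR2 : R ≤ α / (512 * β) := min_le_right _ _
  have hgoal : H ω * (1 - 1 / (r : ℝ) * R) = H ω - R * (H ω / r) := by ring
  rw [hgoal]
  have hHr : 0 ≤ H ω / r := by positivity
  by_cases hcase : 44 / 100 * H ω ≤ frobInner (B ω) (X t ω)
  · refine (h1 ⟨⟨hd, hlt⟩, hcase⟩).trans (sub_le_sub_left ?_ _)
    obtain ⟨e, -, hBe⟩ := exists_posExcess_eq (symPart_isHermitian (G (X t ω)))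
    have h5 := le_integral_quad_uniformSphere hX e
      (d := fun i => max (eig (D ω) (i + 1) - τ ω) 0) (fun i => le_max_right _ _)
    have h6 : (∑ i : Fin n, max (eig (D ω) (i + 1) - τ ω) 0 • outer (e i)) = B ω :=
      (hBe (τ ω)).symm
    rw [h6] at h5
    have hk0 : (0 : ℝ) < (X t ω).rank := by exact_mod_cast rank_pos hX
    -- The bound `rank (X t) ≤ r` replaces the dimension of the sampled sphere by `r`.
    have h7 : 44 / 100 * (H ω / r) ≤ frobInner (B ω) (X t ω) / (X t ω).rank := by
      rw [← mul_div_assoc]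
      exact div_le_div₀ (le_trans (by positivity) hcase) hcase hk0 (by exact_mod_cast hrk)
    calc R * (H ω / r) ≤ 1 / 24 * M * (H ω / r) := mul_le_mul_of_nonneg_right hR1 hHr
      _ ≤ 1 / 8 * M * (44 / 100 * (H ω / r)) := by
        have := mul_nonneg hM0.le hHr
        linarith
      _ ≤ _ := mul_le_mul_of_nonneg_left (h7.trans h5) (by positivity)
  · refine (h2 ⟨⟨hd, hlt⟩, hcase⟩).trans ?_
    have h8 : (1 - α / (32 * β * r)) * H ω = H ω - α / (32 * β) * (H ω / r) := by
      field_simp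
    rw [h8]
    refine sub_le_sub_left (mul_le_mul_of_nonneg_right (hR2.trans ?_) hHr) _
    gcongr
    norm_num

end IsRandomRun

end SpectraFW
-- The main theorem
theorem theorem2 :
    ∃ c c₁ c₂ : ℝ, 0 < c ∧ 0 < c₁ ∧ 0 < c₂ ∧
      ∀ (n : ℕ) (f : Mat n → ℝ) (g : Mat n → Mat n) (β : ℝ), IsSmoothConvex f g β →
        -- monotonicity, sublinear rate and number of drop steps, for every trajectory
        (∀ (X : ℕ → Mat n) (v u : ℕ → Vec n), IsTrajectory f g β X v u →
          (∀ t : ℕ, 1 ≤ t → f (X (t + 1)) - optVal f ≤ f (X t) - optVal f) ∧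
          (∀ t : ℕ, (X 1).rank + 2 ≤ t →
            f (X t) - optVal f ≤ 8 * β / ((t : ℝ) - ((X 1).rank : ℝ) + 4)) ∧
          (∀ t : ℕ, 1 ≤ t →
            (({s : ℕ | 1 ≤ s ∧ s < t ∧ DropTaken f (X s) (v s)}.ncard : ℕ) : ℝ)
              ≤ ((t : ℝ) + ((X 1).rank : ℝ) - 2) / 2)) ∧
        -- linear rates
        (∀ (α : ℝ) (r : ℕ) (δ lam : ℝ), 0 < β → QuadraticGrowth f α →
          StrictComplementarity f g r δ →
          IsLeast ((fun Y => eig Y r) '' minimizers f) lam →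
          (∀ (X : ℕ → Mat n) (v u : ℕ → Vec n), IsTrajectory f g β X v u →
            ∀ t : ℕ, 1 ≤ t → ¬ DropTaken f (X t) (v t) →
              (r = 1 → f (X t) - optVal f < c₁ * (α * δ ^ 2 / β ^ 2) →
                f (X (t + 1)) - optVal f
                  ≤ (f (X t) - optVal f) * (1 - min (δ / (12 * β)) (1 / 2))) ∧
              (r = n → f (X t) - optVal f < c₂ * (α * lam ^ 2) →
                f (X (t + 1)) - optVal f
                  ≤ (f (X t) - optVal f) * (1 - α / (512 * β * (n : ℝ))))) ∧
          (2 ≤ r → r < n →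
            ∀ (Ω : Type*) [MeasurableSpace Ω] (μ : Measure Ω) [IsProbabilityMeasure μ]
              (X : ℕ → Ω → Mat n) (v u : ℕ → Ω → Vec n) (info : ℕ → MeasurableSpace Ω),
              IsRandomRun μ f g β X v u info →
              ∀ t : ℕ, 1 ≤ t →
                Integrable (fun ω => f (X (t + 1) ω) - optVal f) μ ∧
                ∀ᵐ ω ∂μ, ¬ DropTaken f (X t ω) (v t ω) →
                  f (X t ω) - optVal f
                    < c * min (α * δ ^ 2 / β ^ 2) (min (δ ^ 2 / β) (min δ
                        (min (α * lam ^ 2) (δ ^ 3 / β ^ 2)))) →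
                  (μ[fun ω' => f (X (t + 1) ω') - optVal f | info t]) ω
                    ≤ (f (X t ω) - optVal f) *
                      (1 - 1 / (r : ℝ) * min (δ / (48 * gradBound g) * min (δ / (3 * β)) lam)
                        (α / (512 * β))))) := by
  refine ⟨1 / 20000, 1 / 20000, 1 / 20000, by norm_num, by norm_num, by norm_num,
    fun n f g β hf => ⟨fun X v u h => ⟨fun t ht => ?_, fun t ht => ?_, fun t ht => ?_⟩,
    fun α r δ lam hβ hq hs hlam => ⟨fun X v u h t ht hd => ⟨?_, ?_⟩,
    fun hr hrn Ω _ μ _ X v u info hrun t ht => ⟨?_, ?_⟩⟩⟩⟩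
  · exact sub_le_sub_right ((h.2 t ht).le_self hf (h.mem ht)) _
  · exact h.sub_optVal_le_div hf ht
  · have h1 : 2 * ((IsTrajectory.dropSet f X v t).ncard : ℝ) + 2 ≤ (X 1).rank + t := by
      exact_mod_cast h.two_mul_ncard_le ht
    rw [IsTrajectory.dropSet] at h1
    linarith
  · rintro rfl hsmall
    exact rate_rank_one hf hβ hq hs (h.mem ht) (h.2 t ht) hd hsmall
  · rintro rfl hsmall
    exact rate_full_rank hf hβ hq hs hlam (h.mem ht) (h.2 t ht) hd hsmall
  · exact hrun.integrable hf (by omega)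
  · exact hrun.expected_rate hf hβ hq hs hlam hr hrn ht
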